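/- **Setting.** Let $(\overline M,\overline J,\overline g)$ be a Kähler–Norden manifold of dimension $2n\ge 4$: $\overline M$ is a smooth manifold with a semi-Riemannian metric $\overline g$ and a smooth almost complex structure $\overline J$ such that $\overline J^2=-1$, $\overline g(\overline JX,\overline JY)=-\overline g(X,Y)$ and $\overline\nabla\,\overline J=0$, where $\overline\nabla$ is the Levi-Civita connection of $\overline g$. Put $\widetilde{\overline g}(X,Y)=\overline g(\overline JX,Y)$. For a connection $\nabla$ we write $R(X,Y,Z)=\nabla_X\nabla_YZ-\nabla_Y\nabla_XZ-\nabla_{[X,Y]}Z$ and $\mathrm{Ric}(X,Y)=\mathrm{trace}\{Z\mapsto R(Z,X,Y)\}$. Let $\overline R$ be the curvature tensor of $\overline\nabla$, with $\overline R(X,Y,Z,W)=\overline g(\overline R(X,Y,Z),W)$. Assume that $\overline M$ has constant totally real sectional curvatures $\overline\nu,\widetilde{\overline\nu}:\overline M\to\mathbb R$ with respect to $\overline g$: for every $q\in\overline M$ and every nondegenerate plane $\alpha=\mathrm{span}\{x,y\}\subset T_q\overline M$ with $\overline J\alpha\perp\alpha$, $$\frac{\overline R(x,y,y,x)}{\overline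 g(x,x)\overline g(y,y)-\overline g(x,y)^2}=\overline\nu(q),\qquad \frac{\overline R(x,y,y,\overline Jx)}{\overline g(x,x)\overline g(y,y)-\overline g(x,y)^2}=\widetilde{\overline\nu}(q).$$ Let $M$ be an (immersed) hypersurface of $\overline M$, with metrics $g,\widetilde g$ induced by $\overline g,\widetilde{\overline g}$. Assume that $(M,g)$ is lightlike, i.e. $\mathrm{Rad}\,T_pM=T_pM\cap T_pM^\perp\ne 0$ for all $p\in M$, where $\perp$ is taken with respect to $\overline g$. Let $S(TM)$ be a screen distribution, i.e. a smooth nondegenerate distribution with $TM=S(TM)\oplus TM^\perp$, and let $P:TM\to S(TM)$ be the corresponding projection. For a nowhere zero smooth section $\xi$ of $TM^\perp$ on an open set $U\subset M$ let $N$ be the unique vector field along $U$ with $$\overline g(N,\xi)=1,\qquad \overline g(N,N)=0,\qquad \overline g(N,W)=0\quad\text{for all } W\in S(TM);$$ these $N$ span the transversal line bundle $\mathrm{tr}(TM)$, and $T\overline M|_M=TM\oplus\mathrm{tr}(TM)$. The induced connection $\nabla$, the second fundamental form $B$, the operator $A_N$ and the 1-form $\tau$ are defined by this decomposition through $$\overline\nabla_XY=\nabla_XY+B(X,Y)N,\qquad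 \overline\nabla_XN=-A_NX+\tau(X)N .$$ Let $R$ and $\mathrm{Ric}$ be the curvature and Ricci tensors of $\nabla$. Assume that $M$ is radical transversal, i.e. $\overline J(TM^\perp)=\mathrm{tr}(TM)$, and totally umbilical, i.e. for every such pair $\{\xi,N\}$ on $U$ there is a smooth function $\rho$ on $U$ with $B(X,Y)=\rho\,g(X,Y)$ for all $X,Y\in\Gamma(TM|_U)$. **Theorem 3.2.** Under these assumptions $\overline\nu=0$ at every point of $M$. Moreover, for every pair $\{\xi,N\}$ on an open set $U\subset M$ as above, with $\rho$ as above and with $b:U\to\mathbb R$ the function such that $\overline J\xi=bN$, one has on $U$ that $b\neq 0$ everywhere, $$b\,\widetilde{\overline\nu}-\rho^2+\xi(\rho)+\rho\,\tau(\xi)=0,\qquad PX(\rho)+\rho\,\tau(PX)=0,$$ $$R(X,Y,Z)=\Big(\widetilde{\overline\nu}-\frac{\rho^2}{b}\Big)\big[g(X,Z)\overline J(PY)-g(Y,Z)\overline J(PX)\big]+\widetilde{\overline\nu}\,\big[\overline g(X,\overline JZ)Y-\overline g(Y,\overline JZ)X\big],$$ $$\mathrm{Ric}(X,Y)=-2(n-1)\,\widetilde{\overline\nu}\,\widetilde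 g(X,Y)+\Big(\widetilde{\overline\nu}-\frac{\rho^2}{b}\Big)\widetilde g(PX,PY)$$ for all smooth vector fields $X,Y,Z$ tangent to $M$ on $U$. -/

import Mathlib

open Bundle Manifold
open scoped Manifold ContDiff Topology

noncomputable section

namespace KNorden

section General

variable {E : Type*} [NormedAddCommGroup E] [NormedSpace ℝ E]
  {M : Type*} [TopologicalSpace M] [ChartedSpace E M]

/-- A (not necessarily continuous) vector field on `M`. -/
abbrev VField (E : Type*) [NormedAddCommGroup E] [NormedSpace ℝ E]
    (M : Type*) [TopologicalSpace M] [ChartedSpace E M] : Type _ :=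
  Π x : M, TangentSpace 𝓘(ℝ, E) x

/-- The vector field `X` is smooth on the set `U`. -/
def IsSmoothOn [IsManifold 𝓘(ℝ, E) ∞ M] (X : VField E M) (U : Set M) : Prop :=
  ContMDiffOn 𝓘(ℝ, E) 𝓘(ℝ, E).tangent ∞ (fun x ↦ (⟨x, X x⟩ : TangentBundle 𝓘(ℝ, E) M)) U

/-- The curvature `R(X, Y, Z) = ∇_X ∇_Y Z - ∇_Y ∇_X Z - ∇_[X, Y] Z` of an operator `∇` on vector
fields. Argument order of the operator: `nabla Z x v` is the value of `∇_v Z` at `x`. -/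
def curvature (nabla : VField E M → Π x : M, TangentSpace 𝓘(ℝ, E) x → TangentSpace 𝓘(ℝ, E) x)
    (X Y Z : VField E M) : VField E M := fun x ↦
  nabla (fun y ↦ nabla Z y (Y y)) x (X x) - nabla (fun y ↦ nabla Z y (X y)) x (Y x)
    - nabla Z x (VectorField.mlieBracket 𝓘(ℝ, E) X Y x)

/-- The curvature as an operation on tangent vectors at `x`: the vectors are extended to vector
fields that are smooth near `x` (with constant components in the preferred chart at `x`). -/
def curvatureAt [IsManifold 𝓘(ℝ, E) ∞ M]
    (nabla : VField E M → Π x : M, TangentSpace 𝓘(ℝ, E) x → TangentSpace 𝓘(ℝ, E) x)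
    (x : M) (u v w : TangentSpace 𝓘(ℝ, E) x) : TangentSpace 𝓘(ℝ, E) x :=
  curvature nabla (FiberBundle.extend E u) (FiberBundle.extend E v) (FiberBundle.extend E w) x

open Classical in
/-- The trace of a self-map of a vector space that is linear (`0` if the map is not linear). -/
def traceOf {V : Type*} [AddCommGroup V] [Module ℝ V] (φ : V → V) : ℝ :=
  if h : ∃ L : V →ₗ[ℝ] V, ∀ v, L v = φ v then LinearMap.trace ℝ V h.choose else 0

/-- The Ricci tensor `Ric(u, v) = trace (w ↦ R(w, u, v))` of an operator `∇` on vector fields. -/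
def ricciAt [IsManifold 𝓘(ℝ, E) ∞ M]
    (nabla : VField E M → Π x : M, TangentSpace 𝓘(ℝ, E) x → TangentSpace 𝓘(ℝ, E) x)
    (x : M) (u v : TangentSpace 𝓘(ℝ, E) x) : ℝ :=
  traceOf (fun w : TangentSpace 𝓘(ℝ, E) x ↦ curvatureAt nabla x w u v)

end General

section Ambient

variable (E : Type*) [NormedAddCommGroup E] [NormedSpace ℝ E]
  (M : Type*) [TopologicalSpace M] [ChartedSpace E M] [IsManifold 𝓘(ℝ, E) ∞ M]

/-- A smooth semi-Riemannian metric: a smooth field of nondegenerate symmetric bilinear forms. -/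
structure SemiRiemannianMetric where
  val (x : M) : TangentSpace 𝓘(ℝ, E) x →L[ℝ] TangentSpace 𝓘(ℝ, E) x →L[ℝ] ℝ
  symm (x : M) (u v : TangentSpace 𝓘(ℝ, E) x) : val x u v = val x v u
  nondeg (x : M) (u : TangentSpace 𝓘(ℝ, E) x) (hu : ∀ v, val x u v = 0) : u = 0
  contMDiff : ContMDiff 𝓘(ℝ, E) (𝓘(ℝ, E).prod 𝓘(ℝ, E →L[ℝ] E →L[ℝ] ℝ)) ∞
    (fun x ↦ TotalSpace.mk' (E →L[ℝ] E →L[ℝ] ℝ)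
      (E := fun x : M ↦ TangentSpace 𝓘(ℝ, E) x →L[ℝ] TangentSpace 𝓘(ℝ, E) x →L[ℝ] ℝ) x (val x))

variable {E M}

/-- A smooth almost complex structure that makes `g` a Norden metric:
`J ^ 2 = -1` and `g (J u, J v) = - g (u, v)`. -/
structure NordenStructure (g : SemiRiemannianMetric E M) where
  J (x : M) : TangentSpace 𝓘(ℝ, E) x →L[ℝ] TangentSpace 𝓘(ℝ, E) x
  sq (x : M) (u : TangentSpace 𝓘(ℝ, E) x) : J x (J x u) = -u
  anti (x : M) (u v : TangentSpace 𝓘(ℝ, E) x) : g.val x (J x u) (J x v) = - g.val x u v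
  contMDiff : ContMDiff 𝓘(ℝ, E) (𝓘(ℝ, E).prod 𝓘(ℝ, E →L[ℝ] E)) ∞
    (fun x ↦ TotalSpace.mk' (E →L[ℝ] E)
      (E := fun x : M ↦ TangentSpace 𝓘(ℝ, E) x →L[ℝ] TangentSpace 𝓘(ℝ, E) x) x (J x))

/-- The associated Norden metric `(u, v) ↦ g (J u, v)`. -/
def NordenStructure.assoc {g : SemiRiemannianMetric E M} (J : NordenStructure g) (x : M)
    (u v : TangentSpace 𝓘(ℝ, E) x) : ℝ :=
  g.val x (J.J x u) v

/-- `cov` is the Levi-Civita connection of `g`: a smooth, torsion-free, metric connection.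
Here `cov Y x v` is `∇_v Y` at `x`. -/
structure IsLeviCivita [FiniteDimensional ℝ E] (g : SemiRiemannianMetric E M)
    (cov : CovariantDerivative 𝓘(ℝ, E) E (TangentSpace 𝓘(ℝ, E) : M → Type _)) : Prop where
  smooth : ∀ U : Set M, IsOpen U → ContMDiffCovariantDerivativeOn E ∞ (fun Y ↦ cov Y) U
  torsion_free : ∀ (X Y : VField E M) (x : M),
    MDiffAt (T% X) x → MDiffAt (T% Y) x →
      cov Y x (X x) - cov X x (Y x) = VectorField.mlieBracket 𝓘(ℝ, E) X Y x
  metric : ∀ (Y Z : VField E M) (x : M), MDiffAt (T% Y) x → MDiffAt (T% Z) x →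
    ∀ v : TangentSpace 𝓘(ℝ, E) x,
      mvfderiv 𝓘(ℝ, E) (fun y ↦ g.val y (Y y) (Z y)) x v
        = g.val x (cov Y x v) (Z x) + g.val x (Y x) (cov Z x v)

/-- `J` is parallel with respect to `cov`. If `cov` is the Levi-Civita connection of the metric,
this says that the almost complex manifold with Norden metric is Kähler-Norden. -/
def IsParallel {g : SemiRiemannianMetric E M} (J : NordenStructure g)
    (cov : CovariantDerivative 𝓘(ℝ, E) E (TangentSpace 𝓘(ℝ, E) : M → Type _)) : Prop :=
  ∀ (Y : VField E M) (x : M), MDiffAt (T% Y) x → ∀ v : TangentSpace 𝓘(ℝ, E) x,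
    cov (fun y ↦ J.J y (Y y)) x v = J.J x (cov Y x v)

/-- The section `α` of `T_x M` is nondegenerate with respect to `g`. -/
def IsNondegenerateSection (g : SemiRiemannianMetric E M) (x : M)
    (α : Submodule ℝ (TangentSpace 𝓘(ℝ, E) x)) : Prop :=
  ∀ u ∈ α, (∀ v ∈ α, g.val x u v = 0) → u = 0

/-- The section `α` of `T_x M` is totally real with respect to `g`: `J α` is orthogonal to `α`. -/
def IsTotallyRealSection {g : SemiRiemannianMetric E M} (J : NordenStructure g) (x : M)
    (α : Submodule ℝ (TangentSpace 𝓘(ℝ, E) x)) : Prop :=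
  ∀ u ∈ α, ∀ v ∈ α, g.val x (J.J x u) v = 0

/-- The tensor `π₁(u, v, w, z) = g(v, w) g(u, z) - g(u, w) g(v, z)`. -/
def piOne (g : SemiRiemannianMetric E M) (x : M) (u v w z : TangentSpace 𝓘(ℝ, E) x) : ℝ :=
  g.val x v w * g.val x u z - g.val x u w * g.val x v z

/-- The curvature tensor of type (0,4), `R(u, v, w, z) = g(R(u, v, w), z)`. -/
def curvatureFour (g : SemiRiemannianMetric E M)
    (cov : CovariantDerivative 𝓘(ℝ, E) E (TangentSpace 𝓘(ℝ, E) : M → Type _))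
    (x : M) (u v w z : TangentSpace 𝓘(ℝ, E) x) : ℝ :=
  g.val x (curvatureAt (fun Y y a ↦ cov Y y a) x u v w) z

/-- Constant totally real sectional curvatures `ν` and `ν'` with respect to `g`: at every point `x`,
all nondegenerate totally real sections `span {u, v}` have the sectional curvatures
`R(u, v, v, u) / π₁(u, v, v, u) = ν x` and `R(u, v, v, J u) / π₁(u, v, v, u) = ν' x`. -/
def HasConstantTotallyRealCurvatures (g : SemiRiemannianMetric E M) (J : NordenStructure g)
    (cov : CovariantDerivative 𝓘(ℝ, E) E (TangentSpace 𝓘(ℝ, E) : M → Type _))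
    (ν ν' : M → ℝ) : Prop :=
  ∀ (x : M) (u v : TangentSpace 𝓘(ℝ, E) x), LinearIndependent ℝ ![u, v] →
    IsNondegenerateSection g x (Submodule.span ℝ {u, v}) →
    IsTotallyRealSection J x (Submodule.span ℝ {u, v}) →
      curvatureFour g cov x u v v u / piOne g x u v v u = ν x ∧
      curvatureFour g cov x u v v (J.J x u) / piOne g x u v v u = ν' x

end Ambient

section Hypersurface

variable {E : Type*} [NormedAddCommGroup E] [NormedSpace ℝ E]
  {Mb : Type*} [TopologicalSpace Mb] [ChartedSpace E Mb] [IsManifold 𝓘(ℝ, E) ∞ Mb]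
  {F : Type*} [NormedAddCommGroup F] [NormedSpace ℝ F]
  {M : Type*} [TopologicalSpace M] [ChartedSpace F M] [IsManifold 𝓘(ℝ, F) ∞ M]

variable (F E) in
/-- The differential at `p` of a map `f : M → Mb`. -/
abbrev df (f : M → Mb) (p : M) :
    TangentSpace 𝓘(ℝ, F) p →L[ℝ] TangentSpace 𝓘(ℝ, E) (f p) :=
  mfderiv 𝓘(ℝ, F) 𝓘(ℝ, E) f p

/-- The covariant derivative `∇_v V` at `p` of a vector field `V` along `f`. In the preferred chart
of `Mb` at `f p` this is `∂_v V^k + Γ^k_{ij} (df v)^i V^j`: the first summand differentiates the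
components of `V`, the second one is the derivative in direction `df v` of the vector field with
constant components that extends `V p`. -/
def covAlong (cov : CovariantDerivative 𝓘(ℝ, E) E (TangentSpace 𝓘(ℝ, E) : Mb → Type _))
    (f : M → Mb) (V : Π p : M, TangentSpace 𝓘(ℝ, E) (f p)) (p : M)
    (v : TangentSpace 𝓘(ℝ, F) p) : TangentSpace 𝓘(ℝ, E) (f p) :=
  (trivializationAt E (TangentSpace 𝓘(ℝ, E)) (f p)).symm (f p)
      (mvfderiv 𝓘(ℝ, F)
        (fun q ↦ (trivializationAt E (TangentSpace 𝓘(ℝ, E)) (f p) ⟨f q, V q⟩).2) p v)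
    + cov (FiberBundle.extend E (V p)) (f p) (df E F f p v)

/-- The induced metric (the pullback of `g` by `f`). -/
def inducedMetric (g : SemiRiemannianMetric E Mb) (f : M → Mb) (p : M)
    (u v : TangentSpace 𝓘(ℝ, F) p) : ℝ :=
  g.val (f p) (df E F f p u) (df E F f p v)

/-- The metric induced by the associated Norden metric. -/
def inducedAssoc {g : SemiRiemannianMetric E Mb} (J : NordenStructure g) (f : M → Mb) (p : M)
    (u v : TangentSpace 𝓘(ℝ, F) p) : ℝ :=
  J.assoc (f p) (df E F f p u) (df E F f p v)

/-- The normal space `T_p M^⊥` in `T_{f p} Mb`. -/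
def normalSpace (F : Type*) [NormedAddCommGroup F] [NormedSpace ℝ F]
    {M : Type*} [TopologicalSpace M] [ChartedSpace F M]
    (g : SemiRiemannianMetric E Mb) (f : M → Mb) (p : M) :
    Submodule ℝ (TangentSpace 𝓘(ℝ, E) (f p)) where
  carrier := {w | ∀ u : TangentSpace 𝓘(ℝ, F) p, g.val (f p) w (df E F f p u) = 0}
  add_mem' {a b} ha hb u := by simp [ha u, hb u]
  zero_mem' u := by simp
  smul_mem' c a ha u := by
    simp [ha u]

/-- The radical `Rad T_p M`, the intersection of `T_p M` and `T_p M^⊥`, as a subspace of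
`T_p M`. -/
def radicalSpace (F : Type*) [NormedAddCommGroup F] [NormedSpace ℝ F]
    {M : Type*} [TopologicalSpace M] [ChartedSpace F M]
    (g : SemiRiemannianMetric E Mb) (f : M → Mb) (p : M) :
    Submodule ℝ (TangentSpace 𝓘(ℝ, F) p) :=
  (normalSpace F g f p).comap (df E F f p : TangentSpace 𝓘(ℝ, F) p →ₗ[ℝ] TangentSpace 𝓘(ℝ, E) (f p))

/-- The hypersurface `f : M → Mb` is lightlike: `T_p M` and `T_p M^⊥` intersect nontrivially
at each point. -/
def IsLightlike (F : Type*) [NormedAddCommGroup F] [NormedSpace ℝ F]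
    {M : Type*} [TopologicalSpace M] [ChartedSpace F M]
    (g : SemiRiemannianMetric E Mb) (f : M → Mb) : Prop :=
  ∀ p : M, radicalSpace F g f p ≠ ⊥

/-- A screen distribution `S(TM)`: a smooth nondegenerate distribution complementary to the radical
distribution in `TM`. -/
structure ScreenDistribution (F : Type*) [NormedAddCommGroup F] [NormedSpace ℝ F]
    {M : Type*} [TopologicalSpace M] [ChartedSpace F M] [IsManifold 𝓘(ℝ, F) ∞ M]
    (g : SemiRiemannianMetric E Mb) (f : M → Mb) where
  space (p : M) : Submodule ℝ (TangentSpace 𝓘(ℝ, F) p)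
  isCompl (p : M) : IsCompl (space p) (radicalSpace F g f p)
  nondeg (p : M) (u : TangentSpace 𝓘(ℝ, F) p) (hu : u ∈ space p)
    (h : ∀ w ∈ space p, inducedMetric g f p u w = 0) : u = 0
  smooth (p : M) : ∃ U : Set M, IsOpen U ∧ p ∈ U ∧ ∃ (k : ℕ) (W : Fin k → VField F M),
    (∀ i, IsSmoothOn (W i) U) ∧
    ∀ q ∈ U, LinearIndependent ℝ (fun i ↦ W i q) ∧
      Submodule.span ℝ (Set.range fun i ↦ W i q) = space q

/-- The projection `P : T_p M → S(T_p M)` along the radical. -/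
def ScreenDistribution.P {g : SemiRiemannianMetric E Mb} {f : M → Mb}
    (S : ScreenDistribution F g f) (p : M) (u : TangentSpace 𝓘(ℝ, F) p) : TangentSpace 𝓘(ℝ, F) p :=
  (S.space p).projectionOnto (radicalSpace F g f p) (S.isCompl p) u

/-- The vector `N` at `f p` forms with `ξ` in `Rad T_p M` a pair such that `g(N, ξ) = 1`,
`g(N, N) = 0` and `g(N, W) = 0` for all `W` in the screen space. -/
def ScreenDistribution.IsNullTransversal {g : SemiRiemannianMetric E Mb} {f : M → Mb}
    (S : ScreenDistribution F g f) (p : M) (ξ : TangentSpace 𝓘(ℝ, F) p)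
    (N : TangentSpace 𝓘(ℝ, E) (f p)) : Prop :=
  g.val (f p) N (df E F f p ξ) = 1 ∧ g.val (f p) N N = 0 ∧
    ∀ W ∈ S.space p, g.val (f p) N (df E F f p W) = 0

/-- The fibre at `p` of the transversal bundle `tr(TM)`: it is spanned by the vectors `N` that
correspond to the vectors `ξ` of the radical. -/
def ScreenDistribution.transversal {g : SemiRiemannianMetric E Mb} {f : M → Mb}
    (S : ScreenDistribution F g f) (p : M) : Submodule ℝ (TangentSpace 𝓘(ℝ, E) (f p)) :=
  Submodule.span ℝ {N | ∃ ξ ∈ radicalSpace F g f p, S.IsNullTransversal p ξ N}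

/-- The lightlike hypersurface is radical transversal: `J(TM^⊥) = tr(TM)`. -/
def IsRadicalTransversal {g : SemiRiemannianMetric E Mb} (J : NordenStructure g) {f : M → Mb}
    (S : ScreenDistribution F g f) : Prop :=
  ∀ p : M, (normalSpace F g f p).map
    (J.J (f p) : TangentSpace 𝓘(ℝ, E) (f p) →ₗ[ℝ] TangentSpace 𝓘(ℝ, E) (f p)) = S.transversal p

/-- A pair `{ξ, N}` on the open set `U` of `M`: `ξ` is a smooth nowhere zero section of the radical
distribution and `N` is the corresponding section of `tr(TM)`. -/
structure IsNullPair {g : SemiRiemannianMetric E Mb} {f : M → Mb} (S : ScreenDistribution F g f)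
    (U : Set M) (ξ : VField F M) (N : Π p : M, TangentSpace 𝓘(ℝ, E) (f p)) : Prop where
  isOpen : IsOpen U
  smooth : IsSmoothOn ξ U
  mem_radical : ∀ p ∈ U, ξ p ∈ radicalSpace F g f p
  ne_zero : ∀ p ∈ U, ξ p ≠ 0
  transversal : ∀ p ∈ U, S.IsNullTransversal p (ξ p) (N p)

open Classical in
/-- The tangential part `u` of a vector `w` at `f p` in the decomposition `w = df u + n` with `n` in
`tr(TM)`. -/
def tangentialPart {g : SemiRiemannianMetric E Mb} {f : M → Mb} (S : ScreenDistribution F g f)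
    (p : M) (w : TangentSpace 𝓘(ℝ, E) (f p)) : TangentSpace 𝓘(ℝ, F) p :=
  if h : ∃ u : TangentSpace 𝓘(ℝ, F) p, w - df E F f p u ∈ S.transversal p then h.choose else 0

variable (F) in
open Classical in
/-- The coefficient `c` in the decomposition `w = df u + c N` of a vector `w` at `f p`. -/
def transversalCoeff (f : M → Mb) (p : M) (N w : TangentSpace 𝓘(ℝ, E) (f p)) : ℝ :=
  if h : ∃ c : ℝ, ∃ u : TangentSpace 𝓘(ℝ, F) p, w = df E F f p u + c • N then h.choose else 0

/-- The induced connection `∇` on `M`, from the Gauss formula `∇̄_v Y = ∇_v Y + B(v, Y) N`. -/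
def inducedConnection (cov : CovariantDerivative 𝓘(ℝ, E) E (TangentSpace 𝓘(ℝ, E) : Mb → Type _))
    {g : SemiRiemannianMetric E Mb} {f : M → Mb} (S : ScreenDistribution F g f)
    (Y : VField F M) (p : M) (v : TangentSpace 𝓘(ℝ, F) p) : TangentSpace 𝓘(ℝ, F) p :=
  tangentialPart S p (covAlong cov f (fun q ↦ df E F f q (Y q)) p v)

/-- The local second fundamental form `B(v, Y)`, from the Gauss formula
`∇̄_v Y = ∇_v Y + B(v, Y) N`. -/
def secondForm (cov : CovariantDerivative 𝓘(ℝ, E) E (TangentSpace 𝓘(ℝ, E) : Mb → Type _))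
    (f : M → Mb) (N : Π p : M, TangentSpace 𝓘(ℝ, E) (f p)) (p : M)
    (v : TangentSpace 𝓘(ℝ, F) p) (Y : VField F M) : ℝ :=
  transversalCoeff F f p (N p) (covAlong cov f (fun q ↦ df E F f q (Y q)) p v)

/-- The 1-form `τ`, from the Weingarten formula `∇̄_v N = - A_N v + τ(v) N`. -/
def tauForm (cov : CovariantDerivative 𝓘(ℝ, E) E (TangentSpace 𝓘(ℝ, E) : Mb → Type _))
    (f : M → Mb) (N : Π p : M, TangentSpace 𝓘(ℝ, E) (f p)) (p : M)
    (v : TangentSpace 𝓘(ℝ, F) p) : ℝ :=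
  transversalCoeff F f p (N p) (covAlong cov f N p v)

variable (F) in
/-- `ρ` is a smooth function on `U` with `B(X, Y) = ρ g(X, Y)`, where `B` belongs to the section `N`
of the transversal bundle. -/
def IsUmbilicFactor (cov : CovariantDerivative 𝓘(ℝ, E) E (TangentSpace 𝓘(ℝ, E) : Mb → Type _))
    (g : SemiRiemannianMetric E Mb) (f : M → Mb) (U : Set M)
    (N : Π p : M, TangentSpace 𝓘(ℝ, E) (f p)) (ρ : M → ℝ) : Prop :=
  ContMDiffOn 𝓘(ℝ, F) 𝓘(ℝ, ℝ) ∞ ρ U ∧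
  ∀ X Y : VField F M, IsSmoothOn X U → IsSmoothOn Y U → ∀ p ∈ U,
    secondForm cov f N p (X p) Y = ρ p * inducedMetric g f p (X p) (Y p)

/-- The lightlike hypersurface is totally umbilical: on every open set `U` with a pair `{ξ, N}`
there is a smooth function `ρ` with `B = ρ g`. -/
def IsTotallyUmbilical (cov : CovariantDerivative 𝓘(ℝ, E) E (TangentSpace 𝓘(ℝ, E) : Mb → Type _))
    {g : SemiRiemannianMetric E Mb} {f : M → Mb} (S : ScreenDistribution F g f) : Prop :=
  ∀ (U : Set M) (ξ : VField F M) (N : Π p : M, TangentSpace 𝓘(ℝ, E) (f p)),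
    IsNullPair S U ξ N → ∃ ρ : M → ℝ, IsUmbilicFactor F cov g f U N ρ

end Hypersurface

end KNorden

end

/-!
The ambient curvature is determined first. By parallelism of `J` the curvature tensor `R` of a
Kähler–Norden manifold satisfies `R(x, y, J z, w) = R(x, y, z, J w)`, and the Bianchi identity
forces `J` to move between all arguments. So `R` is the real part of a complex multilinear
curvature tensor `R - i R(·, ·, ·, J ·)`, and `g` is the real part of the complex metric
`h = g - i g(J ·, ·)`. Totally real orthonormal pairs are `h`-orthonormal pairs, on which the
complex sectional curvature is `c = ν - i ν'`. A polynomial argument extends this to all pairs of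
vectors, and a curvature tensor is determined by its sectional curvatures, so `R` is the real part
of `c (h(y, z) h(x, w) - h(x, z) h(y, w))` (`curvatureFour_eq`).

On the hypersurface, umbilicity and `N = b⁻¹ J ξ` determine the derivatives of `ξ` and `N`:
`∇̄_v ξ = -ρ v + σ(v) ξ` (`IsUmbilicPair.cov_xi`) and `∇̄_v N = -(ρ / b) J P v + τ(v) N`
(`IsUmbilicPair.cov_N`). Differentiating the first formula again gives
`R(x, y) ξ ≡ -θ(x) y + θ(y) x` modulo `ξ`, with `θ = dρ + ρ τ - ρ² η` and `η = g(·, N)`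
(`IsUmbilicPair.exists_curvature_xi`). Compared with the formula for `R`, the pair `ξ`, `y` with
`y` in the screen space yields `ν = 0` and the differential equation for `ρ` along `ξ`
(`IsUmbilicPair.codazzi_xi`), since `y` and `J y` are independent. The pair `x`, `J x` in the screen
space yields `θ(x) = 0` (`IsUmbilicPair.codazzi_screen`). The tangential part of the second
derivatives of a tangent field gives the curvature of the induced connection
(`IsUmbilicPair.df_curvature_eq`). Its contraction is the Ricci tensor: the operator `J P` does not
contribute, because its complex eigenvalues are `0` and `±i` and so its real trace vanishes.

Differentiation along the immersion `f` is reduced to the calculus of components in charts of the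
target. The main facts are that the connection along `f` is torsion-free and compatible with `g` and
`J`, and that its curvature is the curvature of the target (`covAlong_curvature`).
-/

noncomputable section

namespace KNorden

set_option linter.unusedSectionVars false

/-! ### Calculus in the charts of a manifold -/

theorem two_le_infty : (1 + 1 : ℕ∞ω) ≤ ∞ := by
  have : ((2 : ℕ∞) : ℕ∞ω) ≤ ((⊤ : ℕ∞) : ℕ∞ω) := WithTop.coe_le_coe.2 le_top
  rwa [one_add_one_eq_two]

section Calculus

variable {F : Type*} [NormedAddCommGroup F] [NormedSpace ℝ F]
  {M : Type*} [TopologicalSpace M] [ChartedSpace F M] [IsManifold 𝓘(ℝ, F) ∞ M]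
  {G : Type*} [NormedAddCommGroup G] [NormedSpace ℝ G]

/-- The components at `y` of a tangent vector with respect to the preferred chart at `x₀`. -/
def tcomp (x₀ y : M) : TangentSpace 𝓘(ℝ, F) y →L[ℝ] F :=
  (trivializationAt F (TangentSpace 𝓘(ℝ, F)) x₀).continuousLinearMapAt ℝ y

/-- The tangent vector at `y` with given components with respect to the preferred chart at `x₀`. -/
def tvec (x₀ y : M) : F →L[ℝ] TangentSpace 𝓘(ℝ, F) y :=
  (trivializationAt F (TangentSpace 𝓘(ℝ, F)) x₀).symmL ℝ y

theorem tcomp_eq_mfderiv {x₀ y : M} (hy : y ∈ (chartAt F x₀).source) :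
    tcomp x₀ y = mfderiv 𝓘(ℝ, F) 𝓘(ℝ, F) (extChartAt 𝓘(ℝ, F) x₀) y :=
  TangentBundle.continuousLinearMapAt_trivializationAt hy

theorem trivializationAt_snd {x₀ y : M} (hy : y ∈ (chartAt F x₀).source)
    (v : TangentSpace 𝓘(ℝ, F) y) :
    (trivializationAt F (TangentSpace 𝓘(ℝ, F)) x₀ ⟨y, v⟩).2 = tcomp x₀ y v := by
  have : y ∈ (trivializationAt F (TangentSpace 𝓘(ℝ, F)) x₀).baseSet := by simpa using hy
  simp only [tcomp, Trivialization.continuousLinearMapAt_apply]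
  rw [Trivialization.linearMapAt_apply, if_pos this]

theorem tcomp_tvec {x₀ y : M} (hy : y ∈ (chartAt F x₀).source) (a : F) :
    tcomp x₀ y (tvec x₀ y a) = a :=
  Trivialization.continuousLinearMapAt_symmL _ (by simpa using hy) a

theorem tvec_tcomp {x₀ y : M} (hy : y ∈ (chartAt F x₀).source) (v : TangentSpace 𝓘(ℝ, F) y) :
    tvec x₀ y (tcomp x₀ y v) = v :=
  Trivialization.symmL_continuousLinearMapAt _ (by simpa using hy) v

theorem tcomp_injective {x₀ y : M} (hy : y ∈ (chartAt F x₀).source) :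
    Function.Injective (tcomp (F := F) x₀ y) :=
  Function.LeftInverse.injective (tvec_tcomp hy)

theorem tcomp_self (y : M) (v : TangentSpace 𝓘(ℝ, F) y) : tcomp y y v = v := by
  rw [tcomp_eq_mfderiv (mem_chart_source F y), mfderiv_extChartAt_self]
  rfl

theorem extend_eq_tvec {x y : M} (hy : y ∈ (chartAt F x).source) (v : TangentSpace 𝓘(ℝ, F) x) :
    FiberBundle.extend F v y = tvec x y (tcomp x x v) := by
  simp only [FiberBundle.extend]
  rw [trivializationAt_snd (mem_chart_source F x), tvec, Trivialization.symmL_apply]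
  simpa using hy

/-- The expression of `h` in the preferred chart at `x₀`. -/
def chartExpr (x₀ : M) (h : M → G) : F → G := h ∘ (extChartAt 𝓘(ℝ, F) x₀).symm

omit [IsManifold 𝓘(ℝ, F) ∞ M] [NormedAddCommGroup G] [NormedSpace ℝ G] in
theorem chartExpr_self (p : M) (h : M → G) :
    chartExpr p h (extChartAt 𝓘(ℝ, F) p p) = h p := by
  simp [chartExpr]

omit [IsManifold 𝓘(ℝ, F) ∞ M] [NormedAddCommGroup G] [NormedSpace ℝ G] in
theorem chartExpr_comp_eventuallyEq {x₀ q : M} (hq : q ∈ (chartAt F x₀).source) (h : M → G) :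
    h =ᶠ[𝓝 q] chartExpr x₀ h ∘ extChartAt 𝓘(ℝ, F) x₀ := by
  filter_upwards [(chartAt F x₀).open_source.mem_nhds hq] with y hy
  simp [chartExpr, hy]

theorem contDiffAt_chartExpr {x₀ q : M} (hq : q ∈ (chartAt F x₀).source) {h : M → G} {n : ℕ∞}
    (hh : ContMDiffAt 𝓘(ℝ, F) 𝓘(ℝ, G) n h q) :
    ContDiffAt ℝ n (chartExpr x₀ h) (extChartAt 𝓘(ℝ, F) x₀ q) := by
  rw [← contMDiffAt_iff_contDiffAt]
  have h1 : extChartAt 𝓘(ℝ, F) x₀ q ∈ (extChartAt 𝓘(ℝ, F) x₀).target :=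
    (extChartAt 𝓘(ℝ, F) x₀).map_source (by simpa using hq)
  have h2 : ContMDiffAt 𝓘(ℝ, F) 𝓘(ℝ, F) n (extChartAt 𝓘(ℝ, F) x₀).symm
      (extChartAt 𝓘(ℝ, F) x₀ q) := by
    refine ((contMDiffOn_extChartAt_symm (n := ∞) (I := 𝓘(ℝ, F)) x₀).contMDiffAt ?_).of_le ?_
    · exact (isOpen_extChartAt_target x₀).mem_nhds h1
    · exact_mod_cast le_top
  refine ContMDiffAt.comp _ ?_ h2
  simpa [hq] using hh

theorem mdifferentiableAt_chartExpr {x₀ q : M} (hq : q ∈ (chartAt F x₀).source) {h : M → G}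
    (hh : MDifferentiableAt 𝓘(ℝ, F) 𝓘(ℝ, G) h q) :
    MDifferentiableAt 𝓘(ℝ, F) 𝓘(ℝ, G) (chartExpr x₀ h) (extChartAt 𝓘(ℝ, F) x₀ q) := by
  have h1 : extChartAt 𝓘(ℝ, F) x₀ q ∈ (extChartAt 𝓘(ℝ, F) x₀).target :=
    (extChartAt 𝓘(ℝ, F) x₀).map_source (by simpa using hq)
  have h2 : MDifferentiableAt 𝓘(ℝ, F) 𝓘(ℝ, F) (extChartAt 𝓘(ℝ, F) x₀).symm
      (extChartAt 𝓘(ℝ, F) x₀ q) := by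
    refine ((contMDiffOn_extChartAt_symm (n := ∞) (I := 𝓘(ℝ, F)) x₀).contMDiffAt
      ?_).mdifferentiableAt (by simp)
    exact (isOpen_extChartAt_target x₀).mem_nhds h1
  refine MDifferentiableAt.comp _ ?_ h2
  simpa [hq] using hh

omit [IsManifold 𝓘(ℝ, F) ∞ M] in
theorem mvfderiv_congr {p : M} {h h' : M → G} (e : h =ᶠ[𝓝 p] h') (v : TangentSpace 𝓘(ℝ, F) p) :
    mvfderiv 𝓘(ℝ, F) h p v = mvfderiv 𝓘(ℝ, F) h' p v :=
  congrArg (fun L : F →L[ℝ] G ↦ L v) (e.mfderiv_eq (I := 𝓘(ℝ, F)) (I' := 𝓘(ℝ, G)))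

theorem mvfderiv_eq_fderiv_chartExpr {x₀ q : M} (hq : q ∈ (chartAt F x₀).source) {h : M → G}
    (hh : MDifferentiableAt 𝓘(ℝ, F) 𝓘(ℝ, G) h q) (v : TangentSpace 𝓘(ℝ, F) q) :
    mvfderiv 𝓘(ℝ, F) h q v
      = fderiv ℝ (chartExpr x₀ h) (extChartAt 𝓘(ℝ, F) x₀ q) (tcomp x₀ q v) := by
  have h1 := mdifferentiableAt_chartExpr hq hh
  have h2 : mfderiv 𝓘(ℝ, F) 𝓘(ℝ, G) h q =
      (mfderiv 𝓘(ℝ, F) 𝓘(ℝ, G) (chartExpr x₀ h) (extChartAt 𝓘(ℝ, F) x₀ q)).comp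
        (mfderiv 𝓘(ℝ, F) 𝓘(ℝ, F) (extChartAt 𝓘(ℝ, F) x₀) q) := by
    rw [← mfderiv_comp q h1 (mdifferentiableAt_extChartAt hq)]
    exact (chartExpr_comp_eventuallyEq hq h).mfderiv_eq
  rw [tcomp_eq_mfderiv hq, ← mfderiv_eq_fderiv]
  simp only [mvfderiv, h2]
  rfl

/-- A vector field is smooth if and only if its components are. -/
theorem contMDiffAt_vfield_iff {x₀ q : M} (hq : q ∈ (chartAt F x₀).source) {X : VField F M}
    {n : ℕ∞} :
    ContMDiffAt 𝓘(ℝ, F) 𝓘(ℝ, F).tangent n (fun x ↦ (⟨x, X x⟩ : TangentBundle 𝓘(ℝ, F) M)) q ↔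
      ContMDiffAt 𝓘(ℝ, F) 𝓘(ℝ, F) n (fun x ↦ tcomp x₀ x (X x)) q := by
  have hb : q ∈ (trivializationAt F (TangentSpace 𝓘(ℝ, F)) x₀).baseSet := by simpa using hq
  have : IsManifold 𝓘(ℝ, F) (n + 1) M := IsManifold.of_le (n := ∞) (by exact_mod_cast le_top)
  have := TangentBundle.contMDiffVectorBundle (n := n) (I := 𝓘(ℝ, F)) (M := M)
  refine ((trivializationAt F (TangentSpace 𝓘(ℝ, F)) x₀).contMDiffAt_section_iff hb).trans ?_
  refine Filter.EventuallyEq.contMDiffAt_iff ?_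
  filter_upwards [(chartAt F x₀).open_source.mem_nhds hq] with y hy
  exact trivializationAt_snd hy _

/-- The coordinate expression of the derivative of a function in the direction of a vector field. -/
theorem mvfderiv_eventuallyEq_chartExpr {p : M} {h : M → G}
    (hh : ContMDiffAt 𝓘(ℝ, F) 𝓘(ℝ, G) 1 h p) (X : VField F M) :
    (fun q ↦ mvfderiv 𝓘(ℝ, F) h q (X q)) =ᶠ[𝓝 p]
      fun q ↦ fderiv ℝ (chartExpr p h) (extChartAt 𝓘(ℝ, F) p q) (tcomp p q (X q)) := by
  have : IsManifold 𝓘(ℝ, F) 1 M := IsManifold.of_le (n := ∞) (by simp)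
  filter_upwards [(chartAt F p).open_source.mem_nhds (mem_chart_source F p),
    (contMDiffAt_iff_contMDiffAt_nhds (by simp)).1 hh] with q hq hhq
  exact mvfderiv_eq_fderiv_chartExpr hq (hhq.mdifferentiableAt (by simp)) _

theorem contMDiffOn_mvfderiv {O : Set M} (hO : IsOpen O) {h : M → G}
    (hh : ContMDiffOn 𝓘(ℝ, F) 𝓘(ℝ, G) ∞ h O) {X : VField F M} (hX : IsSmoothOn X O) :
    ContMDiffOn 𝓘(ℝ, F) 𝓘(ℝ, G) ∞ (fun q ↦ mvfderiv 𝓘(ℝ, F) h q (X q)) O := by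
  intro p hp
  have hhp := hh.contMDiffAt (hO.mem_nhds hp)
  have hXp := (contMDiffAt_vfield_iff (mem_chart_source F p)).1 (hX.contMDiffAt (hO.mem_nhds hp))
  refine ContMDiffAt.contMDiffWithinAt ?_
  refine ContMDiffAt.congr_of_eventuallyEq ?_
    (mvfderiv_eventuallyEq_chartExpr (hhp.of_le (by exact_mod_cast le_top)) X)
  refine ContMDiffAt.clm_apply ?_ hXp
  have h1 : ContDiffAt ℝ ∞ (fderiv ℝ (chartExpr p h)) (extChartAt 𝓘(ℝ, F) p p) :=
    (contDiffAt_chartExpr (mem_chart_source F p) hhp).fderiv_right (m := ∞) (by simp)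
  exact h1.contMDiffAt.comp p (contMDiffAt_extChartAt)

/-- The second derivative of a function in a chart. -/
theorem mvfderiv_mvfderiv {p : M} {h : M → G} (hh : ContMDiffAt 𝓘(ℝ, F) 𝓘(ℝ, G) ∞ h p)
    {X : VField F M} (hX : ContMDiffAt 𝓘(ℝ, F) 𝓘(ℝ, F) ∞ (fun q ↦ tcomp p q (X q)) p)
    (v : TangentSpace 𝓘(ℝ, F) p) :
    mvfderiv 𝓘(ℝ, F) (fun q ↦ mvfderiv 𝓘(ℝ, F) h q (X q)) p v =
      fderiv ℝ (fderiv ℝ (chartExpr p h)) (extChartAt 𝓘(ℝ, F) p p) (tcomp p p v)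
        (tcomp p p (X p)) +
      fderiv ℝ (chartExpr p h) (extChartAt 𝓘(ℝ, F) p p)
        (mvfderiv 𝓘(ℝ, F) (fun q ↦ tcomp p q (X q)) p v) := by
  have hm := mem_chart_source F p
  have hd : DifferentiableAt ℝ (fderiv ℝ (chartExpr p h)) (extChartAt 𝓘(ℝ, F) p p) :=
    ((contDiffAt_chartExpr hm hh).fderiv_right (m := 1) two_le_infty).differentiableAt (by simp)
  have hXd := (contDiffAt_chartExpr hm hX).differentiableAt (by simp)
  have h3 : MDifferentiableAt 𝓘(ℝ, F) 𝓘(ℝ, G)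
      (fun q ↦ fderiv ℝ (chartExpr p h) (extChartAt 𝓘(ℝ, F) p q) (tcomp p q (X q))) p := by
    refine MDifferentiableAt.clm_apply ?_ (hX.mdifferentiableAt (by simp))
    exact hd.mdifferentiableAt.comp p (mdifferentiableAt_extChartAt hm)
  rw [mvfderiv_congr (mvfderiv_eventuallyEq_chartExpr (hh.of_le (by exact_mod_cast le_top)) X),
    mvfderiv_eq_fderiv_chartExpr hm h3,
    mvfderiv_eq_fderiv_chartExpr hm (hX.mdifferentiableAt (by simp))]
  have e4 : chartExpr p (fun q ↦ fderiv ℝ (chartExpr p h) (extChartAt 𝓘(ℝ, F) p q)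
        (tcomp p q (X q))) =ᶠ[𝓝 (extChartAt 𝓘(ℝ, F) p p)]
      fun y ↦ fderiv ℝ (chartExpr p h) y (chartExpr p (fun q ↦ tcomp p q (X q)) y) := by
    filter_upwards [extChartAt_target_mem_nhds (I := 𝓘(ℝ, F)) p] with y hy
    simp only [chartExpr, Function.comp_apply, (extChartAt 𝓘(ℝ, F) p).right_inv hy]
  rw [e4.fderiv_eq, fderiv_clm_apply hd hXd]
  rw [chartExpr_self]
  simp only [add_apply, ContinuousLinearMap.comp_apply,
    ContinuousLinearMap.flip_apply]
  exact add_comm _ _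

/-- The Lie bracket in components. -/
theorem tcomp_mlieBracket {p : M} {X Y : VField F M}
    (hX : ContMDiffAt 𝓘(ℝ, F) 𝓘(ℝ, F) ∞ (fun q ↦ tcomp p q (X q)) p)
    (hY : ContMDiffAt 𝓘(ℝ, F) 𝓘(ℝ, F) ∞ (fun q ↦ tcomp p q (Y q)) p) :
    tcomp p p (VectorField.mlieBracket 𝓘(ℝ, F) X Y p) =
      mvfderiv 𝓘(ℝ, F) (fun q ↦ tcomp p q (Y q)) p (X p) -
      mvfderiv 𝓘(ℝ, F) (fun q ↦ tcomp p q (X q)) p (Y p) := by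
  have hm := mem_chart_source F p
  have key : ∀ Z : VField F M,
      VectorField.mpullbackWithin 𝓘(ℝ, F) 𝓘(ℝ, F) (extChartAt 𝓘(ℝ, F) p).symm Z
        (Set.range 𝓘(ℝ, F)) =ᶠ[𝓝 (extChartAt 𝓘(ℝ, F) p p)]
      chartExpr p (fun q ↦ tcomp p q (Z q)) := by
    intro Z
    filter_upwards [extChartAt_target_mem_nhds (I := 𝓘(ℝ, F)) p] with y hy
    have hy' : (extChartAt 𝓘(ℝ, F) p).symm y ∈ (chartAt F p).source := by
      simpa using (extChartAt 𝓘(ℝ, F) p).map_target hy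
    have := TangentBundle.symmL_trivializationAt (I := 𝓘(ℝ, F)) hy'
    rw [(extChartAt 𝓘(ℝ, F) p).right_inv hy] at this
    rw [VectorField.mpullbackWithin_apply, ← this]
    simp only [chartExpr, Function.comp_apply]
    have hinv := ContinuousLinearMap.inverse_eq
      (f := tvec (F := F) p ((extChartAt 𝓘(ℝ, F) p).symm y))
      (g := tcomp (F := F) p ((extChartAt 𝓘(ℝ, F) p).symm y))
      (by ext v; exact tvec_tcomp hy' v) (by ext v; exact tcomp_tvec hy' v)
    exact congrArg (fun L ↦ L (Z ((extChartAt 𝓘(ℝ, F) p).symm y))) hinv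
  have e1 : VectorField.mlieBracket 𝓘(ℝ, F) X Y p = VectorField.lieBracket ℝ
      (chartExpr p (fun q ↦ tcomp p q (X q))) (chartExpr p (fun q ↦ tcomp p q (Y q)))
      (extChartAt 𝓘(ℝ, F) p p) := by
    rw [← VectorField.mlieBracketWithin_univ, VectorField.mlieBracketWithin_apply,
      mfderiv_extChartAt_self]
    refine (congrArg (fun L : F →L[ℝ] F ↦ L _) ContinuousLinearMap.inverse_id).trans ?_
    have hset : (extChartAt 𝓘(ℝ, F) p).symm ⁻¹' Set.univ ∩ Set.range 𝓘(ℝ, F) = Set.univ := by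
      simp
    rw [hset]
    exact (congrFun VectorField.lieBracketWithin_univ _).trans <|
      (key X).lieBracket_vectorField_eq (key Y)
  rw [tcomp_self, e1, mvfderiv_eq_fderiv_chartExpr hm (hX.mdifferentiableAt (by simp)),
    mvfderiv_eq_fderiv_chartExpr hm (hY.mdifferentiableAt (by simp)), VectorField.lieBracket_eq]
  simp only [chartExpr_self]

/-- `[X, Y] h = X (Y h) - Y (X h)`. -/
theorem mvfderiv_mlieBracket {p : M} {h : M → G} (hh : ContMDiffAt 𝓘(ℝ, F) 𝓘(ℝ, G) ∞ h p)
    {X Y : VField F M} {O : Set M} (hO : IsOpen O) (hp : p ∈ O)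
    (hX : IsSmoothOn X O) (hY : IsSmoothOn Y O) :
    mvfderiv 𝓘(ℝ, F) h p (VectorField.mlieBracket 𝓘(ℝ, F) X Y p) =
      mvfderiv 𝓘(ℝ, F) (fun q ↦ mvfderiv 𝓘(ℝ, F) h q (Y q)) p (X p) -
      mvfderiv 𝓘(ℝ, F) (fun q ↦ mvfderiv 𝓘(ℝ, F) h q (X q)) p (Y p) := by
  have hXp := (contMDiffAt_vfield_iff (mem_chart_source F p)).1 (hX.contMDiffAt (hO.mem_nhds hp))
  have hYp := (contMDiffAt_vfield_iff (mem_chart_source F p)).1 (hY.contMDiffAt (hO.mem_nhds hp))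
  have hm := mem_chart_source F p
  rw [mvfderiv_mvfderiv hh hXp, mvfderiv_mvfderiv hh hYp,
    mvfderiv_eq_fderiv_chartExpr hm (hh.mdifferentiableAt (by simp)), tcomp_mlieBracket hXp hYp]
  have hs : IsSymmSndFDerivAt ℝ (chartExpr p h) (extChartAt 𝓘(ℝ, F) p p) :=
    (contDiffAt_chartExpr hm hh).isSymmSndFDerivAt
      (by simpa [one_add_one_eq_two] using two_le_infty)
  rw [map_sub, hs.eq (tcomp p p (X p)) (tcomp p p (Y p))]
  abel

theorem mvfderiv_clm_apply {G' : Type*} [NormedAddCommGroup G'] [NormedSpace ℝ G']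
    {A : M → G →L[ℝ] G'} {h : M → G} {p : M}
    (hA : MDifferentiableAt 𝓘(ℝ, F) 𝓘(ℝ, G →L[ℝ] G') A p)
    (hh : MDifferentiableAt 𝓘(ℝ, F) 𝓘(ℝ, G) h p) (v : TangentSpace 𝓘(ℝ, F) p) :
    mvfderiv 𝓘(ℝ, F) (fun q ↦ A q (h q)) p v =
      mvfderiv 𝓘(ℝ, F) A p v (h p) + A p (mvfderiv 𝓘(ℝ, F) h p v) := by
  have hm := mem_chart_source F p
  have hA' := (mdifferentiableAt_chartExpr hm hA).differentiableAt
  have hh' := (mdifferentiableAt_chartExpr hm hh).differentiableAt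
  rw [mvfderiv_eq_fderiv_chartExpr hm (hA.clm_apply hh), mvfderiv_eq_fderiv_chartExpr hm hA,
    mvfderiv_eq_fderiv_chartExpr hm hh]
  rw [show chartExpr p (fun q ↦ A q (h q)) = fun y ↦ chartExpr p A y (chartExpr p h y) from rfl,
    fderiv_clm_apply hA' hh', chartExpr_self, chartExpr_self]
  simp only [add_apply, ContinuousLinearMap.comp_apply, ContinuousLinearMap.flip_apply]
  exact add_comm _ _

theorem mvfderiv_clm_comp {G' : Type*} [NormedAddCommGroup G'] [NormedSpace ℝ G']
    (L : G →L[ℝ] G') {h : M → G} {p : M}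
    (hh : MDifferentiableAt 𝓘(ℝ, F) 𝓘(ℝ, G) h p) (v : TangentSpace 𝓘(ℝ, F) p) :
    mvfderiv 𝓘(ℝ, F) (fun q ↦ L (h q)) p v = L (mvfderiv 𝓘(ℝ, F) h p v) := by
  rw [mvfderiv_clm_apply (A := fun _ ↦ L) mdifferentiableAt_const hh, mvfderiv_const]
  simp

omit [IsManifold 𝓘(ℝ, F) ∞ M] in
theorem mvfderiv_comp_map {E : Type*} [NormedAddCommGroup E] [NormedSpace ℝ E]
    {Mb : Type*} [TopologicalSpace Mb] [ChartedSpace E Mb] {f : M → Mb} {h : Mb → G} {p : M}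
    (hh : MDifferentiableAt 𝓘(ℝ, E) 𝓘(ℝ, G) h (f p))
    (hf : MDifferentiableAt 𝓘(ℝ, F) 𝓘(ℝ, E) f p) (v : TangentSpace 𝓘(ℝ, F) p) :
    mvfderiv 𝓘(ℝ, F) (fun q ↦ h (f q)) p v =
      mvfderiv 𝓘(ℝ, E) h (f p) (mfderiv 𝓘(ℝ, F) 𝓘(ℝ, E) f p v) :=
  congrArg (fun L : F →L[ℝ] G ↦ L v) (mfderiv_comp p hh hf)

end Calculus

/-! ### Vector fields along a map and their covariant derivative -/

section Along

variable {E : Type*} [NormedAddCommGroup E] [NormedSpace ℝ E]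
  {Mb : Type*} [TopologicalSpace Mb] [ChartedSpace E Mb] [IsManifold 𝓘(ℝ, E) ∞ Mb]
  {F : Type*} [NormedAddCommGroup F] [NormedSpace ℝ F]
  {M : Type*} [TopologicalSpace M] [ChartedSpace F M] [IsManifold 𝓘(ℝ, F) ∞ M]

/-- The vector field `V` along `f` is smooth at `p`. -/
def SmoothAlongAt (F : Type*) [NormedAddCommGroup F] [NormedSpace ℝ F]
    {M : Type*} [TopologicalSpace M] [ChartedSpace F M]
    (f : M → Mb) (V : Π p : M, TangentSpace 𝓘(ℝ, E) (f p)) (p : M) : Prop :=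
  ContMDiffAt 𝓘(ℝ, F) 𝓘(ℝ, E).tangent ∞ (fun q ↦ (⟨f q, V q⟩ : TangentBundle 𝓘(ℝ, E) Mb)) p

variable {f : M → Mb} {p : M}

theorem smoothAlongAt_iff {x₀ : Mb} (hx : f p ∈ (chartAt E x₀).source)
    {V : Π p : M, TangentSpace 𝓘(ℝ, E) (f p)} (hf : ContMDiffAt 𝓘(ℝ, F) 𝓘(ℝ, E) ∞ f p) :
    SmoothAlongAt F f V p ↔
      ContMDiffAt 𝓘(ℝ, F) 𝓘(ℝ, E) ∞ (fun q ↦ tcomp x₀ (f q) (V q)) p := by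
  refine ((trivializationAt E (TangentSpace 𝓘(ℝ, E)) x₀).contMDiffAt_iff
    (by simpa [Trivialization.mem_source] using hx)).trans ?_
  refine (and_iff_right hf).trans ?_
  refine Filter.EventuallyEq.contMDiffAt_iff ?_
  filter_upwards [hf.continuousAt.preimage_mem_nhds ((chartAt E x₀).open_source.mem_nhds hx)]
    with q hq
  exact trivializationAt_snd hq _

theorem SmoothAlongAt.add {V W : Π p : M, TangentSpace 𝓘(ℝ, E) (f p)}
    (hf : ContMDiffAt 𝓘(ℝ, F) 𝓘(ℝ, E) ∞ f p)
    (hV : SmoothAlongAt F f V p) (hW : SmoothAlongAt F f W p) :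
    SmoothAlongAt F f (fun q ↦ V q + W q) p := by
  have hx := mem_chart_source E (f p)
  rw [smoothAlongAt_iff hx hf] at *
  simp only [map_add]
  exact ContMDiffAt.add hV hW

theorem SmoothAlongAt.smul {V : Π p : M, TangentSpace 𝓘(ℝ, E) (f p)} {a : M → ℝ}
    (hf : ContMDiffAt 𝓘(ℝ, F) 𝓘(ℝ, E) ∞ f p)
    (ha : ContMDiffAt 𝓘(ℝ, F) 𝓘(ℝ, ℝ) ∞ a p) (hV : SmoothAlongAt F f V p) :
    SmoothAlongAt F f (fun q ↦ a q • V q) p := by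
  have hx := mem_chart_source E (f p)
  rw [smoothAlongAt_iff hx hf] at *
  simp only [map_smul]
  exact ContMDiffAt.smul ha hV

theorem SmoothAlongAt.comp {W : VField E Mb} (hf : ContMDiffAt 𝓘(ℝ, F) 𝓘(ℝ, E) ∞ f p)
    (hW : ContMDiffAt 𝓘(ℝ, E) 𝓘(ℝ, E).tangent ∞
      (fun x ↦ (⟨x, W x⟩ : TangentBundle 𝓘(ℝ, E) Mb)) (f p)) :
    SmoothAlongAt F f (fun q ↦ W (f q)) p :=
  ContMDiffAt.comp p hW hf

theorem SmoothAlongAt.congr {V W : Π p : M, TangentSpace 𝓘(ℝ, E) (f p)}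
    (hV : SmoothAlongAt F f V p) (h : ∀ᶠ q in 𝓝 p, W q = V q) : SmoothAlongAt F f W p :=
  ContMDiffAt.congr_of_eventuallyEq hV (h.mono fun q hq ↦ by simp only [hq])

/-- The vector field with constant components `a` with respect to the chart at `x₀`. -/
def constField (x₀ : Mb) (a : E) : VField E Mb := fun y ↦ tvec x₀ y a

theorem contMDiffAt_constField {x₀ y : Mb} (hy : y ∈ (chartAt E x₀).source) (a : E) :
    ContMDiffAt 𝓘(ℝ, E) 𝓘(ℝ, E).tangent ∞
      (fun x ↦ (⟨x, constField x₀ a x⟩ : TangentBundle 𝓘(ℝ, E) Mb)) y := by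
  rw [contMDiffAt_vfield_iff (n := ⊤) hy]
  refine (contMDiffAt_const (c := a)).congr_of_eventuallyEq ?_
  filter_upwards [(chartAt E x₀).open_source.mem_nhds hy] with z hz
  exact tcomp_tvec hz a

theorem mdifferentiableAt_constField {x₀ y : Mb} (hy : y ∈ (chartAt E x₀).source) (a : E) :
    MDiffAt (T% (constField x₀ a)) y :=
  (contMDiffAt_constField hy a).mdifferentiableAt (by simp)

variable (cov : CovariantDerivative 𝓘(ℝ, E) E (TangentSpace 𝓘(ℝ, E) : Mb → Type _))

theorem cov_congr {W W' : VField E Mb} {x : Mb} (hW : MDiffAt (T% W) x) (hW' : MDiffAt (T% W') x)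
    (h : ∀ᶠ y in 𝓝 x, W y = W' y) : cov W x = cov W' x :=
  cov.isCovariantDerivativeOnUniv.congr_of_eventuallyEq hW hW' Filter.univ_mem h

theorem cov_add {W W' : VField E Mb} {x : Mb} (hW : MDiffAt (T% W) x) (hW' : MDiffAt (T% W') x)
    (w : TangentSpace 𝓘(ℝ, E) x) : cov (W + W') x w = cov W x w + cov W' x w := by
  rw [cov.isCovariantDerivativeOnUniv.add hW hW']; rfl

theorem cov_smul {W : VField E Mb} {a : Mb → ℝ} {x : Mb} (hW : MDiffAt (T% W) x)
    (ha : MDifferentiableAt 𝓘(ℝ, E) 𝓘(ℝ, ℝ) a x) (w : TangentSpace 𝓘(ℝ, E) x) :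
    cov (fun y ↦ a y • W y) x w = mvfderiv 𝓘(ℝ, E) a x w • W x + a x • cov W x w := by
  have := cov.isCovariantDerivativeOnUniv.leibniz hW ha
  rw [show (fun y ↦ a y • W y) = a • W from rfl, this, add_comm]
  rfl

theorem cov_constField_add {x₀ y : Mb} (hy : y ∈ (chartAt E x₀).source) (a b : E) :
    cov (constField x₀ (a + b)) y = cov (constField x₀ a) y + cov (constField x₀ b) y := by
  rw [← cov.isCovariantDerivativeOnUniv.add (mdifferentiableAt_constField hy a)
    (mdifferentiableAt_constField hy b)]
  congr 1
  funext z
  simp [constField]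

theorem cov_constField_smul {x₀ y : Mb} (hy : y ∈ (chartAt E x₀).source) (c : ℝ) (a : E) :
    cov (constField x₀ (c • a)) y = c • cov (constField x₀ a) y := by
  rw [← cov.isCovariantDerivativeOnUniv.smul_const c (mdifferentiableAt_constField hy a)]
  congr 1
  funext z
  simp [constField]

theorem cov_extend {x : Mb} (u : TangentSpace 𝓘(ℝ, E) x) :
    cov (FiberBundle.extend E u) x = cov (constField x (tcomp x x u)) x := by
  refine cov_congr cov (FiberBundle.mdifferentiableAt_extend 𝓘(ℝ, E) E u)
    (mdifferentiableAt_constField (mem_chart_source E x) _) ?_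
  filter_upwards [(chartAt E x).open_source.mem_nhds (mem_chart_source E x)] with y hy
  exact extend_eq_tvec hy u

theorem cov_sum_smul_constField {x₀ x : Mb} (hx : x ∈ (chartAt E x₀).source)
    {ι : Type*} (s : Finset ι) (b : ι → E) {a : ι → Mb → ℝ}
    (ha : ∀ i, MDifferentiableAt 𝓘(ℝ, E) 𝓘(ℝ, ℝ) (a i) x) (w : TangentSpace 𝓘(ℝ, E) x) :
    MDiffAt (T% (fun y ↦ ∑ i ∈ s, a i y • constField x₀ (b i) y)) x ∧
    cov (fun y ↦ ∑ i ∈ s, a i y • constField x₀ (b i) y) x w =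
      ∑ i ∈ s, (mvfderiv 𝓘(ℝ, E) (a i) x w • constField x₀ (b i) x +
        a i x • cov (constField x₀ (b i)) x w) := by
  classical
  have h1 : ∀ i, MDiffAt (T% (fun y ↦ a i y • constField x₀ (b i) y)) x := fun i ↦
    (ha i).smul_section (mdifferentiableAt_constField hx (b i))
  have h2 : ∀ s : Finset ι, MDiffAt (T% (fun y ↦ ∑ i ∈ s, a i y • constField x₀ (b i) y)) x :=
    fun s ↦ .sum_section fun i _ ↦ h1 i
  refine ⟨h2 s, ?_⟩
  induction s using Finset.induction_on with
  | empty =>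
    simp only [Finset.sum_empty]
    have := cov.isCovariantDerivativeOnUniv.zero (x := x)
    exact congrArg (fun L : E →L[ℝ] E ↦ L w) this
  | insert i s hi ih =>
    simp only [Finset.sum_insert hi]
    rw [← ih, ← cov_smul cov (mdifferentiableAt_constField hx (b i)) (ha i) w,
      ← cov_add cov (h1 i) (h2 s)]
    rfl

variable [FiniteDimensional ℝ E]

/-- The coordinate functional of the chosen basis of the model space. -/
def coordL (i : Fin (Module.finrank ℝ E)) : E →L[ℝ] ℝ :=
  LinearMap.toContinuousLinearMap ((Module.finBasis ℝ E).coord i)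

theorem sum_coordL_smul (a : E) : ∑ i, coordL i a • Module.finBasis ℝ E i = a := by
  simp [coordL]

theorem cov_constField_eq_sum {x₀ y : Mb} (hy : y ∈ (chartAt E x₀).source) (a : E) :
    cov (constField x₀ a) y =
      ∑ i, coordL i a • cov (constField x₀ (Module.finBasis ℝ E i)) y := by
  let L : E →ₗ[ℝ] (TangentSpace 𝓘(ℝ, E) y →L[ℝ] TangentSpace 𝓘(ℝ, E) y) :=
    { toFun := fun a ↦ cov (constField x₀ a) y
      map_add' := cov_constField_add cov hy
      map_smul' := cov_constField_smul cov hy }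
  change L a = ∑ i, coordL i a • L (Module.finBasis ℝ E i)
  conv_lhs => rw [← sum_coordL_smul a]
  simp only [map_sum, map_smul]

/-- A connection in coordinates: the derivative of the components plus the derivative of the
frame. -/
theorem cov_eq_of_chart {x₀ x : Mb} (hx : x ∈ (chartAt E x₀).source) {W : VField E Mb}
    (hW : ContMDiffAt 𝓘(ℝ, E) 𝓘(ℝ, E).tangent ∞
      (fun x ↦ (⟨x, W x⟩ : TangentBundle 𝓘(ℝ, E) Mb)) x) (w : TangentSpace 𝓘(ℝ, E) x) :
    cov W x w = tvec x₀ x (mvfderiv 𝓘(ℝ, E) (fun y ↦ tcomp x₀ y (W y)) x w)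
      + cov (constField x₀ (tcomp x₀ x (W x))) x w := by
  have hW' := (contMDiffAt_vfield_iff (n := ⊤) hx).1 hW
  have hWd := hW'.mdifferentiableAt (by simp)
  have ha : ∀ i, MDifferentiableAt 𝓘(ℝ, E) 𝓘(ℝ, ℝ) (fun y ↦ coordL i (tcomp x₀ y (W y))) x :=
    fun i ↦ (coordL i).mdifferentiableAt.comp x hWd
  have hs := cov_sum_smul_constField cov hx Finset.univ (Module.finBasis ℝ E) ha w
  have e1 : ∀ᶠ y in 𝓝 x, W y = ∑ i, coordL i (tcomp x₀ y (W y)) •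
      constField x₀ (Module.finBasis ℝ E i) y := by
    filter_upwards [(chartAt E x₀).open_source.mem_nhds hx] with y hy
    conv_lhs => rw [← tvec_tcomp hy (W y), ← sum_coordL_smul (tcomp x₀ y (W y))]
    simp only [map_sum, map_smul]
    rfl
  rw [cov_congr cov (hW.mdifferentiableAt (by simp)) hs.1 e1, hs.2, Finset.sum_add_distrib,
    cov_constField_eq_sum cov hx]
  congr 1
  · conv_rhs => rw [← sum_coordL_smul (mvfderiv 𝓘(ℝ, E) (fun y ↦ tcomp x₀ y (W y)) x w)]
    simp only [map_sum, map_smul]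
    refine Finset.sum_congr rfl fun i _ ↦ ?_
    rw [mvfderiv_clm_comp (coordL i) hWd]
    rfl
  · simp only [sum_apply, smul_apply]

/-- The definition of the covariant derivative along a map, in terms of the component maps. -/
theorem covAlong_eq {V : Π p : M, TangentSpace 𝓘(ℝ, E) (f p)} (hf : ContinuousAt f p)
    (v : TangentSpace 𝓘(ℝ, F) p) :
    covAlong cov f V p v =
      tvec (f p) (f p) (mvfderiv 𝓘(ℝ, F) (fun q ↦ tcomp (f p) (f q) (V q)) p v)
      + cov (constField (f p) (tcomp (f p) (f p) (V p))) (f p) (df E F f p v) := by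
  have hx := mem_chart_source E (f p)
  rw [covAlong, cov_extend]
  congr 1
  rw [tvec, Trivialization.symmL_apply (trivializationAt E (TangentSpace 𝓘(ℝ, E)) (f p))
    (by simp)]
  congr 1
  refine mvfderiv_congr ?_ v
  filter_upwards [hf.preimage_mem_nhds ((chartAt E (f p)).open_source.mem_nhds hx)] with q hq
  exact trivializationAt_snd hq _

variable (hf : ContMDiff 𝓘(ℝ, F) 𝓘(ℝ, E) ∞ f)

include hf in
theorem covAlong_congr {V W : Π p : M, TangentSpace 𝓘(ℝ, E) (f p)}
    (h : ∀ᶠ q in 𝓝 p, V q = W q) (v : TangentSpace 𝓘(ℝ, F) p) :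
    covAlong cov f V p v = covAlong cov f W p v := by
  rw [covAlong_eq cov (hf p).continuousAt, covAlong_eq cov (hf p).continuousAt, h.self_of_nhds]
  congr 2
  exact mvfderiv_congr (h.mono fun q hq ↦ by simp only [hq]) v

include hf in
/-- The covariant derivative of the restriction of a vector field on the target. -/
theorem covAlong_comp {W : VField E Mb} (hW : ContMDiffAt 𝓘(ℝ, E) 𝓘(ℝ, E).tangent ∞
      (fun x ↦ (⟨x, W x⟩ : TangentBundle 𝓘(ℝ, E) Mb)) (f p)) (v : TangentSpace 𝓘(ℝ, F) p) :
    covAlong cov f (fun q ↦ W (f q)) p v = cov W (f p) (df E F f p v) := by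
  have hx := mem_chart_source E (f p)
  rw [covAlong_eq cov (hf p).continuousAt, cov_eq_of_chart cov hx hW,
    mvfderiv_comp_map (h := fun y ↦ tcomp (f p) y (W y))
      (((contMDiffAt_vfield_iff (n := ⊤) hx).1 hW).mdifferentiableAt (by simp))
      ((hf p).mdifferentiableAt (by simp))]

include hf in
theorem covAlong_add {V W : Π p : M, TangentSpace 𝓘(ℝ, E) (f p)}
    (hV : SmoothAlongAt F f V p) (hW : SmoothAlongAt F f W p) (v : TangentSpace 𝓘(ℝ, F) p) :
    covAlong cov f (fun q ↦ V q + W q) p v = covAlong cov f V p v + covAlong cov f W p v := by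
  have hx := mem_chart_source E (f p)
  have hV' := ((smoothAlongAt_iff hx (hf p)).1 hV).mdifferentiableAt (by simp)
  have hW' := ((smoothAlongAt_iff hx (hf p)).1 hW).mdifferentiableAt (by simp)
  simp only [covAlong_eq cov (hf p).continuousAt, map_add, cov_constField_add cov hx]
  rw [mvfderiv_fun_add hV' hW']
  simp only [add_apply, map_add]
  abel

include hf in
theorem covAlong_smul {V : Π p : M, TangentSpace 𝓘(ℝ, E) (f p)} {a : M → ℝ}
    (ha : ContMDiffAt 𝓘(ℝ, F) 𝓘(ℝ, ℝ) ∞ a p)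
    (hV : SmoothAlongAt F f V p) (v : TangentSpace 𝓘(ℝ, F) p) :
    covAlong cov f (fun q ↦ a q • V q) p v =
      mvfderiv 𝓘(ℝ, F) a p v • V p + a p • covAlong cov f V p v := by
  have hx := mem_chart_source E (f p)
  have hV' := ((smoothAlongAt_iff hx (hf p)).1 hV).mdifferentiableAt (by simp)
  simp only [covAlong_eq cov (hf p).continuousAt, map_smul, cov_constField_smul cov hx]
  rw [mvfderiv_fun_smul (ha.mdifferentiableAt (by simp)) hV']
  simp only [add_apply, map_add, smul_apply, ContinuousLinearMap.smulRight_apply, map_smul,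
    tvec_tcomp hx, smul_add]
  abel

end Along

/-! ### The metric and the complex structure along a map -/

section AlongCalculus

variable {E : Type*} [NormedAddCommGroup E] [NormedSpace ℝ E] [FiniteDimensional ℝ E]
  {Mb : Type*} [TopologicalSpace Mb] [ChartedSpace E Mb] [IsManifold 𝓘(ℝ, E) ∞ Mb]
  {F : Type*} [NormedAddCommGroup F] [NormedSpace ℝ F]
  {M : Type*} [TopologicalSpace M] [ChartedSpace F M] [IsManifold 𝓘(ℝ, F) ∞ M]
  {f : M → Mb} {p : M}

/-- Induction principle for smooth vector fields along `f`: near `p` they are generated over the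
smooth functions by restrictions of vector fields on the target. -/
theorem SmoothAlongAt.induction (hf : ContMDiff 𝓘(ℝ, F) 𝓘(ℝ, E) ∞ f)
    {P : (Π p : M, TangentSpace 𝓘(ℝ, E) (f p)) → Prop}
    (comp : ∀ W : VField E Mb, ContMDiffAt 𝓘(ℝ, E) 𝓘(ℝ, E).tangent ∞
      (fun x ↦ (⟨x, W x⟩ : TangentBundle 𝓘(ℝ, E) Mb)) (f p) → P fun q ↦ W (f q))
    (add : ∀ V W, SmoothAlongAt F f V p → SmoothAlongAt F f W p → P V → P W →
      P fun q ↦ V q + W q)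
    (smul : ∀ (a : M → ℝ) V, ContMDiffAt 𝓘(ℝ, F) 𝓘(ℝ, ℝ) ∞ a p → SmoothAlongAt F f V p → P V →
      P fun q ↦ a q • V q)
    (congr : ∀ V W, (∀ᶠ q in 𝓝 p, V q = W q) → P V → P W)
    {V : Π p : M, TangentSpace 𝓘(ℝ, E) (f p)} (hV : SmoothAlongAt F f V p) : P V := by
  classical
  have hx := mem_chart_source E (f p)
  have hV' := (smoothAlongAt_iff hx (hf p)).1 hV
  let a : Fin (Module.finrank ℝ E) → M → ℝ := fun i q ↦ coordL i (tcomp (f p) (f q) (V q))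
  have ha : ∀ i, ContMDiffAt 𝓘(ℝ, F) 𝓘(ℝ, ℝ) ∞ (a i) p := fun i ↦
    (coordL i).contMDiff.contMDiffAt.comp p hV'
  let e : Fin (Module.finrank ℝ E) → VField E Mb := fun i ↦
    constField (f p) (Module.finBasis ℝ E i)
  have he : ∀ i, SmoothAlongAt F f (fun q ↦ e i (f q)) p := fun i ↦
    .comp (hf p) (contMDiffAt_constField hx _)
  have hs : ∀ s : Finset (Fin (Module.finrank ℝ E)),
      SmoothAlongAt F f (fun q ↦ ∑ i ∈ s, a i q • e i (f q)) p ∧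
      P fun q ↦ ∑ i ∈ s, a i q • e i (f q) := by
    intro s
    induction s using Finset.induction_on with
    | empty =>
      have h0 : ContMDiffAt 𝓘(ℝ, E) 𝓘(ℝ, E).tangent ∞
          (fun x ↦ (⟨x, (0 : VField E Mb) x⟩ : TangentBundle 𝓘(ℝ, E) Mb)) (f p) :=
        contMDiffAt_zeroSection ..
      simp only [Finset.sum_empty]
      exact ⟨.comp (W := 0) (hf p) h0, comp 0 h0⟩
    | insert i s hi ih =>
      simp only [Finset.sum_insert hi]
      have h1 := (he i).smul (hf p) (ha i)
      exact ⟨h1.add (hf p) ih.1, add _ _ h1 ih.1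
        (smul _ _ (ha i) (he i) (comp _ (contMDiffAt_constField hx _))) ih.2⟩
  refine congr _ _ ?_ (hs Finset.univ).2
  filter_upwards [(hf p).continuousAt.preimage_mem_nhds
    ((chartAt E (f p)).open_source.mem_nhds hx)] with q hq
  conv_rhs => rw [← tvec_tcomp hq (V q), ← sum_coordL_smul (tcomp (f p) (f q) (V q))]
  simp only [map_sum, map_smul]
  rfl

variable (cov : CovariantDerivative 𝓘(ℝ, E) E (TangentSpace 𝓘(ℝ, E) : Mb → Type _))

/-- The covariant derivative along `f`, computed in an arbitrary chart of the target. -/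
theorem covAlong_eq_of_chart (hf : ContMDiff 𝓘(ℝ, F) 𝓘(ℝ, E) ∞ f) {x₀ : Mb}
    (hx : f p ∈ (chartAt E x₀).source)
    {V : Π p : M, TangentSpace 𝓘(ℝ, E) (f p)} (hV : SmoothAlongAt F f V p)
    (v : TangentSpace 𝓘(ℝ, F) p) :
    covAlong cov f V p v =
      tvec x₀ (f p) (mvfderiv 𝓘(ℝ, F) (fun q ↦ tcomp x₀ (f q) (V q)) p v)
      + cov (constField x₀ (tcomp x₀ (f p) (V p))) (f p) (df E F f p v) := by
  refine SmoothAlongAt.induction (P := fun V ↦ covAlong cov f V p v =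
      tvec x₀ (f p) (mvfderiv 𝓘(ℝ, F) (fun q ↦ tcomp x₀ (f q) (V q)) p v)
      + cov (constField x₀ (tcomp x₀ (f p) (V p))) (f p) (df E F f p v)) hf ?_ ?_ ?_ ?_ hV
  · intro W hW
    rw [covAlong_comp cov hf hW, cov_eq_of_chart cov hx hW,
      mvfderiv_comp_map (h := fun y ↦ tcomp x₀ y (W y))
      (((contMDiffAt_vfield_iff (n := ⊤) hx).1 hW).mdifferentiableAt (by simp))
      ((hf p).mdifferentiableAt (by simp))]
  · intro V W hV hW h1 h2
    have hV' := ((smoothAlongAt_iff hx (hf p)).1 hV).mdifferentiableAt (by simp)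
    have hW' := ((smoothAlongAt_iff hx (hf p)).1 hW).mdifferentiableAt (by simp)
    rw [covAlong_add cov hf hV hW, h1, h2]
    simp only [map_add, cov_constField_add cov hx]
    rw [mvfderiv_fun_add hV' hW']
    simp only [add_apply, map_add]
    abel
  · intro a V ha hV h1
    have hV' := ((smoothAlongAt_iff hx (hf p)).1 hV).mdifferentiableAt (by simp)
    rw [covAlong_smul cov hf ha hV, h1]
    simp only [map_smul, cov_constField_smul cov hx]
    rw [mvfderiv_fun_smul (ha.mdifferentiableAt (by simp)) hV']
    simp only [add_apply, map_add, smul_apply, ContinuousLinearMap.smulRight_apply, map_smul,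
      tvec_tcomp hx, smul_add]
    abel
  · intro V W h h1
    have e : (fun q ↦ tcomp x₀ (f q) (V q)) =ᶠ[𝓝 p] fun q ↦ tcomp x₀ (f q) (W q) :=
      h.mono fun q hq ↦ by simp only [hq]
    rw [← covAlong_congr cov hf h, h1, h.self_of_nhds, mvfderiv_congr e]

section Metric

variable (g : SemiRiemannianMetric E Mb)

theorem SmoothAlongAt.metric {V W : Π p : M, TangentSpace 𝓘(ℝ, E) (f p)}
    (hf : ContMDiffAt 𝓘(ℝ, F) 𝓘(ℝ, E) ∞ f p)
    (hV : SmoothAlongAt F f V p) (hW : SmoothAlongAt F f W p) :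
    ContMDiffAt 𝓘(ℝ, F) 𝓘(ℝ, ℝ) ∞ (fun q ↦ g.val (f q) (V q) (W q)) p := by
  have : ContMDiffAt 𝓘(ℝ, F) (𝓘(ℝ, E).prod 𝓘(ℝ)) ∞
      (fun m ↦ TotalSpace.mk' ℝ (E := Bundle.Trivial Mb ℝ) (f m) (g.val (f m) (V m) (W m))) p := by
    apply ContMDiffAt.clm_bundle_apply₂ (F₁ := E) (F₂ := E)
    · exact ContMDiffAt.comp p g.contMDiff.contMDiffAt hf
    · exact hV
    · exact hW
  simp only [contMDiffAt_totalSpace] at this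
  exact this.2

/-- The connection along `f` is metric. -/
theorem mvfderiv_metric_along (hf : ContMDiff 𝓘(ℝ, F) 𝓘(ℝ, E) ∞ f) (hcov : IsLeviCivita g cov)
    {V W : Π p : M, TangentSpace 𝓘(ℝ, E) (f p)}
    (hV : SmoothAlongAt F f V p) (hW : SmoothAlongAt F f W p) (v : TangentSpace 𝓘(ℝ, F) p) :
    mvfderiv 𝓘(ℝ, F) (fun q ↦ g.val (f q) (V q) (W q)) p v =
      g.val (f p) (covAlong cov f V p v) (W p) + g.val (f p) (V p) (covAlong cov f W p v) := by
  revert V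
  have step : ∀ W : Π p : M, TangentSpace 𝓘(ℝ, E) (f p), SmoothAlongAt F f W p →
      (∀ V' : VField E Mb, ContMDiffAt 𝓘(ℝ, E) 𝓘(ℝ, E).tangent ∞
        (fun x ↦ (⟨x, V' x⟩ : TangentBundle 𝓘(ℝ, E) Mb)) (f p) →
        mvfderiv 𝓘(ℝ, F) (fun q ↦ g.val (f q) (V' (f q)) (W q)) p v =
        g.val (f p) (covAlong cov f (fun q ↦ V' (f q)) p v) (W p) +
        g.val (f p) (V' (f p)) (covAlong cov f W p v)) →
      ∀ {V}, SmoothAlongAt F f V p →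
        mvfderiv 𝓘(ℝ, F) (fun q ↦ g.val (f q) (V q) (W q)) p v =
        g.val (f p) (covAlong cov f V p v) (W p) + g.val (f p) (V p) (covAlong cov f W p v) := by
    intro W hW hbase V hV
    refine SmoothAlongAt.induction (P := fun V ↦
        mvfderiv 𝓘(ℝ, F) (fun q ↦ g.val (f q) (V q) (W q)) p v =
        g.val (f p) (covAlong cov f V p v) (W p) + g.val (f p) (V p) (covAlong cov f W p v))
      hf hbase ?_ ?_ ?_ hV
    · intro V V' hV hV' h1 h2
      have d1 := (hV.metric g (hf p) hW).mdifferentiableAt (by simp)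
      have d2 := (hV'.metric g (hf p) hW).mdifferentiableAt (by simp)
      simp only [map_add, add_apply]
      rw [mvfderiv_fun_add d1 d2, covAlong_add cov hf hV hV']
      simp only [map_add, add_apply, h1, h2]
      ring
    · intro a V ha hV h1
      have d1 := (hV.metric g (hf p) hW).mdifferentiableAt (by simp)
      simp only [map_smul, smul_apply]
      rw [mvfderiv_fun_smul (ha.mdifferentiableAt (by simp)) d1, covAlong_smul cov hf ha hV]
      simp only [map_add, add_apply, map_smul, smul_apply, ContinuousLinearMap.smulRight_apply, h1,
        smul_eq_mul]
      ring
    · intro V V' h h1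
      rw [← covAlong_congr cov hf h, ← h.self_of_nhds, ← h1]
      exact mvfderiv_congr (h.mono fun q hq ↦ by simp only [hq]) v
  have symm : ∀ V W : Π p : M, TangentSpace 𝓘(ℝ, E) (f p),
      mvfderiv 𝓘(ℝ, F) (fun q ↦ g.val (f q) (V q) (W q)) p v =
      g.val (f p) (covAlong cov f V p v) (W p) + g.val (f p) (V p) (covAlong cov f W p v) →
      mvfderiv 𝓘(ℝ, F) (fun q ↦ g.val (f q) (W q) (V q)) p v =
      g.val (f p) (covAlong cov f W p v) (V p) + g.val (f p) (W p) (covAlong cov f V p v) := by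
    intro V W h
    rw [g.symm _ _ (V p), g.symm _ (W p), add_comm, ← h]
    simp only [g.symm _ (W _)]
  intro V hV
  refine step W hW (fun V' hV' ↦ symm _ _ ?_) hV
  refine step (fun q ↦ V' (f q)) (.comp (hf p) hV') (fun W' hW' ↦ ?_) hW
  have d : MDifferentiableAt 𝓘(ℝ, E) 𝓘(ℝ, ℝ) (fun y ↦ g.val y (W' y) (V' y)) (f p) :=
    (SmoothAlongAt.metric (F := E) (f := id) g contMDiffAt_id hW' hV').mdifferentiableAt (by simp)
  rw [covAlong_comp cov hf hV', covAlong_comp cov hf hW',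
    mvfderiv_comp_map (h := fun y ↦ g.val y (W' y) (V' y)) d ((hf p).mdifferentiableAt (by simp))]
  exact hcov.metric W' V' (f p) (hW'.mdifferentiableAt (by simp))
    (hV'.mdifferentiableAt (by simp)) _

variable {g}

theorem SmoothAlongAt.J (J : NordenStructure g) {V : Π p : M, TangentSpace 𝓘(ℝ, E) (f p)}
    (hf : ContMDiffAt 𝓘(ℝ, F) 𝓘(ℝ, E) ∞ f p) (hV : SmoothAlongAt F f V p) :
    SmoothAlongAt F f (fun q ↦ J.J (f q) (V q)) p :=
  ContMDiffAt.clm_bundle_apply (F₁ := E) (F₂ := E)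
    (ContMDiffAt.comp p J.contMDiff.contMDiffAt hf) hV

/-- The almost complex structure is parallel along `f`. -/
theorem covAlong_J (hf : ContMDiff 𝓘(ℝ, F) 𝓘(ℝ, E) ∞ f) (J : NordenStructure g)
    (hJ : IsParallel J cov) {V : Π p : M, TangentSpace 𝓘(ℝ, E) (f p)}
    (hV : SmoothAlongAt F f V p) (v : TangentSpace 𝓘(ℝ, F) p) :
    covAlong cov f (fun q ↦ J.J (f q) (V q)) p v = J.J (f p) (covAlong cov f V p v) := by
  refine SmoothAlongAt.induction (P := fun V ↦
    covAlong cov f (fun q ↦ J.J (f q) (V q)) p v = J.J (f p) (covAlong cov f V p v)) hf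
    ?_ ?_ ?_ ?_ hV
  · intro W hW
    have hJW : SmoothAlongAt E (id : Mb → Mb) (fun x ↦ J.J x (W x)) (f p) :=
      SmoothAlongAt.J (f := id) J contMDiffAt_id hW
    rw [covAlong_comp cov hf hW, covAlong_comp (W := fun x ↦ J.J x (W x)) cov hf hJW]
    exact hJ W (f p) (hW.mdifferentiableAt (by simp)) _
  · intro V W hV hW h1 h2
    simp only [map_add]
    rw [covAlong_add cov hf (hV.J J (hf p)) (hW.J J (hf p)), covAlong_add cov hf hV hW, map_add,
      h1, h2]
  · intro a V ha hV h1
    simp only [map_smul]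
    rw [covAlong_smul cov hf ha (hV.J J (hf p)), covAlong_smul cov hf ha hV, map_add, map_smul,
      map_smul, h1]
  · intro V W h h1
    rw [← covAlong_congr cov hf h, ← h1]
    exact covAlong_congr cov hf (h.mono fun q hq ↦ by simp only [hq]) v

end Metric

end AlongCalculus

/-! ### Christoffel symbols and torsion -/

section Christoffel

variable {E : Type*} [NormedAddCommGroup E] [NormedSpace ℝ E] [FiniteDimensional ℝ E]
  {Mb : Type*} [TopologicalSpace Mb] [ChartedSpace E Mb] [IsManifold 𝓘(ℝ, E) ∞ Mb]
  {F : Type*} [NormedAddCommGroup F] [NormedSpace ℝ F]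
  {M : Type*} [TopologicalSpace M] [ChartedSpace F M] [IsManifold 𝓘(ℝ, F) ∞ M]
  {f : M → Mb} {p : M} {O : Set M}
  (cov : CovariantDerivative 𝓘(ℝ, E) E (TangentSpace 𝓘(ℝ, E) : Mb → Type _))

/-- The Christoffel symbols of `cov` in the preferred chart at `x₀`: the components at `y` of the
derivative in direction `a` of the vector field with constant components `c` are
`christoffel cov x₀ y c a`. -/
def christoffel (x₀ y : Mb) : E →L[ℝ] E →L[ℝ] E :=
  ∑ i, ∑ j, (coordL i).smulRight ((coordL j).smulRight
    (tcomp x₀ y (cov (constField x₀ (Module.finBasis ℝ E i)) y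
      (constField x₀ (Module.finBasis ℝ E j) y))))

theorem christoffel_apply {x₀ y : Mb} (hy : y ∈ (chartAt E x₀).source) (c a : E) :
    christoffel cov x₀ y c a = tcomp x₀ y (cov (constField x₀ c) y (constField x₀ a y)) := by
  have h1 : constField x₀ a y = ∑ j, coordL j a • constField x₀ (Module.finBasis ℝ E j) y := by
    conv_lhs => rw [constField, ← sum_coordL_smul a]
    simp only [map_sum, map_smul, constField]
  rw [cov_constField_eq_sum cov hy, h1]
  simp only [christoffel, sum_apply, smul_apply, map_sum, map_smul,
    ContinuousLinearMap.smulRight_apply]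
  rw [Finset.sum_comm]
  refine Finset.sum_congr rfl fun i _ ↦ ?_
  rw [Finset.smul_sum]
  refine Finset.sum_congr rfl fun j _ ↦ ?_
  rw [smul_comm]

theorem tcomp_df (hf : ContMDiff 𝓘(ℝ, F) 𝓘(ℝ, E) ∞ f) {x₀ : Mb}
    (hx : f p ∈ (chartAt E x₀).source) (v : TangentSpace 𝓘(ℝ, F) p) :
    tcomp x₀ (f p) (df E F f p v) =
      mvfderiv 𝓘(ℝ, F) (fun q ↦ extChartAt 𝓘(ℝ, E) x₀ (f q)) p v := by
  rw [mvfderiv_comp_map (h := extChartAt 𝓘(ℝ, E) x₀) (mdifferentiableAt_extChartAt hx)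
    ((hf p).mdifferentiableAt (by simp)), tcomp_eq_mfderiv hx]
  rfl

/-- The components of the covariant derivative along `f`, in terms of the Christoffel symbols. -/
theorem tcomp_covAlong (hf : ContMDiff 𝓘(ℝ, F) 𝓘(ℝ, E) ∞ f) {x₀ : Mb}
    (hx : f p ∈ (chartAt E x₀).source)
    {V : Π p : M, TangentSpace 𝓘(ℝ, E) (f p)} (hV : SmoothAlongAt F f V p)
    (v : TangentSpace 𝓘(ℝ, F) p) :
    tcomp x₀ (f p) (covAlong cov f V p v) =
      mvfderiv 𝓘(ℝ, F) (fun q ↦ tcomp x₀ (f q) (V q)) p v +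
      christoffel cov x₀ (f p) (tcomp x₀ (f p) (V p))
        (mvfderiv 𝓘(ℝ, F) (fun q ↦ extChartAt 𝓘(ℝ, E) x₀ (f q)) p v) := by
  rw [covAlong_eq_of_chart cov hf hx hV, map_add, tcomp_tvec hx, christoffel_apply cov hx,
    ← tcomp_df hf hx, show constField x₀ (tcomp x₀ (f p) (df E F f p v)) (f p) = df E F f p v from
      tvec_tcomp hx _]

theorem eventually_mem_chart_source (hf : ContMDiff 𝓘(ℝ, F) 𝓘(ℝ, E) ∞ f) {x₀ : Mb}
    (hx : f p ∈ (chartAt E x₀).source) : ∀ᶠ q in 𝓝 p, f q ∈ (chartAt E x₀).source :=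
  (hf p).continuousAt.preimage_mem_nhds ((chartAt E x₀).open_source.mem_nhds hx)

theorem contMDiffAt_chart_comp (hf : ContMDiff 𝓘(ℝ, F) 𝓘(ℝ, E) ∞ f) {x₀ : Mb}
    (hx : f p ∈ (chartAt E x₀).source) :
    ContMDiffAt 𝓘(ℝ, F) 𝓘(ℝ, E) ∞ (fun q ↦ extChartAt 𝓘(ℝ, E) x₀ (f q)) p :=
  (contMDiffAt_extChartAt' hx).comp p (hf p)

theorem contMDiffAt_mvfderiv {G : Type*} [NormedAddCommGroup G] [NormedSpace ℝ G] {h : M → G}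
    (hO : IsOpen O) (hp : p ∈ O) (hh : ∀ᶠ q in 𝓝 p, ContMDiffAt 𝓘(ℝ, F) 𝓘(ℝ, G) ∞ h q)
    {X : VField F M} (hX : IsSmoothOn X O) :
    ContMDiffAt 𝓘(ℝ, F) 𝓘(ℝ, G) ∞ (fun q ↦ mvfderiv 𝓘(ℝ, F) h q (X q)) p := by
  obtain ⟨O', hO', hO'o, hpO'⟩ := eventually_nhds_iff.1 hh
  exact (contMDiffOn_mvfderiv (hO'o.inter hO) (fun q hq ↦ (hO' q hq.1).contMDiffWithinAt)
    (hX.mono Set.inter_subset_right)).contMDiffAt ((hO'o.inter hO).mem_nhds ⟨hpO', hp⟩)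

/-- The differential of `f` maps smooth vector fields to smooth vector fields along `f`. -/
theorem smoothAlongAt_df (hf : ContMDiff 𝓘(ℝ, F) 𝓘(ℝ, E) ∞ f) (hO : IsOpen O) (hp : p ∈ O)
    {X : VField F M} (hX : IsSmoothOn X O) :
    SmoothAlongAt F f (fun q ↦ df E F f q (X q)) p := by
  have hx := mem_chart_source E (f p)
  rw [smoothAlongAt_iff hx (hf p)]
  refine (contMDiffAt_mvfderiv hO hp (h := fun q ↦ extChartAt 𝓘(ℝ, E) (f p) (f q))
    ((eventually_mem_chart_source hf hx).mono fun q hq ↦ contMDiffAt_chart_comp hf hq)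
    hX).congr_of_eventuallyEq ?_
  filter_upwards [eventually_mem_chart_source hf hx] with q hq using tcomp_df hf hq _

variable {g : SemiRiemannianMetric E Mb}

theorem contDiff_smulRight_smulRight (l m : E →L[ℝ] ℝ) :
    ContDiff ℝ ∞ (fun w : E ↦ l.smulRight (m.smulRight w)) :=
  contDiff_const.smulRight (contDiff_const.smulRight contDiff_id)

set_option synthInstance.maxHeartbeats 200000 in
theorem contMDiffAt_christoffel (hcov : IsLeviCivita g cov) {x₀ y : Mb}
    (hy : y ∈ (chartAt E x₀).source) :
    ContMDiffAt 𝓘(ℝ, E) 𝓘(ℝ, E →L[ℝ] E →L[ℝ] E) ∞ (christoffel cov x₀) y := by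
  have hA : ∀ i j, ContMDiffAt 𝓘(ℝ, E) 𝓘(ℝ, E) ∞ (fun y ↦ tcomp x₀ y
      (cov (constField x₀ (Module.finBasis ℝ E i)) y
        (constField x₀ (Module.finBasis ℝ E j) y))) y := by
    intro i j
    have h1 := (hcov.smooth (chartAt E x₀).source (chartAt E x₀).open_source).contMDiff
      (σ := constField x₀ (Module.finBasis ℝ E i))
      (fun z hz ↦ (contMDiffAt_constField hz _).contMDiffWithinAt)
    have h2 := h1.contMDiffAt ((chartAt E x₀).open_source.mem_nhds hy)
    exact (contMDiffAt_vfield_iff (n := ⊤) (X := fun y ↦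
      cov (constField x₀ (Module.finBasis ℝ E i)) y (constField x₀ (Module.finBasis ℝ E j) y))
      hy).1 (h2.clm_bundle_apply (F₁ := E) (F₂ := E) (contMDiffAt_constField hy _))
  unfold christoffel
  refine ContMDiffAt.sum fun i _ ↦ ContMDiffAt.sum fun j _ ↦ ?_
  exact (contDiff_smulRight_smulRight (coordL i) (coordL j)).contMDiff.contMDiffAt.comp y (hA i j)

/-- The covariant derivative along `f` of a smooth vector field along `f` in the direction of a
smooth vector field is smooth. -/
theorem SmoothAlongAt.covAlong (hf : ContMDiff 𝓘(ℝ, F) 𝓘(ℝ, E) ∞ f) (hcov : IsLeviCivita g cov)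
    (hO : IsOpen O) (hp : p ∈ O) {X : VField F M} (hX : IsSmoothOn X O)
    {V : Π p : M, TangentSpace 𝓘(ℝ, E) (f p)} (hV : ∀ q ∈ O, SmoothAlongAt F f V q) :
    SmoothAlongAt F f (fun q ↦ KNorden.covAlong cov f V q (X q)) p := by
  have hx := mem_chart_source E (f p)
  have hxe := eventually_mem_chart_source hf hx
  have hOe := hO.mem_nhds hp
  rw [smoothAlongAt_iff hx (hf p)]
  have e : (fun q ↦ tcomp (f p) (f q) (KNorden.covAlong cov f V q (X q))) =ᶠ[𝓝 p] fun q ↦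
      mvfderiv 𝓘(ℝ, F) (fun q ↦ tcomp (f p) (f q) (V q)) q (X q) +
      christoffel cov (f p) (f q) (tcomp (f p) (f q) (V q))
        (mvfderiv 𝓘(ℝ, F) (fun q ↦ extChartAt 𝓘(ℝ, E) (f p) (f q)) q (X q)) := by
    filter_upwards [hxe, hOe] with q hq hqO using tcomp_covAlong cov hf hq (hV q hqO) _
  refine ContMDiffAt.congr_of_eventuallyEq ?_ e
  refine ContMDiffAt.add ?_ (ContMDiffAt.clm_apply (ContMDiffAt.clm_apply ?_ ?_) ?_)
  · refine contMDiffAt_mvfderiv hO hp ?_ hX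
    filter_upwards [hxe, hOe] with q hq hqO using (smoothAlongAt_iff hq (hf q)).1 (hV q hqO)
  · exact (contMDiffAt_christoffel cov hcov hx).comp p (hf p)
  · exact (smoothAlongAt_iff hx (hf p)).1 (hV p hp)
  · exact contMDiffAt_mvfderiv hO hp (hxe.mono fun q hq ↦ contMDiffAt_chart_comp hf hq) hX

/-- The Christoffel symbols of a torsion-free connection are symmetric, as the fields with constant
components commute. -/
theorem christoffel_symm (hcov : IsLeviCivita g cov) {x₀ y : Mb}
    (hy : y ∈ (chartAt E x₀).source) (c a : E) :
    christoffel cov x₀ y c a = christoffel cov x₀ y a c := by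
  have hs : ∀ a : E, IsSmoothOn (constField x₀ a) (chartAt E x₀).source := fun a z hz ↦
    (contMDiffAt_constField hz a).contMDiffWithinAt
  have h0 : VectorField.mlieBracket 𝓘(ℝ, E) (constField x₀ a) (constField x₀ c) y = 0 := by
    apply tcomp_injective hy
    have h1 := mvfderiv_mlieBracket (contMDiffAt_extChartAt' (n := ∞) (I := 𝓘(ℝ, E)) hy)
      (chartAt E x₀).open_source hy (hs a) (hs c)
    have h2 : ∀ d : E, (fun q ↦ mvfderiv 𝓘(ℝ, E) (extChartAt 𝓘(ℝ, E) x₀) q (constField x₀ d q))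
        =ᶠ[𝓝 y] fun _ ↦ d := by
      intro d
      filter_upwards [(chartAt E x₀).open_source.mem_nhds hy] with z hz
      refine Eq.trans ?_ (tcomp_tvec hz d)
      rw [tcomp_eq_mfderiv hz]
      rfl
    rw [mvfderiv_congr (h2 c), mvfderiv_congr (h2 a), mvfderiv_const, mvfderiv_const] at h1
    rw [map_zero, tcomp_eq_mfderiv hy]
    simpa using! h1
  have h1 := hcov.torsion_free (constField x₀ a) (constField x₀ c) y
    (mdifferentiableAt_constField hy a) (mdifferentiableAt_constField hy c)
  rw [h0, sub_eq_zero] at h1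
  rw [christoffel_apply cov hy, christoffel_apply cov hy, h1]

/-- The connection along `f` is torsion-free. -/
theorem covAlong_df_sub_covAlong_df (hf : ContMDiff 𝓘(ℝ, F) 𝓘(ℝ, E) ∞ f)
    (hcov : IsLeviCivita g cov) (hO : IsOpen O) (hp : p ∈ O) {X Y : VField F M}
    (hX : IsSmoothOn X O) (hY : IsSmoothOn Y O) :
    KNorden.covAlong cov f (fun q ↦ df E F f q (Y q)) p (X p) -
      KNorden.covAlong cov f (fun q ↦ df E F f q (X q)) p (Y p) =
      df E F f p (VectorField.mlieBracket 𝓘(ℝ, F) X Y p) := by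
  have hx := mem_chart_source E (f p)
  apply tcomp_injective hx
  have e : ∀ X : VField F M, (fun q ↦ tcomp (f p) (f q) (df E F f q (X q))) =ᶠ[𝓝 p]
      fun q ↦ mvfderiv 𝓘(ℝ, F) (fun q ↦ extChartAt 𝓘(ℝ, E) (f p) (f q)) q (X q) := fun X ↦ by
    filter_upwards [eventually_mem_chart_source hf hx] with q hq using tcomp_df hf hq _
  rw [map_sub, tcomp_covAlong cov hf hx (smoothAlongAt_df hf hO hp hX),
    tcomp_covAlong cov hf hx (smoothAlongAt_df hf hO hp hY), mvfderiv_congr (e X),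
    mvfderiv_congr (e Y), tcomp_df hf hx, tcomp_df hf hx, tcomp_df hf hx,
    mvfderiv_mlieBracket (contMDiffAt_chart_comp hf hx) hO hp hX hY,
    christoffel_symm cov hcov hx]
  abel

end Christoffel

/-! ### The curvature along a map -/

section CurvatureAlong

variable {E : Type*} [NormedAddCommGroup E] [NormedSpace ℝ E] [FiniteDimensional ℝ E]
  {Mb : Type*} [TopologicalSpace Mb] [ChartedSpace E Mb] [IsManifold 𝓘(ℝ, E) ∞ Mb]
  {F : Type*} [NormedAddCommGroup F] [NormedSpace ℝ F]
  {M : Type*} [TopologicalSpace M] [ChartedSpace F M] [IsManifold 𝓘(ℝ, F) ∞ M]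
  {f : M → Mb} {p : M} {O : Set M}
  (cov : CovariantDerivative 𝓘(ℝ, E) E (TangentSpace 𝓘(ℝ, E) : Mb → Type _))
  {g : SemiRiemannianMetric E Mb}

/-- The derivative at `x` of the Christoffel symbols of the preferred chart at `x`. -/
def christoffelDeriv (x : Mb) : E →L[ℝ] E →L[ℝ] E →L[ℝ] E :=
  ContinuousLinearMap.comp (mvfderiv 𝓘(ℝ, E) (christoffel cov x) x) (tvec x x)

theorem christoffelDeriv_apply (x : Mb) (a b c : E) : christoffelDeriv cov x a b c =
    mvfderiv 𝓘(ℝ, E) (christoffel cov x) x (tvec x x a) b c := rfl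

/-- The curvature at `x` in terms of the Christoffel symbols of the preferred chart at `x`. -/
def coordCurv (x : Mb) (a b c : E) : E :=
  christoffelDeriv cov x a c b - christoffelDeriv cov x b c a
    + christoffel cov x x (christoffel cov x x c b) a
    - christoffel cov x x (christoffel cov x x c a) b

/-- The components of a second covariant derivative along `f`. -/
theorem tcomp_covAlong_covAlong (hf : ContMDiff 𝓘(ℝ, F) 𝓘(ℝ, E) ∞ f)
    (hcov : IsLeviCivita g cov) (hO : IsOpen O) (hp : p ∈ O) {Y : VField F M}
    (hY : IsSmoothOn Y O)
    {V : Π p : M, TangentSpace 𝓘(ℝ, E) (f p)} (hV : ∀ q ∈ O, SmoothAlongAt F f V q)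
    (v : TangentSpace 𝓘(ℝ, F) p) :
    tcomp (f p) (f p) (covAlong cov f (fun q ↦ covAlong cov f V q (Y q)) p v) =
      mvfderiv 𝓘(ℝ, F) (fun q ↦ mvfderiv 𝓘(ℝ, F) (fun q ↦ tcomp (f p) (f q) (V q)) q (Y q)) p v
      + mvfderiv 𝓘(ℝ, E) (christoffel cov (f p)) (f p) (df E F f p v)
          (tcomp (f p) (f p) (V p)) (tcomp (f p) (f p) (df E F f p (Y p)))
      + christoffel cov (f p) (f p)
          (mvfderiv 𝓘(ℝ, F) (fun q ↦ tcomp (f p) (f q) (V q)) p v)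
          (tcomp (f p) (f p) (df E F f p (Y p)))
      + christoffel cov (f p) (f p) (tcomp (f p) (f p) (V p))
          (mvfderiv 𝓘(ℝ, F) (fun q ↦ mvfderiv 𝓘(ℝ, F)
            (fun q ↦ extChartAt 𝓘(ℝ, E) (f p) (f q)) q (Y q)) p v)
      + christoffel cov (f p) (f p)
          (mvfderiv 𝓘(ℝ, F) (fun q ↦ tcomp (f p) (f q) (V q)) p (Y p))
          (tcomp (f p) (f p) (df E F f p v))
      + christoffel cov (f p) (f p)
          (christoffel cov (f p) (f p) (tcomp (f p) (f p) (V p))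
            (tcomp (f p) (f p) (df E F f p (Y p))))
          (tcomp (f p) (f p) (df E F f p v)) := by
  have hx := mem_chart_source E (f p)
  have hxe := eventually_mem_chart_source hf hx
  have hOe := hO.mem_nhds hp
  have e : (fun q ↦ tcomp (f p) (f q) (KNorden.covAlong cov f V q (Y q))) =ᶠ[𝓝 p] fun q ↦
      mvfderiv 𝓘(ℝ, F) (fun q ↦ tcomp (f p) (f q) (V q)) q (Y q) +
      christoffel cov (f p) (f q) (tcomp (f p) (f q) (V q))
        (mvfderiv 𝓘(ℝ, F) (fun q ↦ extChartAt 𝓘(ℝ, E) (f p) (f q)) q (Y q)) := by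
    filter_upwards [hxe, hOe] with q hq hqO using tcomp_covAlong cov hf hq (hV q hqO) _
  have d1 : ContMDiffAt 𝓘(ℝ, F) 𝓘(ℝ, E) ∞
      (fun q ↦ mvfderiv 𝓘(ℝ, F) (fun q ↦ tcomp (f p) (f q) (V q)) q (Y q)) p := by
    refine contMDiffAt_mvfderiv hO hp ?_ hY
    filter_upwards [hxe, hOe] with q hq hqO using (smoothAlongAt_iff hq (hf q)).1 (hV q hqO)
  have d2 : ContMDiffAt 𝓘(ℝ, F) 𝓘(ℝ, E →L[ℝ] E →L[ℝ] E) ∞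
      (fun q ↦ christoffel cov (f p) (f q)) p :=
    (contMDiffAt_christoffel cov hcov hx).comp p (hf p)
  have d3 := (smoothAlongAt_iff hx (hf p)).1 (hV p hp)
  have d4 := contMDiffAt_mvfderiv (h := fun q ↦ extChartAt 𝓘(ℝ, E) (f p) (f q)) hO hp
    (hxe.mono fun q hq ↦ contMDiffAt_chart_comp hf hq) hY
  have D2 := d2.mdifferentiableAt (by simp)
  have D3 := d3.mdifferentiableAt (by simp)
  rw [tcomp_covAlong cov hf hx (SmoothAlongAt.covAlong cov hf hcov hO hp hY hV), mvfderiv_congr e,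
    mvfderiv_fun_add (d1.mdifferentiableAt (by simp)) (((d2.clm_apply d3).clm_apply
      d4).mdifferentiableAt (by simp)), add_apply,
    mvfderiv_clm_apply ((d2.clm_apply d3).mdifferentiableAt (by simp))
      (d4.mdifferentiableAt (by simp)),
    mvfderiv_clm_apply D2 D3, tcomp_covAlong cov hf hx (hV p hp), ← tcomp_df hf hx,
    ← tcomp_df hf hx,
    mvfderiv_comp_map (h := christoffel cov (f p))
      ((contMDiffAt_christoffel cov hcov hx).mdifferentiableAt (by simp))
      ((hf p).mdifferentiableAt (by simp))]
  simp only [map_add, add_apply]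
  abel

/-- The curvature of the connection along `f` in terms of the Christoffel symbols of the target. -/
theorem covAlong_curvature_coord (hf : ContMDiff 𝓘(ℝ, F) 𝓘(ℝ, E) ∞ f)
    (hcov : IsLeviCivita g cov) (hO : IsOpen O) (hp : p ∈ O) {X Y : VField F M}
    (hX : IsSmoothOn X O) (hY : IsSmoothOn Y O)
    {V : Π p : M, TangentSpace 𝓘(ℝ, E) (f p)} (hV : ∀ q ∈ O, SmoothAlongAt F f V q) :
    covAlong cov f (fun q ↦ covAlong cov f V q (Y q)) p (X p)
      - covAlong cov f (fun q ↦ covAlong cov f V q (X q)) p (Y p)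
      - covAlong cov f V p (VectorField.mlieBracket 𝓘(ℝ, F) X Y p) =
    tvec (f p) (f p) (coordCurv cov (f p) (tcomp (f p) (f p) (df E F f p (X p)))
      (tcomp (f p) (f p) (df E F f p (Y p))) (tcomp (f p) (f p) (V p))) := by
  have hx := mem_chart_source E (f p)
  apply tcomp_injective hx
  rw [tcomp_tvec hx, map_sub, map_sub, tcomp_covAlong_covAlong cov hf hcov hO hp hY hV,
    tcomp_covAlong_covAlong cov hf hcov hO hp hX hV, tcomp_covAlong cov hf hx (hV p hp),
    mvfderiv_mlieBracket ((smoothAlongAt_iff hx (hf p)).1 (hV p hp)) hO hp hX hY,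
    mvfderiv_mlieBracket (contMDiffAt_chart_comp hf hx) hO hp hX hY, coordCurv,
    christoffelDeriv_apply, christoffelDeriv_apply, tvec_tcomp hx, tvec_tcomp hx]
  simp only [map_sub]
  abel

/-- The extension of a tangent vector with constant components is smooth on the chart domain. -/
theorem isSmoothOn_extend (x : M) (v : TangentSpace 𝓘(ℝ, F) x) :
    IsSmoothOn (FiberBundle.extend F v : VField F M) (chartAt F x).source := by
  intro y hy
  refine ContMDiffAt.contMDiffWithinAt ?_
  rw [contMDiffAt_vfield_iff (n := ⊤) hy]
  refine (contMDiffAt_const (c := tcomp x x v)).congr_of_eventuallyEq ?_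
  filter_upwards [(chartAt F x).open_source.mem_nhds hy] with z hz
  rw [extend_eq_tvec hz, tcomp_tvec hz]

/-- The covariant derivative along the identity is the covariant derivative. -/
theorem covAlong_id {x : Mb} {W : VField E Mb} {O : Set Mb} (hO : IsOpen O)
    (hx : x ∈ O) (hW : IsSmoothOn W O) (v : TangentSpace 𝓘(ℝ, E) x) :
    covAlong cov id W x v = cov W x v := by
  refine (covAlong_comp (f := id) (W := W) cov contMDiff_id
    (hW.contMDiffAt (hO.mem_nhds hx)) v).trans ?_
  rw [df, mfderiv_id]
  rfl

theorem covAlong_id_eventuallyEq {x : Mb} {W V : VField E Mb} {O : Set Mb} (hO : IsOpen O)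
    (hx : x ∈ O) (hW : IsSmoothOn W O) :
    ∀ᶠ y in 𝓝 x, covAlong cov id W y (V y) = cov W y (V y) := by
  filter_upwards [hO.mem_nhds hx] with y hy using covAlong_id cov hO hy hW _

theorem isSmoothOn_cov {O : Set Mb} (hcov : IsLeviCivita g cov) (hO : IsOpen O) {X Y : VField E Mb}
    (hX : IsSmoothOn X O) (hY : IsSmoothOn Y O) :
    IsSmoothOn (fun y ↦ cov Y y (X y)) O := by
  intro x hx
  have h := SmoothAlongAt.covAlong cov (f := id) contMDiff_id hcov hO hx hX (V := Y)
    (fun q hq ↦ hY.contMDiffAt (hO.mem_nhds hq))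
  exact (h.congr ((covAlong_id_eventuallyEq cov hO hx hY).mono fun _ h ↦ h.symm)).contMDiffWithinAt

theorem curvature_eq_coord {O : Set Mb} (hcov : IsLeviCivita g cov) (hO : IsOpen O)
    {X Y Z : VField E Mb} (hX : IsSmoothOn X O) (hY : IsSmoothOn Y O) (hZ : IsSmoothOn Z O)
    {x : Mb} (hx : x ∈ O) :
    curvature (fun Y y a ↦ cov Y y a) X Y Z x =
      tvec x x (coordCurv cov x (tcomp x x (X x)) (tcomp x x (Y x)) (tcomp x x (Z x))) := by
  have h := covAlong_curvature_coord cov (f := id) contMDiff_id hcov hO hx hX hY (V := Z)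
    (fun q hq ↦ hZ.contMDiffAt (hO.mem_nhds hq))
  have e : ∀ (W : VField E Mb), IsSmoothOn W O → ∀ v, covAlong cov id W x v = cov W x v :=
    fun W hW v ↦ covAlong_id cov hO hx hW v
  have e2 : ∀ X : VField E Mb, IsSmoothOn X O → ∀ v,
      covAlong cov id (fun y ↦ covAlong cov id Z y (X y)) x v = cov (fun y ↦ cov Z y (X y)) x v :=
    fun X hX v ↦ by
      rw [← e _ (isSmoothOn_cov cov hcov hO hX hZ)]
      exact covAlong_congr cov contMDiff_id (covAlong_id_eventuallyEq cov hO hx hZ) v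
  simp only [df, mfderiv_id] at h
  rw [e2 _ hX, e2 _ hY] at h
  exact (congrArg _ (e Z hZ _).symm).trans h

theorem curvatureAt_eq_coord (hcov : IsLeviCivita g cov) (x : Mb)
    (u v w : TangentSpace 𝓘(ℝ, E) x) :
    curvatureAt (fun Y y a ↦ cov Y y a) x u v w =
      tvec x x (coordCurv cov x (tcomp x x u) (tcomp x x v) (tcomp x x w)) := by
  rw [curvatureAt, curvature_eq_coord cov hcov (chartAt E x).open_source (isSmoothOn_extend x u)
    (isSmoothOn_extend x v) (isSmoothOn_extend x w) (mem_chart_source E x)]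
  simp

/-- The curvature of the connection along `f` is the curvature of the target. -/
theorem covAlong_curvature (hf : ContMDiff 𝓘(ℝ, F) 𝓘(ℝ, E) ∞ f)
    (hcov : IsLeviCivita g cov) (hO : IsOpen O) (hp : p ∈ O) {X Y : VField F M}
    (hX : IsSmoothOn X O) (hY : IsSmoothOn Y O)
    {V : Π p : M, TangentSpace 𝓘(ℝ, E) (f p)} (hV : ∀ q ∈ O, SmoothAlongAt F f V q) :
    covAlong cov f (fun q ↦ covAlong cov f V q (Y q)) p (X p)
      - covAlong cov f (fun q ↦ covAlong cov f V q (X q)) p (Y p)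
      - covAlong cov f V p (VectorField.mlieBracket 𝓘(ℝ, F) X Y p) =
    curvatureAt (fun Y y a ↦ cov Y y a) (f p) (df E F f p (X p)) (df E F f p (Y p)) (V p) := by
  rw [covAlong_curvature_coord cov hf hcov hO hp hX hY hV, curvatureAt_eq_coord cov hcov]

end CurvatureAlong

/-! ### Algebraic curvature tensors -/

section Algebra

variable {K V : Type*} [Field K] [AddCommGroup V] [Module K V]

/-- `R` has the algebraic symmetries of a curvature tensor of type (0,4). Linearity in the other
arguments follows from linearity in the first one and the symmetries. -/
structure IsCurvatureLike (K : Type*) {V : Type*} [Field K] [AddCommGroup V] [Module K V]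
    (R : V → V → V → V → K) : Prop where
  add₁ : ∀ x x' y z w, R (x + x') y z w = R x y z w + R x' y z w
  smul₁ : ∀ (c : K) x y z w, R (c • x) y z w = c * R x y z w
  skew₁₂ : ∀ x y z w, R x y z w = - R y x z w
  skew₃₄ : ∀ x y z w, R x y z w = - R x y w z
  bianchi : ∀ x y z w, R x y z w + R y z x w + R z x y w = 0

namespace IsCurvatureLike

variable {R : V → V → V → V → K} (hR : IsCurvatureLike K R)
include hR

theorem add₂ (x y y' z w) : R x (y + y') z w = R x y z w + R x y' z w := by
  rw [hR.skew₁₂, hR.add₁, hR.skew₁₂ y, hR.skew₁₂ y']; ring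

theorem smul₂ (c : K) (x y z w) : R x (c • y) z w = c * R x y z w := by
  rw [hR.skew₁₂, hR.smul₁, hR.skew₁₂ y]; ring

variable [CharZero K]

/-- The pair symmetry, from the four Bianchi identities that omit one of the arguments in turn. -/
theorem pair_symm (x y z w) : R x y z w = R z w x y := by
  have h1 := hR.bianchi x y z w
  have h2 := hR.bianchi y z w x
  have h3 := hR.bianchi z w x y
  have h4 := hR.bianchi w x y z
  have e1 := hR.skew₃₄ x y z w
  have e2 := hR.skew₃₄ y z x w
  have e3 := hR.skew₃₄ z x y w
  have e4 := hR.skew₃₄ z w x y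
  have e5 := hR.skew₃₄ w x z y
  have e6 := hR.skew₃₄ w y z x
  have e7 := hR.skew₁₂ z x y w
  have e8 := hR.skew₁₂ z x w y
  have e9 := hR.skew₁₂ w y x z
  have e10 := hR.skew₁₂ w y z x
  have : (2 : K) * R x y z w = 2 * R z w x y := by
    grind
  exact mul_left_cancel₀ two_ne_zero this

theorem add₃ (x y z z' w) : R x y (z + z') w = R x y z w + R x y z' w := by
  rw [hR.pair_symm, hR.add₁, hR.pair_symm z, hR.pair_symm z']

theorem smul₃ (c : K) (x y z w) : R x y (c • z) w = c * R x y z w := by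
  rw [hR.pair_symm, hR.smul₁, hR.pair_symm z]

theorem add₄ (x y z w w') : R x y z (w + w') = R x y z w + R x y z w' := by
  rw [hR.pair_symm, hR.add₂, hR.pair_symm z, hR.pair_symm z]

theorem smul₄ (c : K) (x y z w) : R x y z (c • w) = c * R x y z w := by
  rw [hR.pair_symm, hR.smul₂, hR.pair_symm z]

theorem self₁₂ (x z w) : R x x z w = 0 := by
  have := hR.skew₁₂ x x z w
  exact self_eq_neg.1 this

theorem self₃₄ (x y z) : R x y z z = 0 := by
  have := hR.skew₃₄ x y z z
  exact self_eq_neg.1 this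

/-- A curvature-like tensor is determined by its sectional curvatures. -/
theorem eq_zero (h : ∀ x y, R x y y x = 0) (x y z w) : R x y z w = 0 := by
  have h1 : ∀ x y w, R x y y w = 0 := by
    intro x y w
    have h2 := h (x + w) y
    rw [hR.add₁, hR.add₄, hR.add₄, h, h, hR.pair_symm w, hR.skew₁₂ y x, hR.skew₃₄ x y w] at h2
    have : (2 : K) * R x y y w = 0 := by linear_combination h2
    simpa using this
  have h2 : ∀ x y z w, R x y z w = - R x z y w := by
    intro x y z w
    have := h1 x (y + z) w
    rw [hR.add₂, hR.add₃, hR.add₃, h1, h1] at this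
    linear_combination this
  have h3 : (3 : K) * R x y z w = 0 := by
    linear_combination hR.bianchi x y z w - h2 y z x w + hR.skew₁₂ y x z w - hR.skew₁₂ z x y w
      + h2 x z y w
  simpa using h3

/-- A tensor with the symmetries of a curvature tensor that commutes with `J` in the last two
arguments is `J`-linear in all arguments. -/
theorem J₁₃ {J : V → V} (hJ : ∀ x y z w, R x y (J z) w = R x y z (J w)) (x y z w) :
    R (J x) y z w = R x y z (J w) := by
  have h12 : ∀ x y z w, R (J x) y z w = R x (J y) z w := fun x y z w ↦ by
    rw [hR.pair_symm, hJ, hR.pair_symm z]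
  -- the difference changes sign under a cyclic permutation of order three
  have key : ∀ x y z, R (J x) y z w - R x y z (J w) = - (R (J z) x y w - R z x y (J w)) := by
    intro x y z
    linear_combination hR.bianchi (J x) y z w - hR.bianchi x y z (J w) - hJ y z x w + h12 z x y w
  have : (2 : K) * (R (J x) y z w - R x y z (J w)) = 0 := by
    linear_combination key x y z - key z x y + key y z x
  rw [← sub_eq_zero]
  simpa using this

end IsCurvatureLike

end Algebra

open Polynomial in
/-- A polynomial that vanishes where a nonzero polynomial does not vanish is zero. -/
theorem polynomial_eq_zero_of_eval {q p : ℂ[X]} (hp : p ≠ 0)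
    (h : ∀ t, p.eval t ≠ 0 → q.eval t = 0) : q = 0 := by
  have : q * p = 0 := Polynomial.funext fun t ↦ by
    by_cases ht : p.eval t = 0
    · simp [ht]
    · simp [h t ht]
  exact (mul_eq_zero.1 this).resolve_right hp

open Polynomial in
theorem quadratic_ne_zero {a b c : ℂ} (hc : c ≠ 0) : (C a + C b * X + C c * X ^ 2 : ℂ[X]) ≠ 0 := by
  intro h
  have := congrArg (fun p ↦ p.coeff 2) h
  simp at this
  exact hc this

section ComplexAlgebra

variable {V : Type*} [AddCommGroup V] [Module ℂ V] {R : V → V → V → V → ℂ}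
  (hR : IsCurvatureLike ℂ R) {h : V → V → ℂ} (hsymm : ∀ x y, h x y = h y x)
  (hadd : ∀ x x' y, h (x + x') y = h x y + h x' y)
  (hsmul : ∀ (c : ℂ) x y, h (c • x) y = c * h x y)
include hR hsymm hadd hsmul

/-- Subtraction of a constant multiple of the curvature tensor of constant curvature. -/
theorem IsCurvatureLike.sub_const (c : ℂ) :
    IsCurvatureLike ℂ fun x y z w ↦ R x y z w - c * (h y z * h x w - h x z * h y w) where
  add₁ x x' y z w := by simp only [hR.add₁, hadd]; ring
  smul₁ a x y z w := by simp only [hR.smul₁, hsmul]; ring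
  skew₁₂ x y z w := by rw [hR.skew₁₂]; ring
  skew₃₄ x y z w := by rw [hR.skew₃₄]; ring
  bianchi x y z w := by
    rw [hsymm y x, hsymm z x, hsymm z y]
    linear_combination hR.bianchi x y z w

/-- A complex curvature-like tensor vanishes if its sectional curvatures vanish on all orthonormal
pairs of a complex metric `h`, and `h` is nondegenerate on some plane. Nondegeneracy of a plane is
a polynomial condition, so the vanishing extends from the nondegenerate planes to all planes. -/
theorem IsCurvatureLike.eq_zero_of_orthonormal
    (h0 : ∀ x y, h x x = 1 → h y y = 1 → h x y = 0 → R x y y x = 0)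
    {x₀ y₀ : V} (hx₀ : h x₀ x₀ ≠ 0) (hG : h x₀ x₀ * h y₀ y₀ - h x₀ y₀ ^ 2 ≠ 0) (x y z w) :
    R x y z w = 0 := by
  have hadd' : ∀ x y y', h x (y + y') = h x y + h x y' := fun x y y' ↦ by
    rw [hsymm, hadd, hsymm y, hsymm y']
  have hsmul' : ∀ (c : ℂ) x y, h x (c • y) = c * h x y := fun c x y ↦ by
    rw [hsymm, hsmul, hsymm y]
  -- nondegenerate planes, by orthonormalization with complex square roots
  have h1 : ∀ x y, h x x ≠ 0 → h x x * h y y - h x y ^ 2 ≠ 0 → R x y y x = 0 := by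
    intro x y hx hG
    obtain ⟨s, hs⟩ := IsAlgClosed.exists_pow_nat_eq (h x x) zero_lt_two
    obtain ⟨r, hr⟩ := IsAlgClosed.exists_pow_nat_eq
      ((h x x * h y y - h x y ^ 2) / h x x) zero_lt_two
    have hs0 : s ≠ 0 := by rintro rfl; exact hx (by simpa using hs.symm)
    have hr0 : r ≠ 0 := by
      rintro rfl
      exact div_ne_zero hG hx (by simpa using hr.symm)
    have hr' : r ^ 2 * h x x = h x x * h y y - h x y ^ 2 := by rw [hr]; field_simp
    have := h0 (s⁻¹ • x) (r⁻¹ • (y + (-(h x y / h x x)) • x)) (by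
      rw [hsmul, hsmul', ← hs]; field_simp) (by
      simp only [hsmul, hsmul', hadd, hadd', hsymm y x]; field_simp; linear_combination -hr') (by
      simp only [hsmul, hsmul', hadd']; field_simp; ring)
    simp only [hR.smul₁, hR.smul₂, hR.smul₃, hR.smul₄, hR.add₂, hR.add₃, hR.self₁₂,
      hR.self₃₄] at this
    simpa [hs0, hr0] using this
  -- `x + t x₀` and `y` span a nondegenerate plane for all but finitely many `t`
  have h2 : ∀ y, h x₀ x₀ * h y y - h x₀ y ^ 2 ≠ 0 → ∀ x, R x y y x = 0 := by
    intro y hy x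
    open Polynomial in
    have := polynomial_eq_zero_of_eval
      (q := C (R x y y x) + C (R x y y x₀ + R x₀ y y x) * X + C (R x₀ y y x₀) * X ^ 2)
      (p := (C (h x x) + C (2 * h x x₀) * X + C (h x₀ x₀) * X ^ 2) *
        (C (h x x * h y y - h x y ^ 2) + C (2 * (h x x₀ * h y y - h x y * h x₀ y)) * X +
          C (h x₀ x₀ * h y y - h x₀ y ^ 2) * X ^ 2))
      (mul_ne_zero (quadratic_ne_zero hx₀) (quadratic_ne_zero hy)) (by
        intro t ht
        have e := h1 (x + t • x₀) y (by
          intro h'; apply ht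
          simp only [hadd, hadd', hsmul, hsmul', hsymm x₀ x] at h'
          simp only [eval_mul, eval_add, eval_C, eval_X, eval_pow]
          linear_combination h' *
            (h x x * h y y - h x y ^ 2 + 2 * (h x x₀ * h y y - h x y * h x₀ y) * t +
              (h x₀ x₀ * h y y - h x₀ y ^ 2) * t ^ 2)) (by
          intro h'; apply ht
          simp only [hadd, hadd', hsmul, hsmul', hsymm x₀ x] at h'
          simp only [eval_mul, eval_add, eval_C, eval_X, eval_pow]
          linear_combination (h x x + 2 * h x x₀ * t + h x₀ x₀ * t ^ 2) * h')
        simp only [hR.add₁, hR.add₄, hR.smul₁, hR.smul₄] at e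
        simp only [eval_mul, eval_add, eval_C, eval_X, eval_pow]
        linear_combination e)
    simpa using congrArg (eval 0) this
  refine hR.eq_zero (fun x y ↦ ?_) x y z w
  -- `x₀` and `y + t y₀` span a nondegenerate plane for all but finitely many `t`
  open Polynomial in
  have := polynomial_eq_zero_of_eval
      (q := C (R x y y x) + C (R x y y₀ x + R x y₀ y x) * X + C (R x y₀ y₀ x) * X ^ 2)
      (p := C (h x₀ x₀ * h y y - h x₀ y ^ 2) +
        C (2 * (h x₀ x₀ * h y y₀ - h x₀ y * h x₀ y₀)) * X +
          C (h x₀ x₀ * h y₀ y₀ - h x₀ y₀ ^ 2) * X ^ 2)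
      (quadratic_ne_zero hG) (by
        intro t ht
        have e := h2 (y + t • y₀) (by
          intro h'; apply ht
          simp only [hadd, hadd', hsmul, hsmul', hsymm y₀ y] at h'
          simp only [eval_mul, eval_add, eval_C, eval_X, eval_pow]
          linear_combination h') x
        simp only [hR.add₂, hR.add₃, hR.smul₂, hR.smul₃] at e
        simp only [eval_mul, eval_add, eval_C, eval_X, eval_pow]
        linear_combination e)
  simpa using congrArg (Polynomial.eval 0) this

end ComplexAlgebra

/-! ### Symmetries of the curvature of a Kähler–Norden manifold -/

section AmbientCurvature

variable {E : Type*} [NormedAddCommGroup E] [NormedSpace ℝ E] [FiniteDimensional ℝ E]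
  {Mb : Type*} [TopologicalSpace Mb] [ChartedSpace E Mb] [IsManifold 𝓘(ℝ, E) ∞ Mb]
  {cov : CovariantDerivative 𝓘(ℝ, E) E (TangentSpace 𝓘(ℝ, E) : Mb → Type _)}
  {g : SemiRiemannianMetric E Mb} (hcov : IsLeviCivita g cov)
include hcov

/-- The first Bianchi identity, from the symmetry of the Christoffel symbols. -/
theorem coordCurv_bianchi (x : Mb) (a b c : E) :
    coordCurv cov x a b c + coordCurv cov x b c a + coordCurv cov x c a b = 0 := by
  have hx := mem_chart_source E x
  have d := (contMDiffAt_christoffel cov hcov hx).mdifferentiableAt (by simp)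
  have h1 : ∀ (v : TangentSpace 𝓘(ℝ, E) x) (a b : E),
      mvfderiv 𝓘(ℝ, E) (christoffel cov x) x v a b =
        mvfderiv 𝓘(ℝ, E) (fun y ↦ christoffel cov x y a b) x v := by
    intro v a b
    have d' : MDifferentiableAt 𝓘(ℝ, E) 𝓘(ℝ, E →L[ℝ] E) (fun y ↦ christoffel cov x y a) x :=
      d.clm_apply mdifferentiableAt_const
    rw [mvfderiv_clm_apply d' mdifferentiableAt_const, mvfderiv_clm_apply d mdifferentiableAt_const,
      mvfderiv_const, mvfderiv_const]
    simp
  have h2 : ∀ (v : TangentSpace 𝓘(ℝ, E) x) (a b : E),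
      mvfderiv 𝓘(ℝ, E) (christoffel cov x) x v a b =
        mvfderiv 𝓘(ℝ, E) (christoffel cov x) x v b a := by
    intro v a b
    rw [h1, h1]
    refine mvfderiv_congr ?_ v
    filter_upwards [(chartAt E x).open_source.mem_nhds hx] with y hy
      using christoffel_symm cov hcov hy a b
  simp only [coordCurv, christoffelDeriv_apply]
  rw [h2 _ c b, h2 _ a c, h2 _ b a, christoffel_symm cov hcov hx c b,
    christoffel_symm cov hcov hx a c, christoffel_symm cov hcov hx b a]
  abel

set_option synthInstance.maxHeartbeats 200000 in
omit hcov in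
theorem coordCurv_add (x : Mb) (a a' b c : E) :
    coordCurv cov x (a + a') b c = coordCurv cov x a b c + coordCurv cov x a' b c := by
  simp only [coordCurv]
  generalize christoffelDeriv cov x = D
  generalize christoffel cov x x = Γ
  simp only [map_add, add_apply]
  abel

set_option synthInstance.maxHeartbeats 200000 in
omit hcov in
theorem coordCurv_smul (x : Mb) (t : ℝ) (a b c : E) :
    coordCurv cov x (t • a) b c = t • coordCurv cov x a b c := by
  simp only [coordCurv]
  generalize christoffelDeriv cov x = D
  generalize christoffel cov x x = Γ
  simp only [map_smul, smul_apply, smul_add, smul_sub]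

theorem curvatureAt_add₃ (x : Mb) (u v w w' : TangentSpace 𝓘(ℝ, E) x) :
    curvatureAt (fun Y y a ↦ cov Y y a) x u v (w + w') =
      curvatureAt (fun Y y a ↦ cov Y y a) x u v w +
      curvatureAt (fun Y y a ↦ cov Y y a) x u v w' := by
  simp only [curvatureAt_eq_coord cov hcov, coordCurv, map_add, add_apply]
  rw [← map_add]
  congr 1
  abel

omit hcov in
theorem smoothAlongAt_extend (x : Mb) (w : TangentSpace 𝓘(ℝ, E) x) :
    ∀ y ∈ (chartAt E x).source,
      SmoothAlongAt E (id : Mb → Mb) (FiberBundle.extend E w : VField E Mb) y := fun _ hq ↦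
  (isSmoothOn_extend x w).contMDiffAt ((chartAt E x).open_source.mem_nhds hq)

/-- The curvature is skew with respect to the metric: the second derivatives of `g(Z, Z)` commute up
to the bracket. -/
theorem curvatureFour_self (x : Mb) (u v w : TangentSpace 𝓘(ℝ, E) x) :
    curvatureFour g cov x u v w w = 0 := by
  have hO := (chartAt E x).open_source
  have hx := mem_chart_source E x
  have hZ := smoothAlongAt_extend x w
  have hX := isSmoothOn_extend x u
  have hY := isSmoothOn_extend x v
  set X : VField E Mb := FiberBundle.extend E u
  set Y : VField E Mb := FiberBundle.extend E v
  set Z : VField E Mb := FiberBundle.extend E w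
  have hR := covAlong_curvature cov (f := id) contMDiff_id hcov hO hx hX hY hZ
  have e1 : ∀ Y : VField E Mb, IsSmoothOn Y (chartAt E x).source →
      ∀ a, mvfderiv 𝓘(ℝ, E) (fun q ↦ mvfderiv 𝓘(ℝ, E) (fun q ↦ g.val q (Z q) (Z q)) q (Y q)) x a =
      2 * (g.val x (covAlong cov id (fun q ↦ covAlong cov id Z q (Y q)) x a) (Z x) +
        g.val x (covAlong cov id Z x (Y x)) (covAlong cov id Z x a)) := by
    intro Y hY a
    have h1 : (fun q ↦ mvfderiv 𝓘(ℝ, E) (fun q ↦ g.val q (Z q) (Z q)) q (Y q)) =ᶠ[𝓝 x] fun q ↦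
        (2 : ℝ) • g.val q (covAlong cov id Z q (Y q)) (Z q) := by
      filter_upwards [hO.mem_nhds hx] with q hq
      refine (mvfderiv_metric_along cov (f := id) g contMDiff_id hcov (hZ q hq) (hZ q hq)
        _).trans ?_
      refine (congrArg _ (g.symm q (Z q) _)).trans ?_
      exact (two_mul _).symm
    have h2 := SmoothAlongAt.covAlong cov (f := id) contMDiff_id hcov hO hx hY hZ
    rw [mvfderiv_congr h1]
    refine (mvfderiv_clm_comp ((2 : ℝ) • ContinuousLinearMap.id ℝ ℝ)
      ((SmoothAlongAt.metric (f := id) g contMDiffAt_id h2 (hZ x hx)).mdifferentiableAt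
        (by simp)) a).trans ?_
    exact congrArg (fun t : ℝ ↦ 2 * t)
      (mvfderiv_metric_along cov (f := id) g contMDiff_id hcov h2 (hZ x hx) a)
  have h3 := mvfderiv_mlieBracket (SmoothAlongAt.metric (f := id) g contMDiffAt_id (hZ x hx)
    (hZ x hx)) hO hx hX hY
  have h4 := mvfderiv_metric_along cov (f := id) g contMDiff_id hcov (hZ x hx) (hZ x hx)
    (VectorField.mlieBracket 𝓘(ℝ, E) X Y x)
  simp only [id] at h3 h4
  rw [e1 _ hX, e1 _ hY, h4] at h3
  have h5 : curvatureFour g cov x u v w w = g.val x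
      (covAlong cov id (fun q ↦ covAlong cov id Z q (Y q)) x (X x)
      - covAlong cov id (fun q ↦ covAlong cov id Z q (X q)) x (Y x)
      - covAlong cov id Z x (VectorField.mlieBracket 𝓘(ℝ, E) X Y x)) (Z x) := by
    rw [hR]
    simp [curvatureFour, X, Y, Z, df]
  rw [h5]
  simp only [map_sub, sub_apply]
  rw [g.symm x (Z x)] at h3
  rw [g.symm x (covAlong cov id Z x (X x))] at h3
  linear_combination (-1/2) * h3

/-- The curvature operators of a connection commute with a parallel structure `J`. -/
theorem curvatureAt_J (J : NordenStructure g) (hJ : IsParallel J cov) (x : Mb)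
    (u v w : TangentSpace 𝓘(ℝ, E) x) :
    curvatureAt (fun Y y a ↦ cov Y y a) x u v (J.J x w) =
      J.J x (curvatureAt (fun Y y a ↦ cov Y y a) x u v w) := by
  have hO := (chartAt E x).open_source
  have hx := mem_chart_source E x
  have hZ := smoothAlongAt_extend x w
  have hX := isSmoothOn_extend x u
  have hY := isSmoothOn_extend x v
  set X : VField E Mb := FiberBundle.extend E u with hXdef
  set Y : VField E Mb := FiberBundle.extend E v
  set Z : VField E Mb := FiberBundle.extend E w
  have hR := covAlong_curvature cov (f := id) contMDiff_id hcov hO hx hX hY hZ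
  have hRJ := covAlong_curvature cov (f := id) (V := fun q ↦ J.J q (Z q)) contMDiff_id hcov hO hx
    hX hY
    (fun q hq ↦ (hZ q hq).J J contMDiffAt_id)
  have e : ∀ Y : VField E Mb, IsSmoothOn Y (chartAt E x).source →
      ∀ a : TangentSpace 𝓘(ℝ, E) x,
        covAlong cov id (fun q ↦ covAlong cov id (fun q ↦ J.J q (Z q)) q (Y q)) x a =
        J.J x (covAlong cov id (fun q ↦ covAlong cov id Z q (Y q)) x a) := by
    intro Y hY a
    have h2 := SmoothAlongAt.covAlong cov (f := id) contMDiff_id hcov hO hx hY hZ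
    refine Eq.trans ?_ (covAlong_J cov (f := id) contMDiff_id J hJ h2 a)
    refine covAlong_congr cov contMDiff_id ?_ a
    filter_upwards [hO.mem_nhds hx] with q hq
      using covAlong_J cov (f := id) contMDiff_id J hJ (hZ q hq) _
  have e' : ∀ a : TangentSpace 𝓘(ℝ, E) x, covAlong cov id (fun q ↦ J.J q (Z q)) x a =
      J.J x (covAlong cov id Z x a) := covAlong_J cov (f := id) contMDiff_id J hJ (hZ x hx)
  rw [e _ hX, e _ hY, e'] at hRJ
  have e2 : ∀ z, curvatureAt (fun Y y a ↦ cov Y y a) x u v z =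
      curvatureAt (fun Y y a ↦ cov Y y a) (id x) (df E E id x (X x)) (df E E id x (Y x)) z := by
    intro z
    simp [X, Y, df]
  have e3 : w = Z x := by simp [Z]
  rw [e2, e2]
  conv_lhs => rw [e3]
  conv_rhs => rw [e3]
  refine hRJ.symm.trans ?_
  rw [← hR]
  simp

/-- The curvature tensor of type (0,4) of a Levi-Civita connection has the usual symmetries. -/
theorem isCurvatureLike_curvatureFour (x : Mb) : IsCurvatureLike ℝ (curvatureFour g cov x) where
  add₁ u u' v w z := by
    simp only [curvatureFour, curvatureAt_eq_coord cov hcov, map_add (tcomp x x), coordCurv_add,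
      map_add (tvec x x), map_add (g.val x), add_apply]
  smul₁ c u v w z := by
    simp only [curvatureFour, curvatureAt_eq_coord cov hcov, map_smul (tcomp x x), coordCurv_smul,
      map_smul (tvec x x), map_smul (g.val x), smul_apply, smul_eq_mul]
  skew₁₂ u v w z := by
    simp only [curvatureFour, curvatureAt_eq_coord cov hcov, coordCurv, map_add, add_apply, map_sub,
      sub_apply]
    ring
  skew₃₄ u v w z := by
    have h := curvatureFour_self hcov x u v (w + z)
    have h1 := curvatureFour_self hcov x u v w
    have h2 := curvatureFour_self hcov x u v z
    simp only [curvatureFour, curvatureAt_add₃ hcov, map_add, add_apply] at h h1 h2 ⊢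
    linear_combination h - h1 - h2
  bianchi u v w z := by
    have := coordCurv_bianchi hcov x (tcomp x x u) (tcomp x x v) (tcomp x x w)
    have := congrArg (fun a ↦ g.val x (tvec x x a) z) this
    simpa only [curvatureFour, curvatureAt_eq_coord cov hcov, map_add, add_apply, map_zero,
      zero_apply] using this

end AmbientCurvature

/-! ### The curvature tensor for constant totally real sectional curvatures -/

section ConstantCurvature

/-- The complex structure on a real vector space defined by an operator `J` with `J² = -1`. -/
abbrev complexModule {V : Type*} [AddCommGroup V] [Module ℝ V] (J : V →ₗ[ℝ] V)
    (hJ : ∀ v, J (J v) = -v) : Module ℂ V where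
  smul z v := z.re • v + z.im • J v
  one_smul v := by
    change (1 : ℂ).re • v + (1 : ℂ).im • J v = v
    simp
  mul_smul z w v := by
    change (z * w).re • v + (z * w).im • J v =
      z.re • (w.re • v + w.im • J v) + z.im • J (w.re • v + w.im • J v)
    simp only [Complex.mul_re, Complex.mul_im, map_add, map_smul, hJ]
    module
  smul_zero z := by
    change z.re • (0 : V) + z.im • J 0 = 0
    simp
  smul_add z v w := by
    change z.re • (v + w) + z.im • J (v + w) = z.re • v + z.im • J v + (z.re • w + z.im • J w)
    simp only [map_add]
    module
  add_smul z w v := by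
    change (z + w).re • v + (z + w).im • J v = z.re • v + z.im • J v + (w.re • v + w.im • J v)
    simp only [Complex.add_re, Complex.add_im]
    module
  zero_smul v := by
    change (0 : ℂ).re • v + (0 : ℂ).im • J v = 0
    simp

variable {E : Type*} [NormedAddCommGroup E] [NormedSpace ℝ E]
  {Mb : Type*} [TopologicalSpace Mb] [ChartedSpace E Mb] [IsManifold 𝓘(ℝ, E) ∞ Mb]
  {cov : CovariantDerivative 𝓘(ℝ, E) E (TangentSpace 𝓘(ℝ, E) : Mb → Type _)}
  {g : SemiRiemannianMetric E Mb} (J : NordenStructure g)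

theorem NordenStructure.val_J (x : Mb) (u v : TangentSpace 𝓘(ℝ, E) x) :
    g.val x u (J.J x v) = g.val x (J.J x u) v := by
  have := J.anti x u (J.J x v)
  rw [J.sq, map_neg] at this
  linarith

/-- The complex metric `g - i g(J ·, ·)` of a Norden manifold. -/
def complexMetric (x : Mb) (u v : TangentSpace 𝓘(ℝ, E) x) : ℂ :=
  g.val x u v - Complex.I * g.val x (J.J x u) v

/-- An orthonormal pair of the complex metric spans a totally real section. -/
theorem HasConstantTotallyRealCurvatures.of_orthonormal {ν ν' : Mb → ℝ}
    (hν : HasConstantTotallyRealCurvatures g J cov ν ν') {x : Mb} {u v : TangentSpace 𝓘(ℝ, E) x}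
    (hu : complexMetric J x u u = 1) (hv : complexMetric J x v v = 1)
    (huv : complexMetric J x u v = 0) :
    curvatureFour g cov x u v v u = ν x ∧ curvatureFour g cov x u v v (J.J x u) = ν' x := by
  have a1 : g.val x u u = 1 := by simpa [complexMetric] using congrArg Complex.re hu
  have a2 : g.val x v v = 1 := by simpa [complexMetric] using congrArg Complex.re hv
  have a3 : g.val x u v = 0 := by simpa [complexMetric] using congrArg Complex.re huv
  have b1 : g.val x (J.J x u) u = 0 := by simpa [complexMetric] using congrArg Complex.im hu
  have b2 : g.val x (J.J x v) v = 0 := by simpa [complexMetric] using congrArg Complex.im hv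
  have b3 : g.val x (J.J x u) v = 0 := by simpa [complexMetric] using congrArg Complex.im huv
  have a4 : g.val x v u = 0 := by rw [g.symm, a3]
  have b4 : g.val x (J.J x v) u = 0 := by rw [g.symm, J.val_J, b3]
  have hli : LinearIndependent ℝ ![u, v] := by
    rw [LinearIndependent.pair_iff]
    intro s t hst
    have h1 := congrArg (g.val x u) hst
    have h2 := congrArg (g.val x v) hst
    simp only [map_add, map_smul, a1, a2, a3, a4, smul_eq_mul, map_zero] at h1 h2
    constructor <;> linarith
  have key := hν x u v hli (by
    intro w hw h0
    obtain ⟨s, t, rfl⟩ := Submodule.mem_span_pair.1 hw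
    have h1 := h0 u (Submodule.subset_span (by simp))
    have h2 := h0 v (Submodule.subset_span (by simp))
    simp only [map_add, map_smul, add_apply, smul_apply, a1, a2, a3, a4, smul_eq_mul] at h1 h2
    simp only [mul_one, mul_zero, add_zero, zero_add] at h1 h2
    simp [h1, h2]) (by
    intro w hw z hz
    obtain ⟨s, t, rfl⟩ := Submodule.mem_span_pair.1 hw
    obtain ⟨s', t', rfl⟩ := Submodule.mem_span_pair.1 hz
    simp [b1, b2, b3, b4])
  simpa [piOne, a1, a2, a3] using key

/-- The curvature tensor of a Kähler-Norden manifold of constant totally real sectional curvatures: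
with `h = g - i g(J ·, ·)` and `c = ν - i ν'` it is the real part of
`c (h(v, w) h(u, z) - h(u, w) h(v, z))`. The hypotheses on `x₀`, `y₀` say that there is a
nondegenerate complex plane. -/
theorem curvatureFour_eq [FiniteDimensional ℝ E] (hcov : IsLeviCivita g cov)
    (hJ : IsParallel J cov) {ν ν' : Mb → ℝ}
    (hν : HasConstantTotallyRealCurvatures g J cov ν ν') {x : Mb} {x₀ y₀ : TangentSpace 𝓘(ℝ, E) x}
    (hx₀ : complexMetric J x x₀ x₀ ≠ 0) (hy₀ : complexMetric J x y₀ y₀ ≠ 0)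
    (hxy : complexMetric J x x₀ y₀ = 0)
    (u v w z : TangentSpace 𝓘(ℝ, E) x) :
    curvatureFour g cov x u v w z =
      ν x * (g.val x v w * g.val x u z - g.val x (J.J x v) w * g.val x (J.J x u) z
        - (g.val x u w * g.val x v z - g.val x (J.J x u) w * g.val x (J.J x v) z))
      - ν' x * (g.val x v w * g.val x (J.J x u) z + g.val x (J.J x v) w * g.val x u z
        - (g.val x u w * g.val x (J.J x v) z + g.val x (J.J x u) w * g.val x v z)) := by
  let _ : Module ℂ (TangentSpace 𝓘(ℝ, E) x) :=
    complexModule (J.J x : TangentSpace 𝓘(ℝ, E) x →ₗ[ℝ] TangentSpace 𝓘(ℝ, E) x) (J.sq x)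
  have hsm : ∀ (c : ℂ) (v : TangentSpace 𝓘(ℝ, E) x), c • v = c.re • v + c.im • J.J x v :=
    fun _ _ ↦ rfl
  have hR := isCurvatureLike_curvatureFour hcov x
  have hRJ : ∀ u v w z, curvatureFour g cov x u v (J.J x w) z =
      curvatureFour g cov x u v w (J.J x z) := fun u v w z ↦ by
    rw [curvatureFour, curvatureAt_J hcov J hJ, curvatureFour, J.val_J]
  have hRJ' := hR.J₁₃ hRJ
  have hneg : ∀ u v w z, curvatureFour g cov x u v w (-z) = - curvatureFour g cov x u v w z :=
    fun u v w z ↦ by rw [curvatureFour, curvatureFour, map_neg]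
  have hRc : IsCurvatureLike ℂ fun u v w z ↦ (curvatureFour g cov x u v w z : ℂ)
      - Complex.I * curvatureFour g cov x u v w (J.J x z) :=
    { add₁ := fun u u' v w z ↦ by
        simp only [hR.add₁]
        push_cast
        ring
      smul₁ := fun c u v w z ↦ by
        simp only [hsm, hR.add₁, hR.smul₁, hRJ', J.sq, hneg]
        apply Complex.ext <;> simp <;> ring
      skew₁₂ := fun u v w z ↦ by
        simp only [hR.skew₁₂ u v]
        push_cast
        ring
      skew₃₄ := fun u v w z ↦ by
        simp only [hR.skew₃₄ u v w, hRJ]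
        push_cast
        ring
      bianchi := fun u v w z ↦ by
        have h1 := congrArg (fun t : ℝ ↦ (t : ℂ)) (hR.bianchi u v w z)
        have h2 := congrArg (fun t : ℝ ↦ (t : ℂ)) (hR.bianchi u v w (J.J x z))
        push_cast at h1 h2
        linear_combination h1 - Complex.I * h2 }
  have hsymm : ∀ u v, complexMetric J x u v = complexMetric J x v u := fun u v ↦ by
    rw [complexMetric, complexMetric, g.symm x u v, g.symm x _ v, J.val_J]
  have hadd : ∀ u u' v, complexMetric J x (u + u') v = complexMetric J x u v +
      complexMetric J x u' v := fun u u' v ↦ by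
    simp only [complexMetric, map_add, add_apply]
    push_cast
    ring
  have hsmul : ∀ (c : ℂ) u v, complexMetric J x (c • u) v = c * complexMetric J x u v :=
    fun c u v ↦ by
      simp only [hsm, complexMetric, map_add, map_smul, add_apply, smul_apply, J.sq, map_neg,
        neg_apply, smul_eq_mul]
      apply Complex.ext <;> simp <;> ring
  have key := (hRc.sub_const hsymm hadd hsmul (ν x - Complex.I * ν' x)).eq_zero_of_orthonormal
    hsymm hadd hsmul (fun u v hu hv huv ↦ by
      have h := hν.of_orthonormal J hu hv huv
      rw [h.1, h.2, hu, hv, huv]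
      ring) hx₀ (by rw [hxy]; simp [hx₀, hy₀]) u v w z
  have := congrArg Complex.re key
  simp only [complexMetric] at this
  simp at this
  linear_combination this

end ConstantCurvature

/-! ### A trace, the differential of an immersion, extension of tangent vectors -/

/-- An operator `K` with `K³ = -K` has trace zero: its complex eigenvalues are `0` and `±i`. -/
theorem trace_eq_zero_of_cube {V : Type*} [AddCommGroup V] [Module ℝ V] [FiniteDimensional ℝ V]
    (K : V →ₗ[ℝ] V) (hK : ∀ v, K (K (K v)) = - K v) : LinearMap.trace ℝ V K = 0 := by
  have h : (LinearMap.toMatrix (Module.finBasis ℝ V) (Module.finBasis ℝ V) K) ^ 3 =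
      - LinearMap.toMatrix (Module.finBasis ℝ V) (Module.finBasis ℝ V) K := by
    rw [← map_neg, show -K = K * K * K from LinearMap.ext fun v ↦ (hK v).symm,
      LinearMap.toMatrix_mul, LinearMap.toMatrix_mul, pow_succ, pow_two]
  rw [LinearMap.trace_eq_matrix_trace ℝ (Module.finBasis ℝ V)]
  generalize LinearMap.toMatrix (Module.finBasis ℝ V) (Module.finBasis ℝ V) K = A at h
  have hB : (A.map (algebraMap ℝ ℂ)) ^ 3 = - A.map (algebraMap ℝ ℂ) := by
    rw [← Matrix.map_pow, h]
    ext i j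
    simp
  have htr : ((A.trace : ℝ) : ℂ) = (A.map (algebraMap ℝ ℂ)).trace := by
    simp [Matrix.trace]
  have hroot : ∀ z ∈ (A.map (algebraMap ℝ ℂ)).charpoly.roots, z.re = 0 := by
    intro z hz
    have h1 := Polynomial.isRoot_of_mem_roots hz
    rw [← Matrix.charpoly_toLin', ← Module.End.hasEigenvalue_iff_isRoot_charpoly] at h1
    obtain ⟨v, hv⟩ := h1.exists_hasEigenvector
    have h2 := (hv.pow_apply 3).symm
    rw [← Matrix.toLin'_pow, hB, map_neg, LinearMap.neg_apply, hv.apply_eq_smul, ← neg_smul] at h2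
    have h3 := smul_left_injective ℂ hv.2 h2
    have h4 : z * (z ^ 2 + 1) = 0 := by
      linear_combination h3
    rcases mul_eq_zero.1 h4 with h5 | h5
    · simp [h5]
    · have h6 : (z - Complex.I) * (z + Complex.I) = 0 := by
        linear_combination h5 - Complex.I_sq
      rcases mul_eq_zero.1 h6 with h7 | h7
      · simp [sub_eq_zero.1 h7]
      · simp [eq_neg_of_add_eq_zero_left h7]
  rw [Matrix.trace_eq_sum_roots_charpoly (A := A.map (algebraMap ℝ ℂ))] at htr
  have h8 : ∀ s : Multiset ℂ, (∀ z ∈ s, z.re = 0) → s.sum.re = 0 := by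
    intro s
    induction s using Multiset.induction_on with
    | empty => simp
    | cons a s ih =>
      intro hs
      rw [Multiset.sum_cons, Complex.add_re, hs a (by simp), ih fun z hz ↦ hs z (by simp [hz]),
        add_zero]
  have := h8 _ hroot
  rwa [← htr, Complex.ofReal_re] at this

section Manifolds

variable {E : Type*} [NormedAddCommGroup E] [NormedSpace ℝ E]
  {Mb : Type*} [TopologicalSpace Mb] [ChartedSpace E Mb] [IsManifold 𝓘(ℝ, E) ∞ Mb]
  {F : Type*} [NormedAddCommGroup F] [NormedSpace ℝ F]
  {M : Type*} [TopologicalSpace M] [ChartedSpace F M] [IsManifold 𝓘(ℝ, F) ∞ M]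

/-- The differential of an immersion is injective. -/
theorem df_injective {f : M → Mb} (hf : IsImmersion 𝓘(ℝ, F) 𝓘(ℝ, E) ∞ f) (p : M) :
    Function.Injective (df E F f p) := by
  have h := hf.isImmersionAt p
  have : IsManifold 𝓘(ℝ, F) 1 M := IsManifold.of_le (n := ∞) (by simp)
  have : IsManifold 𝓘(ℝ, E) 1 Mb := IsManifold.of_le (n := ∞) (by simp)
  have hd : MDifferentiableAt 𝓘(ℝ, F) 𝓘(ℝ, F) h.domChart p :=
    (contMDiffAt_of_mem_maximalAtlas h.domChart_mem_maximalAtlas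
      h.mem_domChart_source).mdifferentiableAt (by simp)
  have hds : MDifferentiableAt 𝓘(ℝ, F) 𝓘(ℝ, F) h.domChart.symm (h.domChart p) :=
    (contMDiffAt_symm_of_mem_maximalAtlas h.domChart_mem_maximalAtlas
      (h.domChart.map_source h.mem_domChart_source)).mdifferentiableAt (by simp)
  have hc : MDifferentiableAt 𝓘(ℝ, E) 𝓘(ℝ, E) h.codChart (f p) :=
    (contMDiffAt_of_mem_maximalAtlas h.codChart_mem_maximalAtlas
      h.mem_codChart_source).mdifferentiableAt (by simp)
  have hfp : MDifferentiableAt 𝓘(ℝ, F) 𝓘(ℝ, E) f p := (hf.contMDiff p).mdifferentiableAt (by simp)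
  let L : F →L[ℝ] E := (h.equiv : (F × h.complement) →L[ℝ] E).comp
    (ContinuousLinearMap.inl ℝ F h.complement)
  have hL : Function.Injective L := h.equiv.injective.comp LinearMap.inl_injective
  have e : (fun q ↦ L (h.domChart q)) =ᶠ[𝓝 p] fun q ↦ h.codChart (f q) := by
    filter_upwards [h.domChart.open_source.mem_nhds h.mem_domChart_source] with q hq
    have := h.writtenInCharts (show h.domChart q ∈ (h.domChart.extend 𝓘(ℝ, F)).target by
      simpa using h.domChart.map_source hq)
    simp only [OpenPartialHomeomorph.extend_coe, OpenPartialHomeomorph.extend_coe_symm,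
      Function.comp_apply, modelWithCornersSelf_coe, modelWithCornersSelf_coe_symm, id,
      h.domChart.left_inv hq] at this
    exact this.symm
  rw [injective_iff_map_eq_zero]
  intro v hv
  have h1 := mvfderiv_congr e v
  rw [mvfderiv_clm_comp L hd, mvfderiv_comp_map hc hfp] at h1
  rw [show mfderiv 𝓘(ℝ, F) 𝓘(ℝ, E) f p v = 0 from hv, map_zero] at h1
  have h2 : mvfderiv 𝓘(ℝ, F) h.domChart p v = 0 := hL (by rw [h1, map_zero])
  -- the derivative of the chart is injective since it has a left inverse
  have h3 : (fun q ↦ h.domChart.symm (h.domChart q)) =ᶠ[𝓝 p] id := by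
    filter_upwards [h.domChart.open_source.mem_nhds h.mem_domChart_source] with q hq
      using h.domChart.left_inv hq
  have h4 := h3.mfderiv_eq (I := 𝓘(ℝ, F)) (I' := 𝓘(ℝ, F))
  have h5 := mfderiv_comp p hds hd
  have h6 : mfderiv 𝓘(ℝ, F) 𝓘(ℝ, F) (fun q ↦ h.domChart.symm (h.domChart q)) p v = 0 := by
    refine (congrArg (fun L : F →L[ℝ] F ↦ L v) h5).trans ?_
    exact (congrArg (mfderiv 𝓘(ℝ, F) 𝓘(ℝ, F) h.domChart.symm (h.domChart p)) h2).trans (map_zero _)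
  have h7 := (congrArg (fun L : F →L[ℝ] F ↦ L v) (h4.trans mfderiv_id)).symm.trans h6
  exact h7

/-- A tangent vector extends to a smooth vector field on the whole manifold. -/
theorem exists_isSmoothOn_univ_eq [FiniteDimensional ℝ F] [T2Space M] (p : M)
    (v : TangentSpace 𝓘(ℝ, F) p) : ∃ X : VField F M, IsSmoothOn X Set.univ ∧ X p = v := by
  obtain ⟨χ⟩ : Nonempty (SmoothBumpFunction 𝓘(ℝ, F) p) := inferInstance
  refine ⟨fun q ↦ χ q • (FiberBundle.extend F v : VField F M) q, ?_, ?_⟩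
  · have h := ContMDiffOn.smul_section_of_tsupport (I := 𝓘(ℝ, F)) (F := F)
      (V := (TangentSpace 𝓘(ℝ, F) : M → Type _)) (ψ := χ) (n := ∞)
      (s := (FiberBundle.extend F v : VField F M)) χ.contMDiff.contMDiffOn
      (chartAt F p).open_source χ.tsupport_subset_chartAt_source (isSmoothOn_extend p v)
    exact h.contMDiffOn
  · simp

end Manifolds

/-! ### The decomposition of the tangent spaces at a point of the hypersurface -/

section Frame

variable {E : Type*} [NormedAddCommGroup E] [NormedSpace ℝ E] [FiniteDimensional ℝ E]
  {Mb : Type*} [TopologicalSpace Mb] [ChartedSpace E Mb] [IsManifold 𝓘(ℝ, E) ∞ Mb]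
  {F : Type*} [NormedAddCommGroup F] [NormedSpace ℝ F] [FiniteDimensional ℝ F]
  {M : Type*} [TopologicalSpace M] [ChartedSpace F M] [IsManifold 𝓘(ℝ, F) ∞ M]
  {g : SemiRiemannianMetric E Mb} {f : M → Mb} {S : ScreenDistribution F g f}
  {p : M} {ξ : TangentSpace 𝓘(ℝ, F) p} {N : TangentSpace 𝓘(ℝ, E) (f p)} {b : ℝ}

/-- At the point `p` of the hypersurface `f`, the vector `ξ` of the radical and the transversal
vector `N` form a null pair. -/
structure IsNullFrame (S : ScreenDistribution F g f) (p : M) (ξ : TangentSpace 𝓘(ℝ, F) p)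
    (N : TangentSpace 𝓘(ℝ, E) (f p)) : Prop where
  inj : Function.Injective (df E F f p)
  finrank : Module.finrank ℝ F + 1 = Module.finrank ℝ E
  mem_radical : ξ ∈ radicalSpace F g f p
  null : S.IsNullTransversal p ξ N

namespace IsNullFrame

theorem val_radical {ξ : TangentSpace 𝓘(ℝ, F) p} (h : ξ ∈ radicalSpace F g f p)
    (u : TangentSpace 𝓘(ℝ, F) p) : g.val (f p) (df E F f p ξ) (df E F f p u) = 0 := h u

variable (h : IsNullFrame S p ξ N)
include h

theorem val_xi (u : TangentSpace 𝓘(ℝ, F) p) :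
    g.val (f p) (df E F f p u) (df E F f p ξ) = 0 := by
  rw [g.symm]; exact h.mem_radical u

theorem val_N_xi : g.val (f p) N (df E F f p ξ) = 1 := h.null.1

theorem val_xi_N : g.val (f p) (df E F f p ξ) N = 1 := by rw [g.symm, h.val_N_xi]

theorem val_N_N : g.val (f p) N N = 0 := h.null.2.1

theorem val_screen_N {w : TangentSpace 𝓘(ℝ, F) p} (hw : w ∈ S.space p) :
    g.val (f p) (df E F f p w) N = 0 := by
  rw [g.symm]; exact h.null.2.2 w hw

/-- Each ambient vector is the sum of a tangent vector and a multiple of `N`. -/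
theorem exists_eq (w : TangentSpace 𝓘(ℝ, E) (f p)) : ∃ u : TangentSpace 𝓘(ℝ, F) p,
    w = df E F f p u + g.val (f p) w (df E F f p ξ) • N := by
  let T : (F × ℝ) →ₗ[ℝ] E := LinearMap.coprod
    (df E F f p : TangentSpace 𝓘(ℝ, F) p →ₗ[ℝ] TangentSpace 𝓘(ℝ, E) (f p))
    (LinearMap.toSpanSingleton ℝ (TangentSpace 𝓘(ℝ, E) (f p)) N)
  have hT : ∀ (u : TangentSpace 𝓘(ℝ, F) p) (c : ℝ), T (u, c) = df E F f p u + c • N :=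
    fun _ _ ↦ rfl
  have hinj : Function.Injective T := by
    rw [injective_iff_map_eq_zero]
    rintro ⟨(u : TangentSpace 𝓘(ℝ, F) p), c⟩ huc
    have h1 : df E F f p u + c • N = 0 := huc
    have h2 := congrArg (fun w ↦ g.val (f p) w (df E F f p ξ)) h1
    simp only [map_add, add_apply, h.val_xi, map_smul, smul_apply, h.val_N_xi, map_zero,
      zero_apply, smul_eq_mul, mul_one, zero_add] at h2
    subst h2
    rw [zero_smul, add_zero] at h1
    have h3 : u = 0 := h.inj (by rw [h1, map_zero])
    subst h3
    rfl
  have hsurj := (LinearMap.injective_iff_surjective_of_finrank_eq_finrank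
    (by rw [Module.finrank_prod, Module.finrank_self, h.finrank])).1 hinj
  obtain ⟨⟨(u : TangentSpace 𝓘(ℝ, F) p), c⟩, huc⟩ := hsurj w
  have h1 : df E F f p u + c • N = w := huc
  refine ⟨u, ?_⟩
  have h2 := congrArg (fun w ↦ g.val (f p) w (df E F f p ξ)) h1
  simp only [map_add, add_apply, h.val_xi, map_smul, smul_apply, h.val_N_xi,
    smul_eq_mul, mul_one, zero_add] at h2
  rw [← h2, h1]

/-- A vector that is orthogonal to the hypersurface and to `N` vanishes. -/
theorem eq_zero_of_normal {w : TangentSpace 𝓘(ℝ, E) (f p)}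
    (hw : ∀ u : TangentSpace 𝓘(ℝ, F) p, g.val (f p) w (df E F f p u) = 0)
    (hN : g.val (f p) w N = 0) : w = 0 := by
  refine g.nondeg _ w fun v ↦ ?_
  obtain ⟨u, hu⟩ := h.exists_eq v
  rw [hu]
  simp [hw, hN]

/-- The normal space is spanned by `ξ`. -/
theorem eq_smul_of_normal {w : TangentSpace 𝓘(ℝ, E) (f p)}
    (hw : ∀ u : TangentSpace 𝓘(ℝ, F) p, g.val (f p) w (df E F f p u) = 0) :
    w = g.val (f p) w N • df E F f p ξ := by
  rw [← sub_eq_zero]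
  apply h.eq_zero_of_normal
  · intro u
    simp [hw, val_radical h.mem_radical]
  · simp [h.val_xi_N]

theorem eq_smul_of_radical {u : TangentSpace 𝓘(ℝ, F) p} (hu : u ∈ radicalSpace F g f p) :
    u = g.val (f p) (df E F f p u) N • ξ := by
  apply h.inj
  rw [map_smul]
  exact h.eq_smul_of_normal hu

theorem P_mem (u : TangentSpace 𝓘(ℝ, F) p) : S.P p u ∈ S.space p := Submodule.coe_mem _

/-- The decomposition of a tangent vector into its screen and radical parts. -/
theorem df_P (u : TangentSpace 𝓘(ℝ, F) p) :
    u = S.P p u + g.val (f p) (df E F f p u) N • ξ := by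
  have hr : u - S.P p u ∈ radicalSpace F g f p := by
    rw [← Submodule.projectionOnto_apply_eq_zero_iff (S.isCompl p), map_sub, sub_eq_zero]
    exact (Submodule.projectionOnto_apply_left (S.isCompl p) _).symm
  obtain ⟨r, hr', h2⟩ : ∃ r ∈ radicalSpace F g f p, u = S.P p u + r := ⟨_, hr, by abel⟩
  have h3 := h.eq_smul_of_radical hr'
  have h4 : g.val (f p) (df E F f p u) N = g.val (f p) (df E F f p r) N := by
    conv_lhs => rw [h2]
    rw [map_add, map_add, add_apply, h.val_screen_N (h.P_mem u), zero_add]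
  rw [h4, ← h3]
  exact h2

theorem P_eq_self {u : TangentSpace 𝓘(ℝ, F) p} (hu : g.val (f p) (df E F f p u) N = 0) :
    S.P p u = u := by
  have := h.df_P u
  rw [hu, zero_smul, add_zero] at this
  exact this.symm

theorem eq_zero_of_screen {w : TangentSpace 𝓘(ℝ, F) p} (hw : w ∈ S.space p)
    (h0 : ∀ v ∈ S.space p, g.val (f p) (df E F f p w) (df E F f p v) = 0) : w = 0 :=
  S.nondeg p w hw h0

theorem mem_transversal : N ∈ S.transversal p :=
  Submodule.subset_span ⟨ξ, h.mem_radical, h.null⟩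

/-- The null transversal vector is determined up to a factor. -/
theorem eq_smul_of_null {ξ' : TangentSpace 𝓘(ℝ, F) p} {N' : TangentSpace 𝓘(ℝ, E) (f p)}
    (hN : S.IsNullTransversal p ξ' N') :
    N' = g.val (f p) N' (df E F f p ξ) • N := by
  obtain ⟨u, hu⟩ := h.exists_eq N'
  set c := g.val (f p) N' (df E F f p ξ)
  have h1 := h.df_P u
  have h2 : S.P p u = 0 := by
    refine h.eq_zero_of_screen (h.P_mem u) fun v hv ↦ ?_
    have h3 := hN.2.2 v hv
    rw [hu, h1] at h3
    simpa [h.null.2.2 v hv, val_radical h.mem_radical] using h3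
  rw [h2, zero_add] at h1
  have h4 := hN.2.1
  set e := g.val (f p) (df E F f p u) N with he
  rw [hu, h1] at h4
  have h5 : e * c = 0 := by
    simp only [map_add, map_smul, add_apply, smul_apply, h.val_N_N, h.val_N_xi, h.val_xi_N,
      h.val_xi, smul_eq_mul] at h4
    linarith
  have hc0 : c ≠ 0 := by
    intro hc0
    have h6 := hN.1
    rw [hu, hc0, h1] at h6
    simp [val_radical h.mem_radical] at h6
  have he0 : e = 0 := (mul_eq_zero.1 h5).resolve_right hc0
  rw [he0, zero_smul] at h1
  rw [h1, map_zero, zero_add] at hu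
  exact hu

theorem mem_transversal_iff {w : TangentSpace 𝓘(ℝ, E) (f p)} :
    w ∈ S.transversal p ↔ ∃ c : ℝ, w = c • N := by
  constructor
  · intro hw
    have : S.transversal p ≤ Submodule.span ℝ {N} := by
      refine Submodule.span_le.2 ?_
      rintro N' ⟨ξ', -, hN'⟩
      exact Submodule.mem_span_singleton.2 ⟨_, (h.eq_smul_of_null hN').symm⟩
    obtain ⟨c, hc⟩ := Submodule.mem_span_singleton.1 (this hw)
    exact ⟨c, hc.symm⟩
  · rintro ⟨c, rfl⟩
    exact Submodule.smul_mem _ _ h.mem_transversal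

theorem df_tangentialPart (w : TangentSpace 𝓘(ℝ, E) (f p)) :
    df E F f p (tangentialPart S p w) = w - g.val (f p) w (df E F f p ξ) • N := by
  obtain ⟨u, hu⟩ := h.exists_eq w
  have hex : ∃ u : TangentSpace 𝓘(ℝ, F) p, w - df E F f p u ∈ S.transversal p :=
    ⟨u, h.mem_transversal_iff.2 ⟨_, sub_eq_of_eq_add' hu⟩⟩
  rw [tangentialPart, dif_pos hex]
  obtain ⟨c, hc⟩ := h.mem_transversal_iff.1 hex.choose_spec
  have h1 := congrArg (fun w ↦ g.val (f p) w (df E F f p ξ)) hc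
  simp only [map_sub, sub_apply, h.val_xi, map_smul, smul_apply, h.val_N_xi, smul_eq_mul, mul_one,
    sub_zero] at h1
  rw [h1, ← hc]
  abel

theorem transversalCoeff_eq (w : TangentSpace 𝓘(ℝ, E) (f p)) :
    transversalCoeff F f p N w = g.val (f p) w (df E F f p ξ) := by
  obtain ⟨u, hu⟩ := h.exists_eq w
  have hex : ∃ c : ℝ, ∃ u : TangentSpace 𝓘(ℝ, F) p, w = df E F f p u + c • N := ⟨_, u, hu⟩
  rw [transversalCoeff, dif_pos hex]
  obtain ⟨u', hu'⟩ := hex.choose_spec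
  have h1 := congrArg (fun w ↦ g.val (f p) w (df E F f p ξ)) hu'
  simpa only [map_add, add_apply, h.val_xi, map_smul, smul_apply, h.val_N_xi, smul_eq_mul, mul_one,
    zero_add] using h1.symm

theorem xi_ne_zero : ξ ≠ 0 := by
  rintro rfl
  simpa using h.val_N_xi

section J

variable {J : NordenStructure g} (hb : J.J (f p) (df E F f p ξ) = b • N)
include hb

theorem b_ne_zero : b ≠ 0 := by
  rintro rfl
  rw [zero_smul] at hb
  have h1 := J.sq (f p) (df E F f p ξ)
  rw [hb, map_zero] at h1
  exact h.xi_ne_zero (h.inj (by rw [neg_eq_zero.1 h1.symm, map_zero]))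

theorem J_N : J.J (f p) N = -b⁻¹ • df E F f p ξ := by
  have h1 := congrArg (J.J (f p)) hb
  rw [J.sq, map_smul] at h1
  have h2 := h.b_ne_zero hb
  rw [neg_smul, ← smul_neg, h1, smul_smul, inv_mul_cancel₀ h2, one_smul]

theorem val_J_xi (u : TangentSpace 𝓘(ℝ, F) p) :
    g.val (f p) (J.J (f p) (df E F f p u)) (df E F f p ξ) =
      b * g.val (f p) (df E F f p u) N := by
  rw [← J.val_J, hb, map_smul, smul_eq_mul]

/-- The screen space is invariant under `J`. -/
theorem exists_screen_J {w : TangentSpace 𝓘(ℝ, F) p} (hw : w ∈ S.space p) :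
    ∃ w' ∈ S.space p, J.J (f p) (df E F f p w) = df E F f p w' := by
  obtain ⟨u, hu⟩ := h.exists_eq (J.J (f p) (df E F f p w))
  rw [h.val_J_xi hb, h.val_screen_N hw, mul_zero, zero_smul, add_zero] at hu
  have h1 : g.val (f p) (df E F f p u) N = 0 := by
    rw [← hu, ← J.val_J, h.J_N hb, map_smul, h.val_xi, smul_zero]
  exact ⟨u, by rw [← h.P_eq_self h1]; exact h.P_mem u, hu⟩

theorem J_df (u : TangentSpace 𝓘(ℝ, F) p) : J.J (f p) (df E F f p u) =
    J.J (f p) (df E F f p (S.P p u)) + (b * g.val (f p) (df E F f p u) N) • N := by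
  conv_lhs => rw [h.df_P u]
  rw [map_add, map_add, map_smul, map_smul, hb, smul_smul, mul_comm b]

theorem val_J_P_xi (u : TangentSpace 𝓘(ℝ, F) p) :
    g.val (f p) (J.J (f p) (df E F f p (S.P p u))) (df E F f p ξ) = 0 := by
  rw [h.val_J_xi hb, h.val_screen_N (h.P_mem u), mul_zero]

end J

end IsNullFrame

end Frame

/-! ### The equations of Weingarten, Codazzi and Gauss -/

section Umbilic

variable {E : Type*} [NormedAddCommGroup E] [NormedSpace ℝ E] [FiniteDimensional ℝ E]
  {Mb : Type*} [TopologicalSpace Mb] [ChartedSpace E Mb] [IsManifold 𝓘(ℝ, E) ∞ Mb]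
  {F : Type*} [NormedAddCommGroup F] [NormedSpace ℝ F] [FiniteDimensional ℝ F]
  {M : Type*} [TopologicalSpace M] [ChartedSpace F M] [IsManifold 𝓘(ℝ, F) ∞ M]
  {g : SemiRiemannianMetric E Mb} {J : NordenStructure g}
  {cov : CovariantDerivative 𝓘(ℝ, E) E (TangentSpace 𝓘(ℝ, E) : Mb → Type _)}
  {f : M → Mb} {S : ScreenDistribution F g f}
  {O : Set M} {ξ : VField F M} {N : Π p : M, TangentSpace 𝓘(ℝ, E) (f p)} {b ρ : M → ℝ} {p : M}

/-- On the open set `O`, the fields `ξ` and `N = b⁻¹ J ξ` form a null pair, and the hypersurface is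
totally umbilical with factor `ρ`. The last property is stated for the shape of `ξ`, which is a
pointwise condition: `g(∇̄_v Y, ξ) = - g(Y, ∇̄_v ξ)` for tangent fields `Y`. -/
structure IsUmbilicPair (J : NordenStructure g)
    (cov : CovariantDerivative 𝓘(ℝ, E) E (TangentSpace 𝓘(ℝ, E) : Mb → Type _))
    (S : ScreenDistribution F g f) (O : Set M) (ξ : VField F M)
    (N : Π p : M, TangentSpace 𝓘(ℝ, E) (f p)) (b ρ : M → ℝ) : Prop where
  isOpen : IsOpen O
  smooth : IsSmoothOn ξ O
  frame : ∀ q ∈ O, IsNullFrame S q (ξ q) (N q)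
  J_eq : ∀ q ∈ O, J.J (f q) (df E F f q (ξ q)) = b q • N q
  smooth_factor : ContMDiffOn 𝓘(ℝ, F) 𝓘(ℝ, ℝ) ∞ ρ O
  umbilic : ∀ q ∈ O, ∀ u v : TangentSpace 𝓘(ℝ, F) q,
    g.val (f q) (covAlong cov f (fun q ↦ df E F f q (ξ q)) q v) (df E F f q u) =
      - (ρ q * g.val (f q) (df E F f q v) (df E F f q u))

theorem IsUmbilicPair.mono (h : IsUmbilicPair J cov S O ξ N b ρ) {O' : Set M} (hO' : IsOpen O')
    (hs : O' ⊆ O) : IsUmbilicPair J cov S O' ξ N b ρ where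
  isOpen := hO'
  smooth := h.smooth.mono hs
  frame q hq := h.frame q (hs hq)
  J_eq q hq := h.J_eq q (hs hq)
  smooth_factor := h.smooth_factor.mono hs
  umbilic q hq := h.umbilic q (hs hq)

/-- The condition on vector fields in `IsUmbilicFactor` implies the pointwise one, since each pair
of tangent vectors extends to global smooth vector fields. -/
theorem IsUmbilicPair.of_factor [T2Space M] (hf : IsImmersion 𝓘(ℝ, F) 𝓘(ℝ, E) ∞ f)
    (hdim : Module.finrank ℝ F + 1 = Module.finrank ℝ E)
    (hcov : IsLeviCivita g cov) (hp : IsNullPair S O ξ N)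
    (hb : ∀ p ∈ O, J.J (f p) (df E F f p (ξ p)) = b p • N p)
    (hρ : IsUmbilicFactor F cov g f O N ρ) : IsUmbilicPair J cov S O ξ N b ρ where
  isOpen := hp.isOpen
  smooth := hp.smooth
  frame q hq := ⟨df_injective hf q, hdim, hp.mem_radical q hq, hp.transversal q hq⟩
  J_eq := hb
  smooth_factor := hρ.1
  umbilic q hq u v := by
    have hfr : IsNullFrame S q (ξ q) (N q) :=
      ⟨df_injective hf q, hdim, hp.mem_radical q hq, hp.transversal q hq⟩
    obtain ⟨X, hX, rfl⟩ := exists_isSmoothOn_univ_eq q v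
    obtain ⟨Y, hY, rfl⟩ := exists_isSmoothOn_univ_eq q u
    have h1 := hρ.2 X Y (hX.mono (Set.subset_univ _)) (hY.mono (Set.subset_univ _)) q hq
    rw [secondForm, hfr.transversalCoeff_eq, inducedMetric] at h1
    have h2 := mvfderiv_metric_along cov g hf.contMDiff hcov
      (smoothAlongAt_df hf.contMDiff isOpen_univ (Set.mem_univ q) hY)
      (smoothAlongAt_df hf.contMDiff hp.isOpen hq hp.smooth) (X q)
    have h3 : (fun q ↦ g.val (f q) (df E F f q (Y q)) (df E F f q (ξ q))) =ᶠ[𝓝 q] fun _ ↦ 0 := by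
      filter_upwards [hp.isOpen.mem_nhds hq] with q' hq'
      rw [g.symm]
      exact hp.mem_radical q' hq' _
    rw [mvfderiv_congr h3, mvfderiv_const, h1] at h2
    rw [g.symm]
    linarith [show (0 : TangentSpace 𝓘(ℝ, F) q →L[ℝ] ℝ) (X q) = 0 from rfl]

namespace IsUmbilicPair

variable (h : IsUmbilicPair J cov S O ξ N b ρ) (hf : ContMDiff 𝓘(ℝ, F) 𝓘(ℝ, E) ∞ f) (hp : p ∈ O)
include h hf hp

theorem smoothAlongAt_xi : SmoothAlongAt F f (fun q ↦ df E F f q (ξ q)) p :=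
  smoothAlongAt_df hf h.isOpen hp h.smooth

theorem contMDiffAt_factor : ContMDiffAt 𝓘(ℝ, F) 𝓘(ℝ, ℝ) ∞ ρ p :=
  h.smooth_factor.contMDiffAt (h.isOpen.mem_nhds hp)

theorem contMDiffAt_inv_b : ContMDiffAt 𝓘(ℝ, F) 𝓘(ℝ, ℝ) ∞ (fun q ↦ (b q)⁻¹) p := by
  have h1 := ((h.smoothAlongAt_xi hf hp).J J (hf p)).metric g (hf p) (h.smoothAlongAt_xi hf hp)
  have h2 : b =ᶠ[𝓝 p] fun q ↦
      g.val (f q) (J.J (f q) (df E F f q (ξ q))) (df E F f q (ξ q)) := by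
    filter_upwards [h.isOpen.mem_nhds hp] with q hq
    rw [h.J_eq q hq, map_smul, smul_apply, (h.frame q hq).val_N_xi, smul_eq_mul, mul_one]
  exact (h1.congr_of_eventuallyEq h2).inv₀ ((h.frame p hp).b_ne_zero (h.J_eq p hp))

theorem N_eventuallyEq : ∀ᶠ q in 𝓝 p, N q = (b q)⁻¹ • J.J (f q) (df E F f q (ξ q)) := by
  filter_upwards [h.isOpen.mem_nhds hp] with q hq
  rw [h.J_eq q hq, smul_smul, inv_mul_cancel₀ ((h.frame q hq).b_ne_zero (h.J_eq q hq)), one_smul]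

theorem smoothAlongAt_N : SmoothAlongAt F f N p :=
  (((h.smoothAlongAt_xi hf hp).J J (hf p)).smul (hf p) (h.contMDiffAt_inv_b hf hp)).congr
    (h.N_eventuallyEq hf hp)

theorem val_cov_N (v : TangentSpace 𝓘(ℝ, F) p) :
    g.val (f p) (covAlong cov f N p v) (df E F f p (ξ p)) = tauForm cov f N p v := by
  rw [tauForm, (h.frame p hp).transversalCoeff_eq]

theorem val_cov_xi (hcov : IsLeviCivita g cov) (v : TangentSpace 𝓘(ℝ, F) p) :
    g.val (f p) (covAlong cov f (fun q ↦ df E F f q (ξ q)) p v) (N p) = - tauForm cov f N p v := by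
  have h1 := mvfderiv_metric_along cov g hf hcov (h.smoothAlongAt_N hf hp)
    (h.smoothAlongAt_xi hf hp) v
  have h2 : (fun q ↦ g.val (f q) (N q) (df E F f q (ξ q))) =ᶠ[𝓝 p] fun _ ↦ 1 := by
    filter_upwards [h.isOpen.mem_nhds hp] with q hq using (h.frame q hq).val_N_xi
  rw [mvfderiv_congr h2, mvfderiv_const, h.val_cov_N hf hp, g.symm _ (N p)] at h1
  linarith [show (0 : TangentSpace 𝓘(ℝ, F) p →L[ℝ] ℝ) v = 0 from rfl]

/-- The derivative of the radical field: its part tangent to the screen is `-ρ` times the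
identity. -/
theorem cov_xi (v : TangentSpace 𝓘(ℝ, F) p) :
    covAlong cov f (fun q ↦ df E F f q (ξ q)) p v = -(ρ p • df E F f p v) +
      (g.val (f p) (covAlong cov f (fun q ↦ df E F f q (ξ q)) p v) (N p) +
        ρ p * g.val (f p) (df E F f p v) (N p)) • df E F f p (ξ p) := by
  have h1 := (h.frame p hp).eq_smul_of_normal
    (w := covAlong cov f (fun q ↦ df E F f q (ξ q)) p v + ρ p • df E F f p v) (by
    intro u
    rw [map_add, add_apply, h.umbilic p hp, map_smul, smul_apply, smul_eq_mul]
    ring)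
  rw [map_add, add_apply, map_smul, smul_apply, smul_eq_mul] at h1
  rw [← h1]
  abel

/-- The Weingarten formula: `A_N` is `(ρ / b) J P`. -/
theorem cov_N (hJ : IsParallel J cov) (v : TangentSpace 𝓘(ℝ, F) p) :
    covAlong cov f N p v = -((ρ p / b p) • J.J (f p) (df E F f p (S.P p v))) +
      tauForm cov f N p v • N p := by
  have hfr := h.frame p hp
  have hbp := h.J_eq p hp
  have hξ := h.smoothAlongAt_xi hf hp
  obtain ⟨c, hc⟩ : ∃ c : ℝ, covAlong cov f N p v =
      -((ρ p / b p) • J.J (f p) (df E F f p (S.P p v))) + c • N p := by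
    rw [covAlong_congr cov hf (h.N_eventuallyEq hf hp), covAlong_smul cov hf
      (h.contMDiffAt_inv_b hf hp) (hξ.J J (hf p)), covAlong_J cov hf J hJ hξ, h.cov_xi hf hp, hbp,
      map_add, map_neg, map_smul, map_smul, hbp, hfr.J_df hbp v]
    refine ⟨mvfderiv 𝓘(ℝ, F) (fun q ↦ (b q)⁻¹) p v * b p + (b p)⁻¹ *
        (-(ρ p * (b p * g.val (f p) (df E F f p v) (N p))) +
        (g.val (f p) (covAlong cov f (fun q ↦ df E F f q (ξ q)) p v) (N p) +
        ρ p * g.val (f p) (df E F f p v) (N p)) * b p), ?_⟩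
    rw [div_eq_inv_mul]
    module
  have h1 := h.val_cov_N (cov := cov) hf hp v
  rw [hc, map_add, add_apply, map_neg, map_smul, map_smul, neg_apply, smul_apply, smul_apply,
    hfr.val_J_P_xi hbp, hfr.val_N_xi, smul_zero, neg_zero, zero_add, smul_eq_mul, mul_one] at h1
  rw [hc, h1]

/-- The Codazzi equation, in terms of the curvature of the target applied to `ξ`. -/
theorem exists_curvature_xi (hcov : IsLeviCivita g cov) (x y : TangentSpace 𝓘(ℝ, F) p) :
    ∃ μ : ℝ, curvatureAt (fun Y y a ↦ cov Y y a) (f p) (df E F f p x) (df E F f p y)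
        (df E F f p (ξ p)) =
      -((mvfderiv 𝓘(ℝ, F) ρ p x + ρ p * tauForm cov f N p x
          - ρ p ^ 2 * g.val (f p) (df E F f p x) (N p)) • df E F f p y)
      + (mvfderiv 𝓘(ℝ, F) ρ p y + ρ p * tauForm cov f N p y
          - ρ p ^ 2 * g.val (f p) (df E F f p y) (N p)) • df E F f p x
      + μ • df E F f p (ξ p) := by
  have hO := h.isOpen.inter (chartAt F p).open_source
  have hpO : p ∈ O ∩ (chartAt F p).source := ⟨hp, mem_chart_source F p⟩
  have hX := (isSmoothOn_extend p x).mono (Set.inter_subset_right (s := O))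
  have hY := (isSmoothOn_extend p y).mono (Set.inter_subset_right (s := O))
  have hXp : (FiberBundle.extend F x : VField F M) p = x := by simp
  have hYp : (FiberBundle.extend F y : VField F M) p = y := by simp
  set X : VField F M := FiberBundle.extend F x
  set Y : VField F M := FiberBundle.extend F y
  have hV : ∀ q ∈ O ∩ (chartAt F p).source, SmoothAlongAt F f (fun q ↦ df E F f q (ξ q)) q :=
    fun q hq ↦ h.smoothAlongAt_xi hf hq.1
  have key : ∀ Y : VField F M, IsSmoothOn Y (O ∩ (chartAt F p).source) →
      ∀ v : TangentSpace 𝓘(ℝ, F) p, ∃ c : ℝ,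
      covAlong cov f (fun q ↦ covAlong cov f (fun q ↦ df E F f q (ξ q)) q (Y q)) p v =
      -(mvfderiv 𝓘(ℝ, F) ρ p v • df E F f p (Y p)) -
        ρ p • covAlong cov f (fun q ↦ df E F f q (Y q)) p v
        - (ρ p * (-tauForm cov f N p (Y p) + ρ p * g.val (f p) (df E F f p (Y p)) (N p))) •
          df E F f p v + c • df E F f p (ξ p) := by
    intro Y hY v
    have hdY := smoothAlongAt_df hf hO hpO hY
    have hNp := h.smoothAlongAt_N hf hp
    have hξ := h.smoothAlongAt_xi hf hp
    have hcY := SmoothAlongAt.covAlong cov hf hcov hO hpO hY hV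
    have hρ := h.contMDiffAt_factor hf hp
    have hσ : ContMDiffAt 𝓘(ℝ, F) 𝓘(ℝ, ℝ) ∞ (fun q ↦
        g.val (f q) (covAlong cov f (fun q ↦ df E F f q (ξ q)) q (Y q)) (N q) +
          ρ q * g.val (f q) (df E F f q (Y q)) (N q)) p :=
      (hcY.metric g (hf p) hNp).add (hρ.mul (hdY.metric g (hf p) hNp))
    have e : ∀ᶠ q in 𝓝 p, covAlong cov f (fun q ↦ df E F f q (ξ q)) q (Y q) =
        (-ρ q) • df E F f q (Y q) +
        (g.val (f q) (covAlong cov f (fun q ↦ df E F f q (ξ q)) q (Y q)) (N q) +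
          ρ q * g.val (f q) (df E F f q (Y q)) (N q)) • df E F f q (ξ q) := by
      filter_upwards [hO.mem_nhds hpO] with q hq
      rw [neg_smul]
      exact h.cov_xi hf hq.1 _
    rw [covAlong_congr cov hf e, covAlong_add cov hf (hdY.smul (hf p) hρ.neg)
      (hξ.smul (hf p) hσ), covAlong_smul cov hf hρ.neg hdY, covAlong_smul cov hf hσ hξ,
      h.cov_xi hf hp v, h.val_cov_xi hf hp hcov (Y p)]
    have e2 : mvfderiv 𝓘(ℝ, F) (fun q ↦ -ρ q) p v = - mvfderiv 𝓘(ℝ, F) ρ p v :=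
      mvfderiv_clm_comp (-ContinuousLinearMap.id ℝ ℝ) (hρ.mdifferentiableAt (by simp)) v
    rw [e2]
    generalize mvfderiv 𝓘(ℝ, F) (fun q ↦
        g.val (f q) (covAlong cov f (fun q ↦ df E F f q (ξ q)) q (Y q)) (N q) +
          ρ q * g.val (f q) (df E F f q (Y q)) (N q)) p v = d
    refine ⟨d + (-tauForm cov f N p (Y p) + ρ p * g.val (f p) (df E F f p (Y p)) (N p)) *
      (g.val (f p) (covAlong cov f (fun q ↦ df E F f q (ξ q)) p v) (N p) +
        ρ p * g.val (f p) (df E F f p v) (N p)), ?_⟩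
    module
  have hR := covAlong_curvature cov hf hcov hO hpO hX hY hV
  have hT := covAlong_df_sub_covAlong_df cov hf hcov hO hpO hX hY
  obtain ⟨c₁, h1⟩ := key Y hY (X p)
  obtain ⟨c₂, h2⟩ := key X hX (Y p)
  rw [h1, h2, h.cov_xi hf hp (VectorField.mlieBracket 𝓘(ℝ, F) X Y p), ← hT, hXp, hYp] at hR
  refine ⟨c₁ - c₂ - (g.val (f p) (covAlong cov f (fun q ↦ df E F f q (ξ q)) p
    (VectorField.mlieBracket 𝓘(ℝ, F) X Y p)) (N p) +
    ρ p * g.val (f p) (covAlong cov f (fun q ↦ df E F f q (Y q)) p x -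
      covAlong cov f (fun q ↦ df E F f q (X q)) p y) (N p)), ?_⟩
  rw [← hR]
  module

/-- The Gauss equation: the curvature of the induced connection. -/
theorem df_curvature (hcov : IsLeviCivita g cov) (hJ : IsParallel J cov) {X Y Z : VField F M}
    (hX : IsSmoothOn X O) (hY : IsSmoothOn Y O) (hZ : IsSmoothOn Z O) :
    df E F f p (curvature (inducedConnection cov S) X Y Z p) =
      df E F f p (tangentialPart S p (curvatureAt (fun Y y a ↦ cov Y y a) (f p)
        (df E F f p (X p)) (df E F f p (Y p)) (df E F f p (Z p)))) +
      (ρ p ^ 2 / b p) • (g.val (f p) (df E F f p (Y p)) (df E F f p (Z p)) •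
          J.J (f p) (df E F f p (S.P p (X p))) -
        g.val (f p) (df E F f p (X p)) (df E F f p (Z p)) •
          J.J (f p) (df E F f p (S.P p (Y p)))) := by
  have hO := h.isOpen
  have hdZ : ∀ q ∈ O, SmoothAlongAt F f (fun q ↦ df E F f q (Z q)) q :=
    fun q hq ↦ smoothAlongAt_df hf hO hq hZ
  have hξ := h.smoothAlongAt_xi hf hp
  have hNp := h.smoothAlongAt_N hf hp
  have hρ := h.contMDiffAt_factor hf hp
  have hfr := h.frame p hp
  have hbp := h.J_eq p hp
  -- the second fundamental form is `ρ g`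
  have hB : ∀ q ∈ O, ∀ v : TangentSpace 𝓘(ℝ, F) q,
      g.val (f q) (covAlong cov f (fun q ↦ df E F f q (Z q)) q v) (df E F f q (ξ q)) =
        ρ q * g.val (f q) (df E F f q v) (df E F f q (Z q)) := by
    intro q hq v
    have h2 := mvfderiv_metric_along cov g hf hcov (hdZ q hq) (h.smoothAlongAt_xi hf hq) v
    have h3 : (fun q ↦ g.val (f q) (df E F f q (Z q)) (df E F f q (ξ q))) =ᶠ[𝓝 q] fun _ ↦ 0 := by
      filter_upwards [hO.mem_nhds hq] with q' hq' using (h.frame q' hq').val_xi _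
    rw [mvfderiv_congr h3, mvfderiv_const, g.symm _ (df E F f q (Z q)), h.umbilic q hq] at h2
    linarith [show (0 : TangentSpace 𝓘(ℝ, F) q →L[ℝ] ℝ) v = 0 from rfl]
  have key : ∀ Y : VField F M, IsSmoothOn Y O → ∀ v : TangentSpace 𝓘(ℝ, F) p,
      df E F f p (inducedConnection cov S (fun q ↦ inducedConnection cov S Z q (Y q)) p v) =
      df E F f p (tangentialPart S p
        (covAlong cov f (fun q ↦ covAlong cov f (fun q ↦ df E F f q (Z q)) q (Y q)) p v)) +
      (ρ p ^ 2 / b p * g.val (f p) (df E F f p (Y p)) (df E F f p (Z p))) •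
        J.J (f p) (df E F f p (S.P p v)) := by
    intro Y hY v
    have hdY := smoothAlongAt_df hf hO hp hY
    have hcY := SmoothAlongAt.covAlong cov hf hcov hO hp hY hdZ
    have hβ : ContMDiffAt 𝓘(ℝ, F) 𝓘(ℝ, ℝ) ∞ (fun q ↦
        -(ρ q * g.val (f q) (df E F f q (Y q)) (df E F f q (Z q)))) p :=
      (hρ.mul (hdY.metric g (hf p) (hdZ p hp))).neg
    have e : ∀ᶠ q in 𝓝 p, df E F f q (inducedConnection cov S Z q (Y q)) =
        covAlong cov f (fun q ↦ df E F f q (Z q)) q (Y q) +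
        (-(ρ q * g.val (f q) (df E F f q (Y q)) (df E F f q (Z q)))) • N q := by
      filter_upwards [hO.mem_nhds hp] with q hq
      rw [inducedConnection, (h.frame q hq).df_tangentialPart, hB q hq, neg_smul, sub_eq_add_neg]
    rw [inducedConnection, covAlong_congr cov hf e, covAlong_add cov hf hcY (hNp.smul (hf p) hβ),
      covAlong_smul cov hf hβ hNp, h.cov_N hf hp hJ, hfr.df_tangentialPart,
      hfr.df_tangentialPart]
    simp only [map_add, map_neg, map_smul, add_apply, neg_apply, smul_apply, hfr.val_N_xi,
      hfr.val_J_P_xi hbp, smul_eq_mul, mul_zero, neg_zero, zero_add, mul_one]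
    rw [show ρ p ^ 2 / b p = ρ p * (ρ p / b p) by ring]
    module
  have hR := covAlong_curvature cov hf hcov hO hp hX hY hdZ
  rw [← hR]
  rw [curvature, map_sub, map_sub, key Y hY, key X hX, inducedConnection]
  simp only [hfr.df_tangentialPart, map_sub, sub_apply]
  module

end IsUmbilicPair

end Umbilic

/-! ### Consequences for constant totally real sectional curvatures -/

/-- The trace of a map that agrees with a linear map; the choice in the definition of `traceOf` does
not matter. -/
theorem traceOf_eq {V : Type*} [AddCommGroup V] [Module ℝ V] {φ : V → V} (L : V →ₗ[ℝ] V)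
    (h : ∀ v, φ v = L v) : traceOf φ = LinearMap.trace ℝ V L := by
  have hex : ∃ L : V →ₗ[ℝ] V, ∀ v, L v = φ v := ⟨L, fun v ↦ (h v).symm⟩
  rw [traceOf, dif_pos hex]
  congr 1
  ext v
  rw [hex.choose_spec, h]

section Umbilic

variable {E : Type*} [NormedAddCommGroup E] [NormedSpace ℝ E] [FiniteDimensional ℝ E]
  {Mb : Type*} [TopologicalSpace Mb] [ChartedSpace E Mb] [IsManifold 𝓘(ℝ, E) ∞ Mb]
  {F : Type*} [NormedAddCommGroup F] [NormedSpace ℝ F] [FiniteDimensional ℝ F]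
  {M : Type*} [TopologicalSpace M] [ChartedSpace F M] [IsManifold 𝓘(ℝ, F) ∞ M]
  {g : SemiRiemannianMetric E Mb} {J : NordenStructure g}
  {cov : CovariantDerivative 𝓘(ℝ, E) E (TangentSpace 𝓘(ℝ, E) : Mb → Type _)}
  {f : M → Mb} {S : ScreenDistribution F g f}
  {O : Set M} {ξ : VField F M} {N : Π p : M, TangentSpace 𝓘(ℝ, E) (f p)} {b ρ : M → ℝ} {p : M}
  {ν ν' : Mb → ℝ}

theorem IsNullFrame.exists_screen_val_ne_zero {ξ : TangentSpace 𝓘(ℝ, F) p}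
    {N : TangentSpace 𝓘(ℝ, E) (f p)} (h : IsNullFrame S p ξ N) (hF : 1 < Module.finrank ℝ F) :
    ∃ y ∈ S.space p, g.val (f p) (df E F f p y) (df E F f p y) ≠ 0 := by
  by_contra! h0
  have h1 : ∀ u ∈ S.space p, u = 0 := fun u hu ↦ by
    refine h.eq_zero_of_screen hu fun v hv ↦ ?_
    have h2 := h0 (u + v) (Submodule.add_mem _ hu hv)
    simp only [map_add, add_apply, h0 u hu, h0 v hv] at h2
    rw [g.symm _ (df E F f p v)] at h2
    linarith
  have h3 : Module.finrank ℝ (TangentSpace 𝓘(ℝ, F) p) ≤ 1 := finrank_le_one ξ fun u ↦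
    ⟨_, by conv_rhs => rw [h.df_P u, h1 _ (h.P_mem u), zero_add]⟩
  exact absurd h3 (not_le.2 hF)

/-- The formula for the curvature tensor of the target at the points of the hypersurface. The
vector `ξ` and a non-isotropic vector of the screen space span a nondegenerate complex plane. -/
theorem IsNullFrame.curvatureFour_eq {ξ : TangentSpace 𝓘(ℝ, F) p}
    {N : TangentSpace 𝓘(ℝ, E) (f p)} {b : ℝ} (h : IsNullFrame S p ξ N)
    (hF : 1 < Module.finrank ℝ F) (hb : J.J (f p) (df E F f p ξ) = b • N)
    (hcov : IsLeviCivita g cov)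
    (hJ : IsParallel J cov) (hν : HasConstantTotallyRealCurvatures g J cov ν ν')
    (u v w z : TangentSpace 𝓘(ℝ, E) (f p)) :
    curvatureFour g cov (f p) u v w z =
      ν (f p) * (g.val (f p) v w * g.val (f p) u z
          - g.val (f p) (J.J (f p) v) w * g.val (f p) (J.J (f p) u) z
        - (g.val (f p) u w * g.val (f p) v z
          - g.val (f p) (J.J (f p) u) w * g.val (f p) (J.J (f p) v) z))
      - ν' (f p) * (g.val (f p) v w * g.val (f p) (J.J (f p) u) z
          + g.val (f p) (J.J (f p) v) w * g.val (f p) u z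
        - (g.val (f p) u w * g.val (f p) (J.J (f p) v) z
          + g.val (f p) (J.J (f p) u) w * g.val (f p) v z)) := by
  obtain ⟨y, hy, hyy⟩ := h.exists_screen_val_ne_zero hF
  refine KNorden.curvatureFour_eq J hcov hJ hν (x₀ := df E F f p ξ) (y₀ := df E F f p y) ?_ ?_ ?_
    u v w z
  · intro h0
    have := congrArg Complex.im h0
    simp [complexMetric, hb, h.val_N_xi, h.b_ne_zero hb] at this
  · intro h0
    have := congrArg Complex.re h0
    simp [complexMetric, hyy] at this
  · rw [complexMetric, hb, IsNullFrame.val_radical h.mem_radical, map_smul, smul_apply,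
      h.null.2.2 y hy]
    simp

namespace IsUmbilicPair

variable (h : IsUmbilicPair J cov S O ξ N b ρ) (hf : ContMDiff 𝓘(ℝ, F) 𝓘(ℝ, E) ∞ f) (hp : p ∈ O)
  (hF : 1 < Module.finrank ℝ F) (hcov : IsLeviCivita g cov) (hJ : IsParallel J cov)
  (hν : HasConstantTotallyRealCurvatures g J cov ν ν')
include h hf hp hF hcov hJ hν

/-- The Codazzi equation for `ξ` and a vector of the screen space. -/
theorem codazzi_xi : ν (f p) = 0 ∧ b p * ν' (f p) - ρ p ^ 2 + mvfderiv 𝓘(ℝ, F) ρ p (ξ p)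
    + ρ p * tauForm cov f N p (ξ p) = 0 := by
  have hfr := h.frame p hp
  have hbp := h.J_eq p hp
  obtain ⟨y, hy, hyy⟩ := hfr.exists_screen_val_ne_zero hF
  obtain ⟨y', hy', hJy⟩ := hfr.exists_screen_J hbp hy
  obtain ⟨μ, hμ⟩ := h.exists_curvature_xi hf hp hcov (ξ p) y
  have key : ∀ w ∈ S.space p,
      (b p * ν' (f p) - ρ p ^ 2 + mvfderiv 𝓘(ℝ, F) ρ p (ξ p) + ρ p * tauForm cov f N p (ξ p)) *
        g.val (f p) (df E F f p y) (df E F f p w) +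
      b p * ν (f p) * g.val (f p) (df E F f p y') (df E F f p w) = 0 := by
    intro w hw
    have h1 := congrArg (fun t ↦ g.val (f p) t (df E F f p w)) hμ
    have h2 := hfr.curvatureFour_eq hF hbp hcov hJ hν (df E F f p (ξ p)) (df E F f p y)
      (df E F f p (ξ p)) (df E F f p w)
    rw [curvatureFour] at h2
    simp only [h2, hbp, hJy, hfr.val_xi, map_add, map_neg, map_smul, add_apply, neg_apply,
      smul_apply, hfr.val_N_xi, hfr.val_xi_N, hfr.null.2.2 w hw, smul_eq_mul,
      IsNullFrame.val_radical hfr.mem_radical w] at h1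
    linear_combination h1
  have e1 := key y hy
  have e2 := key y' hy'
  have e3 : g.val (f p) (df E F f p y') (df E F f p y') =
      - g.val (f p) (df E F f p y) (df E F f p y) := by rw [← hJy, J.anti]
  rw [e3, g.symm _ (df E F f p y)] at e2
  set A := g.val (f p) (df E F f p y) (df E F f p y)
  set B := g.val (f p) (df E F f p y') (df E F f p y)
  have hAB : A ^ 2 + B ^ 2 ≠ 0 := by positivity
  constructor
  · have : b p * ν (f p) * (A ^ 2 + B ^ 2) = 0 := by linear_combination B * e1 - A * e2
    simpa [hAB, hfr.b_ne_zero hbp] using this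
  · exact (mul_eq_zero.1 (show _ * (A ^ 2 + B ^ 2) = 0 by
      linear_combination A * e1 + B * e2)).resolve_right hAB

/-- The Codazzi equation for the vectors `x` and `J x` of the screen space. -/
theorem codazzi_screen {x : TangentSpace 𝓘(ℝ, F) p} (hx : x ∈ S.space p) :
    mvfderiv 𝓘(ℝ, F) ρ p x + ρ p * tauForm cov f N p x = 0 := by
  have hfr := h.frame p hp
  have hbp := h.J_eq p hp
  obtain ⟨x', hx', hJx⟩ := hfr.exists_screen_J hbp hx
  obtain ⟨μ, hμ⟩ := h.exists_curvature_xi hf hp hcov x x'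
  rw [hfr.val_screen_N hx, hfr.val_screen_N hx', mul_zero, sub_zero, sub_zero] at hμ
  set a := mvfderiv 𝓘(ℝ, F) ρ p x + ρ p * tauForm cov f N p x with ha
  set c := mvfderiv 𝓘(ℝ, F) ρ p x' + ρ p * tauForm cov f N p x'
  have hJx' : J.J (f p) (df E F f p x') = - df E F f p x := by rw [← hJx, J.sq]
  have h0 : -(a • x') + c • x = 0 := by
    refine hfr.eq_zero_of_screen (Submodule.add_mem _ (Submodule.neg_mem _
      (Submodule.smul_mem _ _ hx')) (Submodule.smul_mem _ _ hx)) fun w hw ↦ ?_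
    have h1 := congrArg (fun t ↦ g.val (f p) t (df E F f p w)) hμ
    have h2 := hfr.curvatureFour_eq hF hbp hcov hJ hν (df E F f p x) (df E F f p x')
      (df E F f p (ξ p)) (df E F f p w)
    rw [curvatureFour] at h2
    simp only [h2, hJx, hJx', hfr.val_xi, map_add, map_neg, map_smul, add_apply, neg_apply,
      smul_apply, smul_eq_mul, IsNullFrame.val_radical hfr.mem_radical w] at h1 ⊢
    linear_combination -h1
  have h1 : -(a • df E F f p x') + c • df E F f p x = 0 := by
    rw [← map_smul, ← map_smul, ← map_neg, ← map_add, h0, map_zero]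
  have h2 := congrArg (J.J (f p)) h1
  rw [map_add, map_neg, map_smul, map_smul, hJx, hJx', map_zero] at h2
  have h3 : (a ^ 2 + c ^ 2) • df E F f p x = 0 := by
    have h4 : (a ^ 2 + c ^ 2) • df E F f p x = c • (-(a • df E F f p x') + c • df E F f p x) +
        a • (-(a • -df E F f p x) + c • df E F f p x') := by module
    rw [h4, h1, h2, smul_zero, smul_zero, add_zero]
  by_cases hac : a = 0
  · exact hac
  · have hac' : a ^ 2 + c ^ 2 ≠ 0 := by positivity
    -- in the case `x = 0` the claim is the linearity of `dρ` and `τ`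
    have hx0 : x = 0 := hfr.inj (by
      rw [(smul_eq_zero.1 h3).resolve_left hac', map_zero])
    have h4 := h.val_cov_xi (cov := cov) hf hp hcov x
    rw [covAlong_eq cov (hf p).continuousAt, hx0] at h4
    simp only [map_zero, add_zero, zero_apply] at h4
    rw [ha, hx0, map_zero, neg_eq_zero.1 h4.symm, mul_zero, add_zero]

/-- The curvature of the induced connection. -/
theorem df_curvature_eq {X Y Z : VField F M}
    (hX : IsSmoothOn X O) (hY : IsSmoothOn Y O) (hZ : IsSmoothOn Z O) :
    df E F f p (curvature (inducedConnection cov S) X Y Z p) =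
      (ν' (f p) - ρ p ^ 2 / b p) •
        (inducedMetric g f p (X p) (Z p) • J.J (f p) (df E F f p (S.P p (Y p)))
          - inducedMetric g f p (Y p) (Z p) • J.J (f p) (df E F f p (S.P p (X p))))
      + ν' (f p) •
        (g.val (f p) (df E F f p (X p)) (J.J (f p) (df E F f p (Z p))) • df E F f p (Y p)
          - g.val (f p) (df E F f p (Y p)) (J.J (f p) (df E F f p (Z p))) • df E F f p (X p)) := by
  have hfr := h.frame p hp
  have hbp := h.J_eq p hp
  have hν0 := (h.codazzi_xi hf hp hF hcov hJ hν).1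
  rw [h.df_curvature hf hp hcov hJ hX hY hZ]
  generalize X p = x
  generalize Y p = y
  generalize Z p = z
  have hR : curvatureAt (fun Y y a ↦ cov Y y a) (f p) (df E F f p x) (df E F f p y)
        (df E F f p z) = ν' (f p) •
      (g.val (f p) (df E F f p x) (df E F f p z) • J.J (f p) (df E F f p y)
      - g.val (f p) (df E F f p y) (df E F f p z) • J.J (f p) (df E F f p x)
      + g.val (f p) (df E F f p x) (J.J (f p) (df E F f p z)) • df E F f p y
      - g.val (f p) (df E F f p y) (J.J (f p) (df E F f p z)) • df E F f p x) := by
    rw [← sub_eq_zero]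
    refine g.nondeg _ _ fun w ↦ ?_
    have := hfr.curvatureFour_eq hF hbp hcov hJ hν (df E F f p x) (df E F f p y)
      (df E F f p z) w
    rw [curvatureFour, hν0] at this
    simp only [map_sub, sub_apply, this, map_smul, smul_apply, map_add, add_apply, smul_eq_mul,
      J.val_J]
    ring
  rw [hfr.df_tangentialPart, hR, hfr.J_df hbp x, hfr.J_df hbp y]
  simp only [map_sub, map_add, map_smul, sub_apply, add_apply, smul_apply, hfr.val_xi,
    hfr.val_J_P_xi hbp, hfr.val_N_xi, smul_eq_mul, inducedMetric]
  module

/-- The Ricci tensor of the induced connection. -/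
theorem ricciAt_eq (u v : TangentSpace 𝓘(ℝ, F) p) :
    ricciAt (inducedConnection cov S) p u v =
      (1 - (Module.finrank ℝ F : ℝ)) * ν' (f p) * inducedAssoc J f p u v
      + (ν' (f p) - ρ p ^ 2 / b p) * inducedAssoc J f p (S.P p u) (S.P p v) := by
  have hfr := h.frame p hp
  have hbp := h.J_eq p hp
  have : FiniteDimensional ℝ (TangentSpace 𝓘(ℝ, F) p) := inferInstanceAs (FiniteDimensional ℝ F)
  let D : TangentSpace 𝓘(ℝ, F) p →ₗ[ℝ] TangentSpace 𝓘(ℝ, E) (f p) := df E F f p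
  let e := LinearEquiv.ofInjective D hfr.inj
  let P : TangentSpace 𝓘(ℝ, F) p →ₗ[ℝ] TangentSpace 𝓘(ℝ, F) p :=
    (S.space p).subtype ∘ₗ (S.space p).projectionOnto (radicalSpace F g f p) (S.isCompl p)
  have hPJ : ∀ w, (J.J (f p) : TangentSpace 𝓘(ℝ, E) (f p) →ₗ[ℝ] TangentSpace 𝓘(ℝ, E) (f p))
      (D (P w)) ∈ LinearMap.range D := fun w ↦ by
    obtain ⟨w', -, hw'⟩ := hfr.exists_screen_J hbp (hfr.P_mem w)
    exact ⟨w', hw'.symm⟩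
  -- `K` is `J P` as an operator on the tangent space of the hypersurface
  let K : TangentSpace 𝓘(ℝ, F) p →ₗ[ℝ] TangentSpace 𝓘(ℝ, F) p := e.symm.toLinearMap ∘ₗ
    ((J.J (f p) : TangentSpace 𝓘(ℝ, E) (f p) →ₗ[ℝ] TangentSpace 𝓘(ℝ, E) (f p)) ∘ₗ
      D ∘ₗ P).codRestrict (LinearMap.range D) hPJ
  have hK : ∀ w, df E F f p (K w) = J.J (f p) (df E F f p (S.P p w)) := fun w ↦
    congrArg Subtype.val (e.apply_symm_apply ⟨_, hPJ w⟩)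
  have hKP : ∀ w, S.P p (K w) = K w := fun w ↦ by
    obtain ⟨w', hw', hw⟩ := hfr.exists_screen_J hbp (hfr.P_mem w)
    refine hfr.P_eq_self ?_
    rw [hK, hw, hfr.val_screen_N hw']
  have hK3 : ∀ w, K (K (K w)) = - K w := fun w ↦ by
    apply hfr.inj
    rw [hK, hKP, hK, hKP, J.sq, map_neg]
  have htr := trace_eq_zero_of_cube K hK3
  -- the linear forms `g(·, v)` and `g(·, J v)`
  let gv : TangentSpace 𝓘(ℝ, F) p →ₗ[ℝ] ℝ :=
    (g.val (f p) (df E F f p v) : TangentSpace 𝓘(ℝ, E) (f p) →ₗ[ℝ] ℝ) ∘ₗ D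
  let gJ : TangentSpace 𝓘(ℝ, F) p →ₗ[ℝ] ℝ :=
    (g.val (f p) (J.J (f p) (df E F f p v)) : TangentSpace 𝓘(ℝ, E) (f p) →ₗ[ℝ] ℝ) ∘ₗ D
  have hgv : ∀ w, gv w = g.val (f p) (df E F f p w) (df E F f p v) := fun _ ↦ g.symm _ _ _
  have hgJ : ∀ w, gJ w = g.val (f p) (df E F f p w) (J.J (f p) (df E F f p v)) :=
    fun _ ↦ g.symm _ _ _
  let L : TangentSpace 𝓘(ℝ, F) p →ₗ[ℝ] TangentSpace 𝓘(ℝ, F) p :=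
    (ν' (f p) - ρ p ^ 2 / b p) • (gv.smulRight (K u) - gv u • K) +
      ν' (f p) • (gJ.smulRight u - gJ u • LinearMap.id)
  have hO := h.isOpen.inter (chartAt F p).open_source
  have hpO : p ∈ O ∩ (chartAt F p).source := ⟨hp, mem_chart_source F p⟩
  have hs : ∀ x : TangentSpace 𝓘(ℝ, F) p,
      IsSmoothOn (FiberBundle.extend F x : VField F M) (O ∩ (chartAt F p).source) := fun x ↦
    (isSmoothOn_extend p x).mono (Set.inter_subset_right (s := O))
  have hL : ∀ w, curvatureAt (inducedConnection cov S) p w u v = L w := fun w ↦ by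
    apply hfr.inj
    rw [curvatureAt, (h.mono hO Set.inter_subset_left).df_curvature_eq hf hpO hF hcov hJ hν (hs w)
      (hs u) (hs v)]
    simp only [FiberBundle.extend_apply_self, L, LinearMap.add_apply, LinearMap.smul_apply,
      LinearMap.sub_apply, LinearMap.smulRight_apply, LinearMap.id_apply, map_add, map_sub,
      map_smul, hK, hgv, hgJ, inducedMetric]
  rw [ricciAt, traceOf_eq L hL]
  simp only [L, map_add, map_sub, map_smul, LinearMap.trace_smulRight, htr, LinearMap.trace_id,
    hgv, hgJ, hK, smul_eq_mul, inducedAssoc, NordenStructure.assoc]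
  have h1 : g.val (f p) (J.J (f p) (df E F f p (S.P p u))) (df E F f p v) =
      g.val (f p) (J.J (f p) (df E F f p (S.P p u))) (df E F f p (S.P p v)) := by
    conv_lhs => rw [hfr.df_P v]
    rw [map_add, map_add, map_smul, map_smul, hfr.val_J_P_xi hbp, smul_zero, add_zero]
  rw [h1, J.val_J, show Module.finrank ℝ (TangentSpace 𝓘(ℝ, F) p) = Module.finrank ℝ F from rfl]
  ring

end IsUmbilicPair

end Umbilic

/-! ### Existence of local null pairs -/

section LocalPair

variable {E : Type*} [NormedAddCommGroup E] [NormedSpace ℝ E] [FiniteDimensional ℝ E]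
  {Mb : Type*} [TopologicalSpace Mb] [ChartedSpace E Mb] [IsManifold 𝓘(ℝ, E) ∞ Mb]
  {F : Type*} [NormedAddCommGroup F] [NormedSpace ℝ F] [FiniteDimensional ℝ F]
  {M : Type*} [TopologicalSpace M] [ChartedSpace F M] [IsManifold 𝓘(ℝ, F) ∞ M]
  {g : SemiRiemannianMetric E Mb} {J : NordenStructure g}
  {f : M → Mb} {S : ScreenDistribution F g f} {p : M}

theorem contMDiffAt_det {k : ℕ} {A : M → Matrix (Fin k) (Fin k) ℝ}
    (hA : ∀ i j, ContMDiffAt 𝓘(ℝ, F) 𝓘(ℝ, ℝ) ∞ (fun q ↦ A q i j) p) :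
    ContMDiffAt 𝓘(ℝ, F) 𝓘(ℝ, ℝ) ∞ (fun q ↦ (A q).det) p := by
  simp only [Matrix.det_apply']
  exact ContMDiffAt.sum fun σ _ ↦ contMDiffAt_const.mul
    (contMDiffAt_finsetProd fun i _ ↦ hA (σ i) i)

/-- Near each point there is a smooth nowhere zero section of the radical distribution. It is the
part orthogonal to the screen distribution of a smooth vector field, up to the factor by which
Cramer's rule avoids the inverse of the Gram matrix. -/
theorem exists_radical_field (hf : ContMDiff 𝓘(ℝ, F) 𝓘(ℝ, E) ∞ f) (hl : IsLightlike F g f)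
    (S : ScreenDistribution F g f) (p : M) :
    ∃ (O : Set M) (ξ : VField F M), IsOpen O ∧ p ∈ O ∧ IsSmoothOn ξ O ∧
      ∀ q ∈ O, ξ q ∈ radicalSpace F g f q ∧ ξ q ≠ 0 := by
  obtain ⟨r, hr, hr0⟩ := Submodule.exists_mem_ne_zero_of_ne_bot (hl p)
  obtain ⟨U, hU, hpU, k, W, hW, hWS⟩ := S.smooth p
  have hO := hU.inter (chartAt F p).open_source
  have hpO : p ∈ U ∩ (chartAt F p).source := ⟨hpU, mem_chart_source F p⟩
  set O := U ∩ (chartAt F p).source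
  have hWO : ∀ i, IsSmoothOn (W i) O := fun i ↦ (hW i).mono Set.inter_subset_left
  have heO := (isSmoothOn_extend p r).mono (Set.inter_subset_right (s := U))
  have hep : (FiberBundle.extend F r : VField F M) p = r := by simp
  set e : VField F M := FiberBundle.extend F r
  let A : M → Matrix (Fin k) (Fin k) ℝ := fun q ↦ Matrix.of fun i j ↦
    g.val (f q) (df E F f q (W i q)) (df E F f q (W j q))
  let v : M → Fin k → ℝ := fun q i ↦ g.val (f q) (df E F f q (W i q)) (df E F f q (e q))
  let ξ : VField F M := fun q ↦ (A q).det • e q - ∑ i, (A q).cramer (v q) i • W i q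
  have hA : ∀ q ∈ O, ∀ i j, ContMDiffAt 𝓘(ℝ, F) 𝓘(ℝ, ℝ) ∞ (fun q ↦ A q i j) q := fun q hq i j ↦
    (smoothAlongAt_df hf hO hq (hWO i)).metric g (hf q) (smoothAlongAt_df hf hO hq (hWO j))
  have hv : ∀ q ∈ O, ∀ i, ContMDiffAt 𝓘(ℝ, F) 𝓘(ℝ, ℝ) ∞ (fun q ↦ v q i) q := fun q hq i ↦
    (smoothAlongAt_df hf hO hq (hWO i)).metric g (hf q) (smoothAlongAt_df hf hO hq heO)
  have hc : ∀ q ∈ O, ∀ i, ContMDiffAt 𝓘(ℝ, F) 𝓘(ℝ, ℝ) ∞ (fun q ↦ (A q).cramer (v q) i) q := by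
    intro q hq i
    simp only [Matrix.cramer_apply]
    refine contMDiffAt_det fun a c ↦ ?_
    simp only [Matrix.updateCol_apply]
    split_ifs
    exacts [hv q hq a, hA q hq a c]
  have hξ : IsSmoothOn ξ O := by
    intro q hq
    refine ContMDiffAt.contMDiffWithinAt ?_
    have h1 := (contMDiffAt_det (hA q hq)).smul_section (heO.contMDiffAt (hO.mem_nhds hq))
    have h2 := ContMDiffAt.sum_section (s := Finset.univ) fun i _ ↦
      (hc q hq i).smul_section ((hWO i).contMDiffAt (hO.mem_nhds hq))
    exact h1.sub_section h2
  have hrad : ∀ q ∈ O, ξ q ∈ radicalSpace F g f q := by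
    intro q hq
    have h1 : ∀ i, g.val (f q) (df E F f q (W i q)) (df E F f q (ξ q)) = 0 := by
      intro i
      have h2 := congrFun (Matrix.mulVec_cramer (A q) (v q)) i
      simp only [Matrix.mulVec, dotProduct, Pi.smul_apply, smul_eq_mul, A, Matrix.of_apply] at h2
      simp only [ξ, map_sub, map_sum, map_smul, smul_eq_mul]
      rw [sub_eq_zero]
      refine Eq.trans ?_ (h2.symm.trans (Finset.sum_congr rfl fun j _ ↦ mul_comm _ _))
      rfl
    have h2 : ∀ w ∈ S.space q, g.val (f q) (df E F f q w) (df E F f q (ξ q)) = 0 := by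
      intro w hw
      rw [← (hWS q hq.1).2] at hw
      induction hw using Submodule.span_induction with
      | mem x hx => obtain ⟨i, rfl⟩ := hx; exact h1 i
      | zero => simp
      | add x y _ _ hx hy => simp [hx, hy]
      | smul a x _ hx => simp [hx]
    intro u
    obtain ⟨s, hs, t, ht, rfl⟩ := Submodule.mem_sup.1
      ((S.isCompl q).sup_eq_top ▸ Submodule.mem_top (x := u))
    change g.val (f q) (df E F f q (ξ q)) (df E F f q (s + t)) = 0
    rw [g.symm, map_add, map_add, add_apply, h2 s hs, zero_add]
    exact ht _
  have hp0 : ξ p ≠ 0 := by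
    have h1 : v p = 0 := funext fun i ↦ by
      simp only [v, hep]
      rw [g.symm]
      exact hr _
    have h2 : (A p).det ≠ 0 := by
      intro h0
      obtain ⟨c, hc0, hc⟩ := Matrix.exists_mulVec_eq_zero_iff.2 h0
      have h3 : ∑ i, c i • W i p = 0 := by
        refine S.nondeg p _ ?_ fun w hw ↦ ?_
        · rw [← (hWS p hpU).2]
          exact Submodule.sum_mem _ fun i _ ↦
            Submodule.smul_mem _ _ (Submodule.subset_span ⟨i, rfl⟩)
        rw [← (hWS p hpU).2] at hw
        rw [inducedMetric, g.symm]
        induction hw using Submodule.span_induction with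
        | mem x hx =>
          obtain ⟨i, rfl⟩ := hx
          refine Eq.trans ?_ (congrFun hc i)
          simp only [Matrix.mulVec, dotProduct, A, Matrix.of_apply, map_sum, map_smul, smul_eq_mul]
          exact Finset.sum_congr rfl fun j _ ↦ mul_comm _ _
        | zero => simp
        | add x y _ _ hx hy => rw [map_add, map_add, add_apply, hx, hy, add_zero]
        | smul a x _ hx => rw [map_smul, map_smul, smul_apply, hx, smul_zero]
      exact hc0 (funext (Fintype.linearIndependent_iff.1 (hWS p hpU).1 c h3))
    simp only [ξ, h1, map_zero, Pi.zero_apply, zero_smul, Finset.sum_const_zero, sub_zero, hep]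
    exact smul_ne_zero h2 hr0
  have hne : ∀ᶠ q in 𝓝 p, ξ q ≠ 0 := by
    have h1 := ((contMDiffAt_vfield_iff (n := ⊤) (mem_chart_source F p)).1
      (hξ.contMDiffAt (hO.mem_nhds hpO))).continuousAt
    have h2 := h1.eventually_ne (y := 0) (by rw [tcomp_self]; exact hp0)
    filter_upwards [h2] with q hq h0
    exact hq (by rw [h0, map_zero])
  obtain ⟨O', hO', hO'o, hpO'⟩ := eventually_nhds_iff.1 hne
  exact ⟨O ∩ O', ξ, hO.inter hO'o, ⟨hpO, hpO'⟩, hξ.mono Set.inter_subset_left,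
    fun q hq ↦ ⟨hrad q hq.1, hO' q hq.2⟩⟩

/-- A vector of the radical of a radical transversal lightlike hypersurface belongs to a null
pair. -/
theorem exists_isNullTransversal (hrad : IsRadicalTransversal J S)
    (hinj : Function.Injective (df E F f p))
    (hdim : Module.finrank ℝ F + 1 = Module.finrank ℝ E) {ξ : TangentSpace 𝓘(ℝ, F) p}
    (hξ : ξ ∈ radicalSpace F g f p) (h0 : ξ ≠ 0) :
    ∃ (N : TangentSpace 𝓘(ℝ, E) (f p)) (b : ℝ), S.IsNullTransversal p ξ N ∧
      J.J (f p) (df E F f p ξ) = b • N := by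
  have h1 : J.J (f p) (df E F f p ξ) ∈ S.transversal p := by
    rw [← hrad p]
    exact ⟨_, hξ, rfl⟩
  have h2 : J.J (f p) (df E F f p ξ) ≠ 0 := by
    intro h
    have := J.sq (f p) (df E F f p ξ)
    rw [h, map_zero] at this
    exact h0 (hinj (by rw [neg_eq_zero.1 this.symm, map_zero]))
  obtain ⟨N', ξ', hξ', hN'⟩ :
      {N | ∃ ξ ∈ radicalSpace F g f p, S.IsNullTransversal p ξ N}.Nonempty := by
    rw [Set.nonempty_iff_ne_empty]
    intro he
    rw [ScreenDistribution.transversal, he, Submodule.span_empty, Submodule.mem_bot] at h1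
    exact h2 h1
  have hfr : IsNullFrame S p ξ' N' := ⟨hinj, hdim, hξ', hN'⟩
  have h3 := hfr.eq_smul_of_radical hξ
  set a := g.val (f p) (df E F f p ξ) N'
  have ha : a ≠ 0 := by
    intro ha
    rw [ha, zero_smul] at h3
    exact h0 h3
  have hN : S.IsNullTransversal p ξ (a⁻¹ • N') := by
    refine ⟨?_, ?_, fun w hw ↦ ?_⟩
    · rw [h3]
      simp [hN'.1, ha]
    · simp [hN'.2.1]
    · simp [hN'.2.2 w hw]
  have hfr' : IsNullFrame S p ξ (a⁻¹ • N') := ⟨hinj, hdim, hξ, hN⟩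
  obtain ⟨b, hb⟩ := hfr'.mem_transversal_iff.1 h1
  exact ⟨_, b, hN, hb⟩

end LocalPair

end KNorden

end

theorem theorem3p2
    (n : ℕ) (hn : 2 ≤ n)
    -- the ambient manifold, of dimension `2 n`
    {E : Type*} [NormedAddCommGroup E] [NormedSpace ℝ E] [FiniteDimensional ℝ E]
    (hE : Module.finrank ℝ E = 2 * n)
    {Mb : Type*} [TopologicalSpace Mb] [T2Space Mb] [ChartedSpace E Mb]
    [IsManifold 𝓘(ℝ, E) ∞ Mb]
    -- its Kähler-Norden structure, of constant totally real sectional curvatures `ν` and `ν'`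
    (g : KNorden.SemiRiemannianMetric E Mb) (J : KNorden.NordenStructure g)
    (cov : CovariantDerivative 𝓘(ℝ, E) E (TangentSpace 𝓘(ℝ, E) : Mb → Type _))
    (hcov : KNorden.IsLeviCivita g cov) (hJ : KNorden.IsParallel J cov)
    (ν ν' : Mb → ℝ) (hν : KNorden.HasConstantTotallyRealCurvatures g J cov ν ν')
    -- the hypersurface
    {F : Type*} [NormedAddCommGroup F] [NormedSpace ℝ F] [FiniteDimensional ℝ F]
    (hF : Module.finrank ℝ F + 1 = 2 * n)
    {M : Type*} [TopologicalSpace M] [T2Space M] [ChartedSpace F M]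
    [IsManifold 𝓘(ℝ, F) ∞ M]
    (f : M → Mb) (hf : Manifold.IsImmersion 𝓘(ℝ, F) 𝓘(ℝ, E) ∞ f)
    (hlight : KNorden.IsLightlike F g f)
    (S : KNorden.ScreenDistribution F g f) (hrad : KNorden.IsRadicalTransversal J S)
    (humb : KNorden.IsTotallyUmbilical cov S) :
    (∀ p : M, ν (f p) = 0) ∧
    ∀ (U : Set M) (ξ : KNorden.VField F M) (N : Π p : M, TangentSpace 𝓘(ℝ, E) (f p))
      (b ρ : M → ℝ),
      KNorden.IsNullPair S U ξ N →
      (∀ p ∈ U, J.J (f p) (KNorden.df E F f p (ξ p)) = b p • N p) →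
      KNorden.IsUmbilicFactor F cov g f U N ρ →
      ∀ p ∈ U,
        b p ≠ 0 ∧
        b p * ν' (f p) - ρ p ^ 2 + mvfderiv 𝓘(ℝ, F) ρ p (ξ p)
          + ρ p * KNorden.tauForm cov f N p (ξ p) = 0 ∧
        (∀ X : TangentSpace 𝓘(ℝ, F) p,
          mvfderiv 𝓘(ℝ, F) ρ p (S.P p X) + ρ p * KNorden.tauForm cov f N p (S.P p X) = 0) ∧
        (∀ X Y Z : KNorden.VField F M,
          KNorden.IsSmoothOn X U → KNorden.IsSmoothOn Y U → KNorden.IsSmoothOn Z U →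
          KNorden.df E F f p (KNorden.curvature (KNorden.inducedConnection cov S) X Y Z p) =
            (ν' (f p) - ρ p ^ 2 / b p) •
              (KNorden.inducedMetric g f p (X p) (Z p) •
                  J.J (f p) (KNorden.df E F f p (S.P p (Y p)))
                - KNorden.inducedMetric g f p (Y p) (Z p) •
                  J.J (f p) (KNorden.df E F f p (S.P p (X p))))
            + ν' (f p) •
              (g.val (f p) (KNorden.df E F f p (X p)) (J.J (f p) (KNorden.df E F f p (Z p))) •
                  KNorden.df E F f p (Y p)
                - g.val (f p) (KNorden.df E F f p (Y p)) (J.J (f p) (KNorden.df E F f p (Z p))) •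
                  KNorden.df E F f p (X p))) ∧
        (∀ X Y : TangentSpace 𝓘(ℝ, F) p,
          KNorden.ricciAt (KNorden.inducedConnection cov S) p X Y =
            -2 * ((n : ℝ) - 1) * ν' (f p) * KNorden.inducedAssoc J f p X Y
            + (ν' (f p) - ρ p ^ 2 / b p)
              * KNorden.inducedAssoc J f p (S.P p X) (S.P p Y)) := by
  have hdim : Module.finrank ℝ F + 1 = Module.finrank ℝ E := hF.trans hE.symm
  have hF1 : 1 < Module.finrank ℝ F := by omega
  have hfs := hf.contMDiff
  constructor
  · intro p
    obtain ⟨O, ξ, hO, hpO, hξ, hrO⟩ := KNorden.exists_radical_field hfs hlight S p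
    have hex : ∀ q, ∃ (N : TangentSpace 𝓘(ℝ, E) (f q)) (b : ℝ), q ∈ O →
        S.IsNullTransversal q (ξ q) N ∧ J.J (f q) (KNorden.df E F f q (ξ q)) = b • N := by
      intro q
      by_cases hq : q ∈ O
      · obtain ⟨N, b, h⟩ := KNorden.exists_isNullTransversal hrad (KNorden.df_injective hf q) hdim
          (hrO q hq).1 (hrO q hq).2
        exact ⟨N, b, fun _ ↦ h⟩
      · exact ⟨0, 0, fun h ↦ absurd h hq⟩
    choose N b hNb using hex
    have hpair : KNorden.IsNullPair S O ξ N :=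
      ⟨hO, hξ, fun q hq ↦ (hrO q hq).1, fun q hq ↦ (hrO q hq).2, fun q hq ↦ (hNb q hq).1⟩
    obtain ⟨ρ, hρ⟩ := humb O ξ N hpair
    exact ((KNorden.IsUmbilicPair.of_factor hf hdim hcov hpair (fun q hq ↦ (hNb q hq).2)
      hρ).codazzi_xi hfs hpO hF1 hcov hJ hν).1
  · intro U ξ N b ρ hpair hb hρ p hp
    have h := KNorden.IsUmbilicPair.of_factor hf hdim hcov hpair hb hρ
    have hfr := h.frame p hp
    refine ⟨hfr.b_ne_zero (h.J_eq p hp), (h.codazzi_xi hfs hp hF1 hcov hJ hν).2,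
      fun X ↦ h.codazzi_screen hfs hp hF1 hcov hJ hν (hfr.P_mem X),
      fun X Y Z hX hY hZ ↦ h.df_curvature_eq hfs hp hF1 hcov hJ hν hX hY hZ, fun X Y ↦ ?_⟩
    have hFn : (Module.finrank ℝ F : ℝ) = 2 * n - 1 := by
      have : ((Module.finrank ℝ F + 1 : ℕ) : ℝ) = (2 * n : ℕ) := by rw [hF]
      push_cast at this
      linarith
    rw [h.ricciAt_eq hfs hp hF1 hcov hJ hν, hFn]
    ring
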